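/- **Conventions.** Permutations act on the right, so $\sigma\tau$ means "first $\sigma$, then $\tau$"; $u^v=v^{-1}uv$ and $[u,v]=u^{-1}v^{-1}uv$. The bit-length of a group word is the number of symbols required to express it in the generators, where each generator is a single symbol and exponents are written in binary; the bit-length of a finite presentation is the number of its generators plus the sum of the bit-lengths of its relators. **Theorem.** Let $n$ be an integer with $14\le n\le 20$, $26\le n\le 44$ or $n\ge 50$. Let $p\equiv 11 \pmod{12}$ be a prime with $(n+2)/2\le p\le n-3$. Let $r,s$ be integers such that $\mathbb F_p^*=\langle r\rangle$ and $s(r-1)\equiv -1\pmod p$. Put $k=2p+4-n$; then $6\le k\le p+1$ and $n\equiv k\pmod 2$. The 3-generator 7-relator presentation $$\bar J=\langle a,g,y\mid a^p=b^{p-1},\ (a^s)^b=a^{s-1},\ (zz^a)^2=1,\ \tilde a=(\tilde a h)^y,\ c=c^y,\ [d,e^y]=1,\ y=w\rangle$$ with the words $b,z,h,\tilde a,c,d,e,w$ given below defines the symmetric group: $\bar J\cong S_n$. If $r,s$ are chosen with $|r|,|s|\le p$, then its bit-length is at most $C\log n$ for an absolute constant $C$ (independent of $n,p,r,s$). More precisely,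 there is $\alpha\in\mathbb F_p^*$ with $\alpha^3=r$; let $\alpha$ be such an element. Let $S_n=\mathrm{Sym}(\{-p+k-1,\dots,p+2\})$, and use the representatives $\{1,\dots,p\}$ for $\mathbb F_p$. There is an isomorphism $\bar\varphi:\bar J\to S_n$ for which the following hold, where $f\equiv\sigma$ means $\bar\varphi(f)=\sigma$. 1. $a\equiv(1,2,\dots,p)$, $\ g\equiv(x\mapsto\alpha x: x\in\mathbb F_p^*)(p,p+1,p+2)$, $\ y\equiv(-p-1+k,p+2)(-p+k,p+1)\cdots(-1,k+2)(0,k+1)$. 2. $b=g^3\equiv(x\mapsto rx: x\in\mathbb F_p^*)$, $\ z=g^{p-1}\equiv(p,p+1,p+2)$, $\ h=(b^2z(1)z(r))^{(p+1)/2}\equiv 1$, with $z(i)$ as in 3. 3. $z(i)=z^{a^i}\equiv(i,p+1,p+2)$ for $1\le i\le p$; $\ d(i,j)=z(i)z(j)^{-1}z(i)\equiv(i,j)(p+1,p+2)$ for $1\le i,j\le p$, $i\ne j$. The elements of $\bar J$ defined by the words $z(i)$ and $d(i,j)$, for integers $i,j$, depend only on $i,j$ modulo $p$. 4. $x=d(0,1)\equiv(1,p)(p+1,p+2)$,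 and $$c(i,j)=\begin{cases}a^{-j}(ax)^{j-i}a^i & 1\le i\le j\le p-1,\\ z^{(za)^{-2}}c(i,p-2) & 1\le i\le p-2,\ j=p,\\ z^{(za)^{-1}}c(i,p-1) & 1\le i\le p-1,\ j=p+1,\\ z\,c(i,p) & 1\le i\le p-2,\ j=p+2,\end{cases}$$ with $c(i,j)\equiv(i,i+1,\dots,j)(p+1,p+2)^{j-i}$ in each of these cases. 5. $b_2=b^{(p-1)/2}\equiv(1,p-1)(2,p-2)\cdots(\frac{p-1}2,\frac{p+1}2)$; $\ c_\bullet=c(1,\frac{p-1}2)\,c(\frac{p+1}2,p-1)^{-1}\equiv(1,2,\dots,\frac{p-1}2)(p-1,p-2,\dots,\frac{p+1}2)$; $\ v=(c_\bullet d(1,-1))^{(p-1)/2}\equiv(1,p-1)(2,p-2)\cdots(\frac{p-1}2,\frac{p+1}2)(p+1,p+2)$; $\ t=vb_2\equiv(p+1,p+2)$. 6. $\tilde a=z(3)^{z(2)z(1)}\equiv(1,2,3)$; $\ c=c(2,k)t\equiv(2,\dots,k)$ if $n$ is odd, $c=c(1,k)t\equiv(1,\dots,k)$ if $n$ is even; $\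 d=c(5,p+2)\equiv(5,\dots,p+2)$; $\ e=zat\,c(3,k+1)^{-1}\equiv(1,2,k+1,\dots,p+2)$ if $n$ is odd, $e=zat\,c(2,k+1)^{-1}\equiv(1,k+1,\dots,p+2)$ if $n$ is even. 7. $w$ is a word in $\{a,g\}\cup\{a^y,g^y\}$ (and inverses) with $w\equiv(-p-1+k,p+2)\cdots(0,k+1)\equiv y$, namely: - if $k=p+1$: $w=t^{yz}$; - if $k=p$: $w=z^{yz^{-1}}z^{yz}$; - if $k=p-1$: $w=z^{aya^{-1}z^{-1}}\,z^{aya^{-1}z}\,(d(1,p)t)^{ya^{-1}}$; - if $k\le p-2$: put $\tilde x=\big(d(1,k+2)d(2,k+1)\big)^{d(1,k+2)^y\,d(2,k+1)^y}\equiv(-1,k+2)(0,k+1)$ and $u=(za)(za)^y\equiv(1,\dots,p+2)(1,\dots,k,0,-1,\dots,-p-1+k)$, and let $w=(\tilde xu^{-2})^{(p-k)/2}\tilde xu^{p-k}$ if $n$ is odd, $w=t^{zay(za)^{-1}}(\tilde xu^{-2})^{(p-k-1)/2}\tilde xu^{p-k-1}$ if $n$ is even. -/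

import Mathlib

open MulOpposite

namespace SymPres

/-! ### Bit-length -/

/-- Expressions in the letters `X`, built by concatenation and integer powers. -/
inductive Expr (X : Type) : Type
  | empty : Expr X
  | letter (x : X) : Expr X
  | mul (e f : Expr X) : Expr X
  | pow (e : Expr X) (m : ℤ) : Expr X

namespace Expr

/-- The element of the free group that an expression denotes. -/
def eval {X : Type} : Expr X → FreeGroup X
  | empty => 1
  | letter x => FreeGroup.of x
  | mul e f => eval e * eval f
  | pow e m => eval e ^ m

/-- The number of symbols of an expression: every letter is one symbol, a power `(e)^±m` costs a
pair of parentheses, a sign, and the binary digits of `m`. -/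
def symbols {X : Type} : Expr X → ℕ
  | empty => 0
  | letter _ => 1
  | mul e f => symbols e + symbols f
  | pow e m => symbols e + 3 + max 1 m.natAbs.size

end Expr

/-- The bit-length of `w`: the number of symbols required to express `w` in terms of the letters,
exponents being written in binary. -/
noncomputable def bitLength {X : Type} (w : FreeGroup X) : ℕ :=
  sInf {l : ℕ | ∃ e : Expr X, e.eval = w ∧ e.symbols = l}

/-- The bit-length of a finite presentation: the number of generators plus the sum of the
bit-lengths of the relators. -/
noncomputable def presentationBitLength {X : Type} [Fintype X] {m : ℕ}
    (R : Fin m → FreeGroup X) : ℕ :=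
  Fintype.card X + ∑ i, bitLength (R i)

/-! ### The words and relators

Words are elements of the free group on three letters `a`, `g`, `y`. -/

/-- `x ^ h = h⁻¹ x h`. -/
def conj {G : Type} [Group G] (x h : G) : G := h⁻¹ * x * h

/-- `[x, h] = x⁻¹ h⁻¹ x h`. -/
def comm {G : Type} [Group G] (x h : G) : G := x⁻¹ * h⁻¹ * x * h

/-- The free group on the three generators. -/
abbrev F : Type := FreeGroup (Fin 3)

/-- The generator `a`. -/
def wa : F := FreeGroup.of 0

/-- The generator `g`. -/
def wg : F := FreeGroup.of 1

/-- The generator `y`. -/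
def wy : F := FreeGroup.of 2

/-- `b = g³`. -/
def wb : F := wg ^ (3 : ℤ)

/-- `z = g^(p-1)`. -/
def wz (p : ℤ) : F := wg ^ (p - 1)

/-- `z(i) = z^(a^i)`. -/
def wzi (p i : ℤ) : F := conj (wz p) (wa ^ i)

/-- `h = (b² z(1) z(r))^((p+1)/2)`. -/
def wh (p r : ℤ) : F := (wb ^ (2 : ℤ) * wzi p 1 * wzi p r) ^ ((p + 1) / 2)

/-- `d(i,j) = z(i) z(j)⁻¹ z(i)`. -/
def wdij (p i j : ℤ) : F := wzi p i * (wzi p j)⁻¹ * wzi p i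

/-- `x = d(0,1)`. -/
def wx (p : ℤ) : F := wdij p 0 1

/-- The first case of `c(i,j)`: the word `a^(-j) (a x)^(j-i) a^i`. -/
def wcLow (p i j : ℤ) : F := wa ^ (-j) * (wa * wx p) ^ (j - i) * wa ^ i

/-- The case `j = p` of `c(i,j)`. -/
def wcP (p i : ℤ) : F := conj (wz p) ((wz p * wa) ^ (-2 : ℤ)) * wcLow p i (p - 2)

/-- The word `c(i,j)`. -/
def wcij (p i j : ℤ) : F :=
  if j = p + 2 then wz p * wcP p i
  else if j = p + 1 then conj (wz p) ((wz p * wa) ^ (-1 : ℤ)) * wcLow p i (p - 1)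
  else if j = p then wcP p i
  else wcLow p i j

/-- The pairs `(i,j)` for which the word `c(i,j)` is used. -/
def CDefined (p i j : ℤ) : Prop :=
  (1 ≤ i ∧ i ≤ j ∧ j ≤ p - 1) ∨ (1 ≤ i ∧ i ≤ p - 2 ∧ j = p) ∨
    (1 ≤ i ∧ i ≤ p - 1 ∧ j = p + 1) ∨ (1 ≤ i ∧ i ≤ p - 2 ∧ j = p + 2)

/-- `b₂ = b^((p-1)/2)`. -/
def wb2 (p : ℤ) : F := wb ^ ((p - 1) / 2)

/-- `c_• = c(1,(p-1)/2) c((p+1)/2,p-1)⁻¹`. -/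
def wcdot (p : ℤ) : F := wcij p 1 ((p - 1) / 2) * (wcij p ((p + 1) / 2) (p - 1))⁻¹

/-- `v = (c_• d(1,-1))^((p-1)/2)`. -/
def wv (p : ℤ) : F := (wcdot p * wdij p 1 (-1)) ^ ((p - 1) / 2)

/-- `t = v b₂`. -/
def wt (p : ℤ) : F := wv p * wb2 p

/-- `ã = z(3)^(z(2) z(1))`. -/
def watilde (p : ℤ) : F := conj (wzi p 3) (wzi p 2 * wzi p 1)

/-- `k = 2p + 4 - n`. -/
def kk (n p : ℤ) : ℤ := 2 * p + 4 - n

/-- The word `c`. -/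
def wc (n p : ℤ) : F :=
  if Odd n then wcij p 2 (kk n p) * wt p else wcij p 1 (kk n p) * wt p

/-- The word `d`. -/
def wd (p : ℤ) : F := wcij p 5 (p + 2)

/-- The word `e`. -/
def we (n p : ℤ) : F :=
  if Odd n then wz p * wa * wt p * (wcij p 3 (kk n p + 1))⁻¹
  else wz p * wa * wt p * (wcij p 2 (kk n p + 1))⁻¹

/-- `x̃ = (d(1,k+2) d(2,k+1)) ^ (d(1,k+2)^y d(2,k+1)^y)`. -/
def wxtilde (n p : ℤ) : F :=
  conj (wdij p 1 (kk n p + 2) * wdij p 2 (kk n p + 1))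
    (conj (wdij p 1 (kk n p + 2)) wy * conj (wdij p 2 (kk n p + 1)) wy)

/-- `u = (z a) (z a)^y`. -/
def wu (p : ℤ) : F := wz p * wa * conj (wz p * wa) wy

/-- The word `w`. -/
def ww (n p : ℤ) : F :=
  if kk n p = p + 1 then conj (wt p) (wy * wz p)
  else if kk n p = p then
    conj (wz p) (wy * (wz p)⁻¹) * conj (wz p) (wy * wz p)
  else if kk n p = p - 1 then
    conj (wz p) (wa * wy * wa⁻¹ * (wz p)⁻¹) * conj (wz p) (wa * wy * wa⁻¹ * wz p) *
      conj (wdij p 1 p * wt p) (wy * wa⁻¹)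
  else if Odd n then
    (wxtilde n p * wu p ^ (-2 : ℤ)) ^ ((p - kk n p) / 2) * wxtilde n p * wu p ^ (p - kk n p)
  else
    conj (wt p) (wz p * wa * wy * (wz p * wa)⁻¹) *
      (wxtilde n p * wu p ^ (-2 : ℤ)) ^ ((p - kk n p - 1) / 2) * wxtilde n p *
      wu p ^ (p - kk n p - 1)

/-- The seven relators; a relation `u = v` is the relator `u v⁻¹`. -/
def relators (n p r s : ℤ) : Fin 7 → F :=
  ![wa ^ p * (wb ^ (p - 1))⁻¹,
    conj (wa ^ s) wb * (wa ^ (s - 1))⁻¹,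
    (wz p * conj (wz p) wa) ^ (2 : ℤ),
    watilde p * (conj (watilde p * wh p r) wy)⁻¹,
    wc n p * (conj (wc n p) wy)⁻¹,
    comm (wd p) (conj (we n p) wy),
    wy * (ww n p)⁻¹]

/-- The group defined by the presentation. -/
abbrev J (n p r s : ℤ) : Type := PresentedGroup (Set.range (relators n p r s))

/-! ### Permutations

Permutations act on the right, so a product `σ τ` means "first `σ`, then `τ`". This is the
multiplication of `(Equiv.Perm _)ᵐᵒᵖ`. -/

/-- Permutations of `ℤ`, multiplied from left to right. -/
abbrev RPerm : Type := (Equiv.Perm ℤ)ᵐᵒᵖ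

/-- The cycle `(x₁, …, x_m)`. -/
def cyc (l : List ℤ) : RPerm := op l.formPerm

/-- The list `i, i+1, …, j`. -/
def run (i j : ℤ) : List ℤ := (List.range (j + 1 - i).toNat).map fun m : ℕ => i + (m : ℤ)

/-- `(1,p-1)(2,p-2)⋯((p-1)/2,(p+1)/2)`. -/
def negPerm (p : ℤ) : RPerm := ((run 1 ((p - 1) / 2)).map fun i => cyc [i, p - i]).prod

/-- `(-p-1+k,p+2)(-p+k,p+1)⋯(-1,k+2)(0,k+1)`. -/
def ybar (p k : ℤ) : RPerm := ((run (-p - 1 + k) 0).map fun i => cyc [i, k + 1 - i]).prod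

/-- The representatives `{1, …, p}` of `ℤ/p`. -/
def reps (p : ℕ) [NeZero p] : ZMod p ≃ {x : ℤ // 1 ≤ x ∧ x ≤ (p : ℤ)} where
  toFun c := ⟨if c.val = 0 then (p : ℤ) else (c.val : ℤ), by
    have h1 := c.val_lt
    split_ifs <;> constructor <;> omega⟩
  invFun x := ((x : ℤ) : ZMod p)
  left_inv c := by
    by_cases h : c.val = 0
    · have h0 : c = 0 := (ZMod.val_eq_zero c).1 h
      simp [h0]
    · simp [h]
  right_inv x := by
    obtain ⟨x, hx1, hx2⟩ := x
    apply Subtype.ext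
    have hv : ((((x : ℤ) : ZMod p).val : ℕ) : ℤ) = x % (p : ℤ) := ZMod.val_intCast x
    rcases hx2.lt_or_eq with hlt | rfl
    · have hm : x % (p : ℤ) = x := Int.emod_eq_of_lt (by omega) hlt
      have hne : ((x : ℤ) : ZMod p).val ≠ 0 := by omega
      simp only [hne, if_false]
      omega
    · simp

/-- The permutation `x ↦ αx` of the representatives `{1, …, p}` of `ℤ/p`; it fixes `p` and every
integer outside `{1, …, p}`. -/
def mulPerm (p : ℕ) [NeZero p] (α : (ZMod p)ˣ) : RPerm :=
  op (Equiv.Perm.extendDomain (Units.mulLeft α) (reps p))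

/-- `S_n = Sym({-p+k-1, …, p+2})`, multiplied from left to right. -/
abbrev S (n p : ℤ) : Type :=
  (Equiv.Perm {x : ℤ // -p + kk n p - 1 ≤ x ∧ x ≤ p + 2})ᵐᵒᵖ

/-- An element of `Sym({-p+k-1, …, p+2})` as a permutation of `ℤ` that fixes all other integers. -/
def extend {n p : ℤ} (σ : S n p) : RPerm := op (Equiv.Perm.ofSubtype (unop σ))

/-- `Rep θ f σ` says `f ≡ σ`: the word `f` is mapped to the permutation `σ` by `θ`. -/
def Rep {n p r s : ℤ} (θ : J n p r s ≃* S n p) (f : F) (σ : RPerm) : Prop :=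
  extend (θ (PresentedGroup.mk _ f)) = σ

end SymPres

namespace SymPres

/-! ### Permutations acting on the right -/

/-! Let `G` be the presented group, `P = ⟨a, g⟩`, and `f` the map sending words to permutations of
`ℤ`. Computing the image of each word shows that the relators map to 1 (`map_relators`), so `f`
exists. Its image contains all transpositions of the interval (`surjective_of_images`). The
substance is injectivity, and it rests on applying Carmichael's presentation of the alternating
group twice: if `z i ^ 3 = 1` and `(z i * z j) ^ 2 = 1` for `i ≠ j`, and `f (z i) = (i, u, v)`, then
`f` is injective on the group generated by the `z i` (`carmichael_injective`).

First application, to `P`. The first two relations give `a ^ p = 1`, `b ^ (p - 1) = 1` and `a ^ b =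
a ^ r` (`affine_conj`), so `⟨a, b⟩` acts on the indices of the elements `z(i)` as the affine group
of the prime field. This action is 2-transitive, hence the one relation `(z z^a)^2 = 1` spreads to
all pairs (`wzi_mul_sq`), and `A = ⟨z(i)⟩` is alternating on `1, …, p + 2`. The word `h` maps to 1
and normalizes `A`, so it centralizes `A`. As `h` lies in the coset `b^2 A`, its power `(p - 1)/2`
is 1, while `ã = (ã h)^y` forces `h^3 = 1`. The exponents are coprime, so `h = 1` and `b^2 ∈ A`
(`wh_eq_one_and`). It follows that `a` and `g^2` lie in `A`, so `P = A ∪ A g`, and the sign shows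
that `f` is injective on `P` (`closure_ag_injective`).

Second application, to `G`. By the relations on `ã` and `c`, `y` centralizes the copy of `Sym(1, …,
k)` in `P` (`commute_y`). The relation `[d, e^y] = 1` makes `e^y` centralize `Sym(3, …, p + 2)`
(`commute_conj_e`), and this passes to the conjugates by `y` of elements `≡ (j, 1, 2)` with `j > k`
(`exists_cyc3_commute`). Thus the elements `≡ (i, 1, 2)`, taken in `P` for `i ≥ 3` and in `P^y` for
`i ≤ 0`, satisfy Carmichael's relations (`generators_mul_sq`). Together with a transposition `t ≡
(3, 4)` they generate `P` and `P^y`, hence `G`, because `y = w` with `w` a word in `P` and `P^y`.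
The sign again gives injectivity (`amalgam_injective`).

For the bit-length, each relator is built from a bounded number of products and powers with
exponents of size `O(p)` (`short_relators`). -/

/-- The image of `i` under the permutation `σ`. -/
def act (σ : RPerm) (i : ℤ) : ℤ := unop σ i

theorem act_mul (σ τ : RPerm) (i : ℤ) : act (σ * τ) i = act τ (act σ i) := rfl

@[simp] theorem act_one (i : ℤ) : act 1 i = i := rfl

/-- Most permutation identities below go through this: both sides become piecewise linear functions
of one integer, and the cases are decided by linear arithmetic. -/
theorem act_ext {σ τ : RPerm} (h : ∀ i, act σ i = act τ i) : σ = τ :=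
  unop_injective (Equiv.ext h)

@[simp] theorem act_inv_act (σ : RPerm) (i : ℤ) : act σ⁻¹ (act σ i) = i := by
  rw [← act_mul, mul_inv_cancel, act_one]

@[simp] theorem act_act_inv (σ : RPerm) (i : ℤ) : act σ (act σ⁻¹ i) = i := by
  rw [← act_mul, inv_mul_cancel, act_one]

theorem act_injective (σ : RPerm) : Function.Injective (act σ) := (unop σ).injective

theorem act_inv_eq {σ : RPerm} {i j : ℤ} (h : act σ j = i) : act σ⁻¹ i = j := by
  rw [← h, act_inv_act]

theorem cyc_cons_cons (x y : ℤ) (l : List ℤ) : cyc (x :: y :: l) = cyc (y :: l) * cyc [x, y] := by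
  simp [cyc, List.formPerm_cons_cons]

@[simp] theorem cyc_nil : cyc [] = 1 := rfl

@[simp] theorem cyc_singleton (x : ℤ) : cyc [x] = 1 := by simp [cyc]

theorem act_cyc2 (i j x : ℤ) :
    act (cyc [i, j]) x = if x = i then j else if x = j then i else x := by
  simp only [act, cyc, List.formPerm_pair, unop_op, Equiv.swap_apply_def]

theorem act_cyc3 {i j k : ℤ} (hij : i ≠ j) (hjk : j ≠ k) (hik : i ≠ k) (x : ℤ) :
    act (cyc [i, j, k]) x =
      if x = i then j else if x = j then k else if x = k then i else x := by
  rw [cyc_cons_cons, act_mul, act_cyc2, act_cyc2]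
  split_ifs <;> omega

theorem cyc_reverse (l : List ℤ) : cyc l.reverse = (cyc l)⁻¹ := by
  simp only [cyc, List.formPerm_reverse, op_inv]

/-- A cycle is a product of transpositions, and conjugation relabels the entries of a transposition.
With the right action the relabelling is by `σ` itself, not its inverse. -/
theorem conj_cyc (l : List ℤ) (σ : RPerm) : conj (cyc l) σ = cyc (l.map (act σ)) := by
  have h2 : ∀ x y, σ⁻¹ * cyc [x, y] * σ = cyc [act σ x, act σ y] := by
    intro x y
    apply act_ext
    intro i
    obtain ⟨j, rfl⟩ : ∃ j, act σ j = i := ⟨act σ⁻¹ i, act_act_inv σ i⟩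
    simp only [act_mul, act_inv_act, act_cyc2, (act_injective σ).eq_iff]
    split_ifs <;> rfl
  unfold conj
  induction l with
  | nil => simp
  | cons x l ih =>
    cases l with
    | nil => simp
    | cons y l =>
      simp only [List.map_cons] at ih ⊢
      rw [cyc_cons_cons x y l, cyc_cons_cons (act σ x), ← ih, ← h2]
      group

theorem cyc2_comm (i j : ℤ) : cyc [i, j] = cyc [j, i] := by
  simp only [cyc, List.formPerm_pair, Equiv.swap_comm]

@[simp] theorem cyc2_mul_self (i j : ℤ) : cyc [i, j] * cyc [i, j] = 1 := by
  apply act_ext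
  intro x
  simp only [act_mul, act_cyc2, act_one]
  split_ifs <;> omega

theorem cyc2_inv (i j : ℤ) : (cyc [i, j])⁻¹ = cyc [i, j] :=
  inv_eq_of_mul_eq_one_left (cyc2_mul_self i j)

theorem cyc3_pow {i j k : ℤ} (hij : i ≠ j) (hjk : j ≠ k) (hik : i ≠ k) :
    cyc [i, j, k] ^ 3 = 1 := by
  apply act_ext
  intro x
  simp only [pow_succ, pow_zero, act_mul, act_one, act_cyc3 hij hjk hik]
  split_ifs <;> omega

/-! ### Cycles along intervals -/

theorem run_eq_cons {a b : ℤ} (h : a ≤ b) : run a b = a :: run (a + 1) b := by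
  unfold run
  obtain ⟨m, rfl⟩ : ∃ m : ℕ, b = a + m := ⟨(b - a).toNat, by omega⟩
  rw [show (a + m + 1 - a).toNat = m + 1 by omega, show (a + m + 1 - (a + 1)).toNat = m by omega,
    List.range_succ_eq_map]
  simp only [List.map_cons, List.map_map, Nat.cast_zero, add_zero, List.cons.injEq, true_and]
  apply List.map_congr_left
  intro x _
  simp only [Function.comp, Nat.cast_succ]
  ring

theorem run_eq_nil {a b : ℤ} (h : b < a) : run a b = [] := by
  unfold run
  rw [show (b + 1 - a).toNat = 0 by omega]
  rfl

theorem mem_run {a b x : ℤ} : x ∈ run a b ↔ a ≤ x ∧ x ≤ b := by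
  unfold run
  simp only [List.mem_map, List.mem_range]
  constructor
  · rintro ⟨m, hm, rfl⟩
    omega
  · intro h
    exact ⟨(x - a).toNat, by omega, by omega⟩

@[simp] theorem run_self (a : ℤ) : run a a = [a] := by
  rw [run_eq_cons le_rfl, run_eq_nil (by omega)]

/-- Induction along the interval from the top downwards. -/
theorem run_induction {b : ℤ} {P : ℤ → Prop} (hb : P b) (hs : ∀ a < b, P (a + 1) → P a) {a : ℤ}
    (h : a ≤ b) : P a := by
  obtain ⟨m, hm⟩ : ∃ m : ℕ, a = b - m := ⟨(b - a).toNat, by omega⟩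
  subst hm
  clear h
  induction m with
  | zero => simpa using hb
  | succ m ih =>
    apply hs _ (by push_cast; omega)
    convert ih using 1
    push_cast
    ring

theorem act_cyc_run {a b : ℤ} (h : a ≤ b) (x : ℤ) :
    act (cyc (run a b)) x = if x = b then a else if a ≤ x ∧ x < b then x + 1 else x := by
  revert x
  refine run_induction (P := fun a => ∀ x, act (cyc (run a b)) x =
    if x = b then a else if a ≤ x ∧ x < b then x + 1 else x) ?_ ?_ h
  · intro x
    rw [run_self, cyc_singleton, act_one]
    split_ifs <;> omega
  · intro a ha ih x
    rw [run_eq_cons ha.le, run_eq_cons (show a + 1 ≤ b by omega), cyc_cons_cons,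
      ← run_eq_cons (by omega), act_mul, ih, act_cyc2]
    split_ifs <;> omega

theorem act_cyc_run_inv {a b : ℤ} (h : a ≤ b) (x : ℤ) :
    act (cyc (run a b))⁻¹ x = if x = a then b else if a < x ∧ x ≤ b then x - 1 else x := by
  apply act_inv_eq
  rw [act_cyc_run h]
  split_ifs <;> omega

/-- The bound `m ≤ b` means that the orbit wraps around at most once, so no residues are needed. -/
theorem act_cyc_run_pow {b : ℤ} (h : 1 ≤ b) (m : ℕ) (hm : (m : ℤ) ≤ b) (x : ℤ) :
    act (cyc (run 1 b) ^ m) x =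
      if 1 ≤ x ∧ x ≤ b then (if x + m ≤ b then x + m else x + m - b) else x := by
  induction m with
  | zero =>
    simp only [pow_zero, act_one, Nat.cast_zero]
    split_ifs <;> omega
  | succ m ih =>
    rw [pow_succ, act_mul, ih (by push_cast at hm; omega), act_cyc_run h]
    push_cast at hm ⊢
    split_ifs <;> omega

theorem act_cyc_notMem {l : List ℤ} {x : ℤ} (h : x ∉ l) : act (cyc l) x = x :=
  List.formPerm_apply_of_notMem h

/-- Permutations with disjoint supports commute. -/
theorem commute_of_act {σ τ : RPerm} (h : ∀ x, act σ x = x ∨ act τ x = x) : Commute σ τ := by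
  have : Equiv.Perm.Disjoint (unop σ) (unop τ) := h
  apply unop_injective
  rw [unop_mul, unop_mul]
  exact this.commute.symm

/-! ### Products of the transpositions `(i, c - i)` -/

theorem act_prod_swap {c a b : ℤ} (h : 2 * b < c) (x : ℤ) :
    act ((run a b).map fun i => cyc [i, c - i]).prod x =
      if (a ≤ x ∧ x ≤ b) ∨ (c - b ≤ x ∧ x ≤ c - a) then c - x else x := by
  by_cases hab : a ≤ b
  · revert x
    refine run_induction (P := fun a => ∀ x, act ((run a b).map fun i => cyc [i, c - i]).prod x =
      if (a ≤ x ∧ x ≤ b) ∨ (c - b ≤ x ∧ x ≤ c - a) then c - x else x) ?_ ?_ hab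
    · intro x
      rw [run_self, List.map_singleton, List.prod_singleton, act_cyc2]
      split_ifs <;> omega
    · intro a ha ih x
      rw [run_eq_cons ha.le, List.map_cons, List.prod_cons, act_mul, ih, act_cyc2]
      split_ifs <;> omega
  · rw [run_eq_nil (by omega), List.map_nil, List.prod_nil, act_one]
    split_ifs <;> omega

theorem act_ybar {p k : ℤ} (hk : 0 ≤ k) (x : ℤ) :
    act (ybar p k) x =
      if (-p - 1 + k ≤ x ∧ x ≤ 0) ∨ (k + 1 ≤ x ∧ x ≤ p + 2) then k + 1 - x else x := by
  unfold ybar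
  rw [act_prod_swap (by omega)]
  split_ifs <;> omega

theorem act_negPerm {p : ℤ} (hp : Odd p) (x : ℤ) :
    act (negPerm p) x = if 1 ≤ x ∧ x ≤ p - 1 then p - x else x := by
  obtain ⟨m, rfl⟩ := hp
  unfold negPerm
  rw [act_prod_swap (by omega)]
  split_ifs <;> omega

/-! ### Conjugation identities and products of two 3-cycles -/

theorem map_conj {G H : Type} [Group G] [Group H] (φ : G →* H) (x h : G) :
    φ (conj x h) = conj (φ x) (φ h) := by
  simp [conj]

theorem conj_mul {G : Type} [Group G] (x h k : G) : conj x (h * k) = conj (conj x h) k := by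
  simp [conj, mul_assoc]

theorem mul_conj {G : Type} [Group G] (x y h : G) : conj (x * y) h = conj x h * conj y h := by
  simp [conj, mul_assoc]

theorem conj_eq_self {G : Type} [Group G] {x h : G} (H : Commute x h) : conj x h = x := by
  rw [conj, mul_assoc, H.eq, inv_mul_cancel_left]

theorem conj_inv_eq {G : Type} [Group G] {x y h : G} (H : conj y h = x) : conj x h⁻¹ = y := by
  rw [← H]
  simp [conj, mul_assoc]

/-- A product of two 3-cycles sharing `(u, v)` is a double transposition, hence an involution. This
is the source of Carmichael's relation and of the transpositions inside `h`. -/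
theorem cyc3_mul {i j u v : ℤ} (hij : i ≠ j) (hiu : i ≠ u) (hiv : i ≠ v) (hju : j ≠ u)
    (hjv : j ≠ v) (huv : u ≠ v) : cyc [i, u, v] * cyc [j, u, v] = cyc [i, v] * cyc [j, u] := by
  apply act_ext
  intro x
  simp (disch := omega) only [act_mul, act_cyc3, act_cyc2]
  split_ifs <;> omega

theorem commute_cyc2 {i j k l : ℤ} (hik : i ≠ k) (hil : i ≠ l) (hjk : j ≠ k) (hjl : j ≠ l) :
    Commute (cyc [i, j]) (cyc [k, l]) := by
  apply commute_of_act
  intro x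
  simp only [act_cyc2]
  split_ifs <;> omega

theorem cyc3_mul_sq {i j u v : ℤ} (hij : i ≠ j) (hiu : i ≠ u) (hiv : i ≠ v) (hju : j ≠ u)
    (hjv : j ≠ v) (huv : u ≠ v) : (cyc [i, u, v] * cyc [j, u, v]) ^ 2 = 1 := by
  rw [cyc3_mul hij hiu hiv hju hjv huv,
    (commute_cyc2 hij hiu hjv.symm huv.symm).mul_pow, pow_two, pow_two, cyc2_mul_self,
    cyc2_mul_self, one_mul]

section words

variable {p : ℤ} (φ : F →* RPerm) (ha : φ wa = cyc (run 1 p)) (hz : φ (wz p) = cyc [p, p + 1, p + 2])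

/-! ### Words in `a` and `z` -/

theorem pow_a_period (hp : 1 ≤ p) : cyc (run 1 p) ^ p = 1 := by
  lift p to ℕ using by omega
  rw [zpow_natCast]
  apply act_ext
  intro x
  rw [act_cyc_run_pow hp _ le_rfl, act_one]
  split_ifs <;> omega

theorem pow_a_congr (hp : 1 ≤ p) {i j : ℤ} (h : i ≡ j [ZMOD p]) :
    cyc (run 1 p) ^ i = cyc (run 1 p) ^ j := by
  obtain ⟨m, hm⟩ := h.dvd
  rw [show j = i + p * m by omega, zpow_add, zpow_mul, pow_a_period hp, one_zpow, mul_one]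

theorem act_a_zpow (hp : 1 ≤ p) {i : ℤ} (hi : 0 ≤ i) (hip : i ≤ p) (x : ℤ) :
    act (cyc (run 1 p) ^ i) x =
      if 1 ≤ x ∧ x ≤ p then (if x + i ≤ p then x + i else x + i - p) else x := by
  lift i to ℕ using hi
  rw [zpow_natCast, act_cyc_run_pow hp _ hip]

include ha

theorem map_wzi_congr (hp : 1 ≤ p) {i j : ℤ} (h : i ≡ j [ZMOD p]) :
    φ (wzi p i) = φ (wzi p j) := by
  simp only [wzi, map_conj, map_zpow, ha, pow_a_congr hp h]

theorem map_wdij_congr (hp : 1 ≤ p) {i i' j j' : ℤ} (h : i ≡ i' [ZMOD p])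
    (h' : j ≡ j' [ZMOD p]) : φ (wdij p i j) = φ (wdij p i' j') := by
  simp only [wdij, map_mul, map_inv, map_wzi_congr φ ha hp h, map_wzi_congr φ ha hp h']

include hz

theorem map_wzi {i : ℤ} (hi : 1 ≤ i) (hip : i ≤ p) :
    φ (wzi p i) = cyc [i, p + 1, p + 2] := by
  rw [wzi, map_conj, map_zpow, ha, hz, conj_cyc]
  simp only [List.map_cons, List.map_nil, act_a_zpow (show 1 ≤ p by omega) (show 0 ≤ i by omega) hip]
  rw [if_pos (by omega), if_neg (by omega), if_neg (by omega), if_neg (by omega)]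
  congr 2
  ring

theorem map_wdij {i j : ℤ} (hi : 1 ≤ i) (hip : i ≤ p) (hj : 1 ≤ j) (hjp : j ≤ p) (hij : i ≠ j) :
    φ (wdij p i j) = cyc [i, j] * cyc [p + 1, p + 2] := by
  rw [wdij, map_mul, map_mul, map_inv, map_wzi φ ha hz hi hip, map_wzi φ ha hz hj hjp,
    ← cyc_reverse]
  apply act_ext
  intro x
  simp (disch := omega) only [List.reverse_cons, List.reverse_nil, List.nil_append,
    List.cons_append, act_mul, act_cyc3, act_cyc2]
  split_ifs <;> omega

theorem map_wx (hp : 5 ≤ p) : φ (wx p) = cyc [1, p] * cyc [p + 1, p + 2] := by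
  rw [wx, map_wdij_congr φ ha (by omega) (show 0 ≡ p [ZMOD p] by simp [Int.ModEq]) rfl,
    map_wdij φ ha hz (by omega) (by omega) (by omega) (by omega) (by omega), cyc2_comm]

theorem map_ax (hp : 5 ≤ p) : φ (wa * wx p) = cyc (run 1 (p - 1)) * cyc [p + 1, p + 2] := by
  rw [map_mul, ha, map_wx φ ha hz hp]
  apply act_ext
  intro x
  simp (disch := omega) only [act_mul, act_cyc_run, act_cyc2]
  split_ifs <;> omega

theorem map_za (hp : 5 ≤ p) : φ (wz p * wa) = cyc (run 1 (p + 2)) := by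
  rw [map_mul, ha, hz]
  apply act_ext
  intro x
  simp (disch := omega) only [act_mul, act_cyc_run, act_cyc3]
  split_ifs <;> omega

/-- The cycle `(1,…,p-1)` in `a x` skips the point `p`. Following its power `j - i` by `a ^ i`
therefore differs from `a ^ j` exactly by the cycle `(i,…,j)`; this is `key`. The factor `(p+1,p+2)`
commutes with both cycles and just accumulates its exponent. -/
theorem map_wcLow (hp : 5 ≤ p) {i j : ℤ} (hi : 1 ≤ i) (hij : i ≤ j) (hj : j ≤ p - 1) :
    φ (wcLow p i j) = cyc (run i j) * cyc [p + 1, p + 2] ^ (j - i) := by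
  have hT : Commute (cyc [p + 1, p + 2]) (cyc (run 1 p)) := by
    apply commute_of_act
    intro x
    simp (disch := omega) only [act_cyc_run, act_cyc2]
    split_ifs <;> omega
  have hT' : Commute (cyc (run 1 (p - 1))) (cyc [p + 1, p + 2]) := by
    apply commute_of_act
    intro x
    simp (disch := omega) only [act_cyc_run, act_cyc2]
    split_ifs <;> omega
  have key : cyc (run 1 (p - 1)) ^ (j - i) * cyc (run 1 p) ^ i = cyc (run 1 p) ^ j * cyc (run i j) := by
    obtain ⟨e, he⟩ : ∃ e : ℕ, j - i = e := ⟨(j - i).toNat, by omega⟩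
    rw [he, zpow_natCast]
    apply act_ext
    intro x
    rw [act_mul, act_mul, act_cyc_run_pow (by omega) _ (by omega),
      act_a_zpow (by omega) (by omega) (by omega), act_a_zpow (by omega) (by omega) (by omega),
      act_cyc_run hij]
    split_ifs <;> omega
  rw [wcLow, map_mul, map_mul, map_zpow, map_zpow, map_zpow, map_ax φ ha hz hp, ha, hT'.mul_zpow,
    mul_assoc, mul_assoc, (hT.zpow_zpow (j - i) i).eq, ← mul_assoc (_ ^ (j - i)), key, zpow_neg]
  simp only [mul_assoc, inv_mul_cancel_left]

/-- Pulling `z` back two steps along `z a ≡ (1,…,p+2)` gives `(p-2,p-1,p)`, which lengthens the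
cycle `(i,…,p-2)` by two points. The parity of the exponent of `(p+1,p+2)` is unchanged. -/
theorem map_wcP (hp : 5 ≤ p) {i : ℤ} (hi : 1 ≤ i) (hip : i ≤ p - 2) :
    φ (wcP p i) = cyc (run i p) * cyc [p + 1, p + 2] ^ (p - i) := by
  have h : conj (cyc [p, p + 1, p + 2]) (cyc (run 1 (p + 2)) ^ (-2 : ℤ)) =
      cyc [p - 2, p - 1, p] := by
    rw [zpow_neg]
    apply conj_inv_eq
    rw [conj_cyc]
    congr 1
    simp (disch := omega) [zpow_ofNat, pow_two, act_mul, act_cyc_run]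
    omega
  have hT : cyc [p + 1, p + 2] ^ (p - i) = cyc [p + 1, p + 2] ^ (p - 2 - i) := by
    rw [show p - i = 2 + (p - 2 - i) by ring, zpow_add, zpow_two, cyc2_mul_self, one_mul]
  rw [wcP, map_mul, map_conj, map_zpow, map_za φ ha hz hp, hz, h,
    map_wcLow φ ha hz hp hi hip (by omega), ← mul_assoc, hT]
  congr 1
  apply act_ext
  intro x
  simp (disch := omega) only [act_mul, act_cyc_run, act_cyc3]
  split_ifs <;> omega

theorem map_wcij (hp : 5 ≤ p) {i j : ℤ} (h : CDefined p i j) :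
    φ (wcij p i j) = cyc (run i j) * cyc [p + 1, p + 2] ^ (j - i) := by
  have h' : conj (cyc [p, p + 1, p + 2]) (cyc (run 1 (p + 2)) ^ (-1 : ℤ)) =
      cyc [p - 1, p, p + 1] := by
    rw [zpow_neg, zpow_one]
    apply conj_inv_eq
    rw [conj_cyc]
    congr 1
    simp (disch := omega) [act_cyc_run]
    omega
  unfold wcij
  rcases h with ⟨h1, h2, h3⟩ | ⟨h1, h2, rfl⟩ | ⟨h1, h2, rfl⟩ | ⟨h1, h2, rfl⟩
  · rw [if_neg (by omega), if_neg (by omega), if_neg (by omega), map_wcLow φ ha hz hp h1 h2 h3]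
  · rw [if_neg (by omega), if_neg (by omega), if_pos rfl, map_wcP φ ha hz hp h1 h2]
  · rw [if_neg (by omega), if_pos rfl, map_mul, map_conj, map_zpow, map_za φ ha hz hp, hz, h',
      map_wcLow φ ha hz hp h1 h2 (by omega), ← mul_assoc, show p + 1 - i = 2 + (p - 1 - i) by ring,
      zpow_add, zpow_two, cyc2_mul_self, one_mul]
    congr 1
    apply act_ext
    intro x
    simp (disch := omega) only [act_mul, act_cyc_run, act_cyc3]
    split_ifs <;> omega
  · rw [if_pos rfl, map_mul, hz, map_wcP φ ha hz hp h1 h2, ← mul_assoc,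
      show p + 2 - i = 2 + (p - i) by ring, zpow_add, zpow_two, cyc2_mul_self, one_mul]
    congr 1
    apply act_ext
    intro x
    simp (disch := omega) only [act_mul, act_cyc_run, act_cyc3]
    split_ifs <;> omega

theorem map_watilde (hp : 5 ≤ p) : φ (watilde p) = cyc [1, 2, 3] := by
  rw [watilde, map_conj, map_mul, map_wzi φ ha hz (by omega) (by omega),
    map_wzi φ ha hz (by omega) (by omega), map_wzi φ ha hz (by omega) (by omega), conj_cyc]
  apply act_ext
  intro x
  simp (disch := omega) only [List.map_cons, List.map_nil, act_mul, act_cyc3, if_true, if_neg]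
  split_ifs <;> omega

theorem map_wz_conj_sq (hp : 5 ≤ p) : φ ((wz p * conj (wz p) wa) ^ (2 : ℤ)) = 1 := by
  have h := map_wzi φ ha hz (show 1 ≤ (1 : ℤ) by omega) (show 1 ≤ p by omega)
  rw [wzi, zpow_one] at h
  rw [map_zpow, map_mul, h, hz, zpow_ofNat,
    cyc3_mul_sq (by omega) (by omega) (by omega) (by omega) (by omega) (by omega)]

end words

/-! ### Multiplication modulo `p` -/

section modp

variable {p : ℕ} [Fact p.Prime]

/-- The representative in `{1, …, p}` of a residue class. -/
def rep (c : ZMod p) : ℤ := (reps p c : {x : ℤ // 1 ≤ x ∧ x ≤ (p : ℤ)})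

theorem one_le_rep (c : ZMod p) : 1 ≤ rep c := (reps p c).2.1

theorem rep_le (c : ZMod p) : rep c ≤ p := (reps p c).2.2

theorem cast_rep (c : ZMod p) : ((rep c : ℤ) : ZMod p) = c := (reps p).symm_apply_apply c

theorem rep_cast {x : ℤ} (h1 : 1 ≤ x) (h2 : x ≤ p) : rep (x : ZMod p) = x :=
  congrArg Subtype.val ((reps p).apply_symm_apply ⟨x, h1, h2⟩)

theorem rep_injective : Function.Injective (rep (p := p)) :=
  Subtype.val_injective.comp (reps p).injective

theorem rep_zero : rep (0 : ZMod p) = p := by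
  have h := (Fact.out : p.Prime).one_le
  have := rep_cast (p := p) (x := p) (by exact_mod_cast h) le_rfl
  simpa using this

theorem rep_one : rep (1 : ZMod p) = 1 := by
  have h := (Fact.out : p.Prime).one_le
  have := rep_cast (p := p) (x := 1) le_rfl (by exact_mod_cast h)
  simpa using this

theorem act_mulPerm_rep (α : (ZMod p)ˣ) (c : ZMod p) :
    act (mulPerm p α) (rep c) = rep ((α : ZMod p) * c) :=
  Equiv.Perm.extendDomain_apply_image (Units.mulLeft α) (reps p) c

theorem act_mulPerm_of_notMem (α : (ZMod p)ˣ) {x : ℤ} (h : ¬ (1 ≤ x ∧ x ≤ p)) :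
    act (mulPerm p α) x = x :=
  Equiv.Perm.extendDomain_apply_not_subtype (Units.mulLeft α) (reps p) h

theorem act_mulPerm_self (α : (ZMod p)ˣ) : act (mulPerm p α) p = p := by
  conv_lhs => rw [← rep_zero (p := p)]
  rw [act_mulPerm_rep, mul_zero, rep_zero]

/-- Two permutations agree if they agree on representatives and elsewhere. -/
theorem act_ext_rep {σ τ : RPerm} (h : ∀ c : ZMod p, act σ (rep c) = act τ (rep c))
    (h' : ∀ x, ¬ (1 ≤ x ∧ x ≤ (p : ℤ)) → act σ x = act τ x) : σ = τ := by
  apply act_ext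
  intro x
  by_cases hx : 1 ≤ x ∧ x ≤ p
  · rw [← rep_cast hx.1 hx.2]
    exact h _
  · exact h' x hx

theorem mulPerm_mul (α β : (ZMod p)ˣ) : mulPerm p α * mulPerm p β = mulPerm p (α * β) := by
  apply act_ext_rep (p := p)
  · intro c
    rw [act_mul, act_mulPerm_rep, act_mulPerm_rep, act_mulPerm_rep, Units.val_mul]
    congr 1
    ring
  · intro x hx
    rw [act_mul, act_mulPerm_of_notMem _ hx, act_mulPerm_of_notMem _ hx, act_mulPerm_of_notMem _ hx]

theorem mulPerm_one : mulPerm p 1 = 1 := by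
  have h := mulPerm_mul (p := p) 1 1
  rwa [one_mul, mul_eq_left] at h

theorem mulPerm_pow (α : (ZMod p)ˣ) (m : ℕ) : mulPerm p α ^ m = mulPerm p (α ^ m) := by
  induction m with
  | zero => rw [pow_zero, pow_zero, mulPerm_one]
  | succ m ih => rw [pow_succ, ih, mulPerm_mul, pow_succ]

theorem act_a_rep (c : ZMod p) : act (cyc (run 1 p)) (rep c) = rep (c + 1) := by
  have h1 := one_le_rep c
  have h2 := rep_le c
  rw [act_cyc_run (by omega)]
  split_ifs with h3 h4
  · have : c = 0 := rep_injective (h3.trans rep_zero.symm)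
    rw [this, zero_add, rep_one]
  · rw [← rep_cast (p := p) (show 1 ≤ rep c + 1 by omega) (by omega)]
    push_cast
    rw [cast_rep]
  · omega

theorem act_a_zpow_rep (c : ZMod p) (i : ℤ) :
    act (cyc (run 1 p) ^ i) (rep c) = rep (c + (i : ZMod p)) := by
  have key : ∀ (m : ℕ) (c : ZMod p), act (cyc (run 1 p) ^ m) (rep c) = rep (c + (m : ZMod p)) := by
    intro m
    induction m with
    | zero => simp
    | succ m ih =>
      intro c
      rw [pow_succ, act_mul, ih, act_a_rep]
      push_cast
      rw [add_assoc]
  obtain ⟨m, rfl | rfl⟩ := i.eq_nat_or_neg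
  · rw [zpow_natCast, key]
    simp
  · rw [zpow_neg, zpow_natCast]
    apply act_inv_eq
    rw [key]
    push_cast
    congr 1
    ring

theorem act_a_zpow_of_notMem (i : ℤ) {x : ℤ} (h : ¬ (1 ≤ x ∧ x ≤ p)) :
    act (cyc (run 1 p) ^ i) x = x := by
  have hp : (1 : ℤ) ≤ p := by exact_mod_cast (Fact.out : p.Prime).one_le
  have key : ∀ m : ℕ, act (cyc (run 1 p) ^ m) x = x := by
    intro m
    induction m with
    | zero => simp
    | succ m ih =>
      rw [pow_succ, act_mul, ih, act_cyc_run hp]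
      split_ifs <;> omega
  obtain ⟨m, rfl | rfl⟩ := i.eq_nat_or_neg
  · rw [zpow_natCast, key]
  · rw [zpow_neg, zpow_natCast]
    exact act_inv_eq (key m)

theorem conj_a_zpow_mulPerm (ρ : (ZMod p)ˣ) {r s : ℤ} (hr : (ρ : ZMod p) = r)
    (hs : s * (r - 1) ≡ -1 [ZMOD p]) :
    conj (cyc (run 1 p) ^ s) (mulPerm p ρ) = cyc (run 1 p) ^ (s - 1) := by
  have hs' : (s : ZMod p) * (r - 1) = -1 := by
    have := (ZMod.intCast_eq_intCast_iff _ _ p).2 hs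
    push_cast at this
    exact this
  rw [conj, mul_assoc, inv_mul_eq_iff_eq_mul]
  apply act_ext_rep (p := p)
  · intro c
    rw [act_mul, act_mul, act_mulPerm_rep, act_a_zpow_rep, act_a_zpow_rep, act_mulPerm_rep, hr]
    congr 1
    push_cast
    linear_combination hs'
  · intro x hx
    rw [act_mul, act_mul, act_mulPerm_of_notMem _ hx, act_a_zpow_of_notMem _ hx,
      act_a_zpow_of_notMem _ hx, act_mulPerm_of_notMem _ hx]

theorem mulPerm_neg_one (hp : Odd p) : mulPerm p (-1) = negPerm p := by
  have hp' : Odd (p : ℤ) := by exact_mod_cast hp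
  apply act_ext
  intro x
  rw [act_negPerm hp']
  by_cases hx : 1 ≤ x ∧ x ≤ p
  · conv_lhs => rw [← rep_cast hx.1 hx.2]
    rw [act_mulPerm_rep]
    split_ifs with h
    · rw [← rep_cast (p := p) (x := p - x) (by omega) (by omega)]
      simp
    · rw [show x = p by omega]
      simp [rep_zero]
  · rw [act_mulPerm_of_notMem _ hx, if_neg (by omega)]

end modp

/-! ### A primitive root modulo `p` -/

section primitive

variable {p : ℕ} [Fact p.Prime] {ρ : (ZMod p)ˣ} (hρ : Subgroup.zpowers ρ = ⊤)

theorem pow_pred_eq_one (α : (ZMod p)ˣ) : α ^ (p - 1) = 1 := ZMod.units_pow_card_sub_one_eq_one p α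

include hρ

theorem orderOf_primitive : orderOf ρ = p - 1 := by
  rw [← Nat.card_zpowers, hρ, Subgroup.card_top, Nat.card_eq_fintype_card,
    ZMod.card_units_eq_totient, Nat.totient_prime Fact.out]

theorem primitive_pow_half (hp : Odd p) : ρ ^ ((p - 1) / 2) = -1 := by
  obtain ⟨m, hm'⟩ := hp
  have h1 := orderOf_primitive hρ
  have hp1 := (Fact.out : p.Prime).one_lt
  rw [show (p - 1) / 2 = m by omega]
  have h2 : (ρ ^ m) ^ 2 = 1 := by
    rw [← pow_mul, show m * 2 = p - 1 by omega]
    exact pow_pred_eq_one ρ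
  have h3 : ρ ^ m ≠ 1 := pow_ne_one_of_lt_orderOf (by omega) (by omega)
  rw [Units.ext_iff] at h2 ⊢
  push_cast at h2 ⊢
  rcases eq_or_eq_neg_of_sq_eq_sq _ 1 (h2.trans (one_pow 2).symm) with h | h
  · exact absurd (Units.ext (by simpa using h)) h3
  · exact h

theorem exists_pow_eq {c : ZMod p} (hc : c ≠ 0) : ∃ m < p - 1, (ρ : ZMod p) ^ m = c := by
  have h : Units.mk0 c hc ∈ Subgroup.zpowers ρ := by rw [hρ]; trivial
  have hfin : IsOfFinOrder ρ := isOfFinOrder_of_finite ρ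
  rw [hfin.mem_zpowers_iff_mem_range_orderOf, orderOf_primitive hρ] at h
  simp only [Finset.mem_image, Finset.mem_range] at h
  obtain ⟨m, hm, h⟩ := h
  refine ⟨m, hm, ?_⟩
  rw [← Units.val_pow_eq_pow_val, h, Units.val_mk0]

end primitive

theorem act_pow_fixed {σ : RPerm} {x : ℤ} (h : act σ x = x) (m : ℕ) : act (σ ^ m) x = x := by
  induction m with
  | zero => rw [pow_zero, act_one]
  | succ m ih => rw [pow_succ, act_mul, ih, h]

/-- If a power of `σ` fixes `x`, it fixes the whole orbit of `x`. -/
theorem act_pow_orbit {σ : RPerm} {x : ℤ} {N : ℕ} (h : act (σ ^ N) x = x) (m : ℕ) :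
    act (σ ^ N) (act (σ ^ m) x) = act (σ ^ m) x := by
  rw [← act_mul, ← pow_add, add_comm, pow_add, act_mul, h]

theorem cyc2_pow_odd (i j : ℤ) {m : ℤ} (hm : Odd m) : cyc [i, j] ^ m = cyc [i, j] := by
  obtain ⟨l, rfl⟩ := hm
  rw [zpow_add, zpow_mul, zpow_two, cyc2_mul_self, one_zpow, one_mul, zpow_one]

theorem cyc2_pow_even (i j : ℤ) {m : ℤ} (hm : Even m) : cyc [i, j] ^ m = 1 := by
  obtain ⟨l, rfl⟩ := hm
  rw [← two_mul, zpow_mul, zpow_two, cyc2_mul_self, one_zpow]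

section words

variable {p : ℕ} [Fact p.Prime] {ρ : (ZMod p)ˣ} (φ : F →* RPerm)
  (ha : φ wa = cyc (run 1 p)) (hz : φ (wz p) = cyc [(p : ℤ), p + 1, p + 2])
  (hb : φ wb = mulPerm p ρ) (hρ : Subgroup.zpowers ρ = ⊤) (hp : 5 ≤ p) (hp4 : p % 4 = 3)

/-! ### The words that involve `b` -/

include hb hρ hp4 in
theorem map_wb2 : φ (wb2 p) = negPerm p := by
  have hodd : Odd p := by rw [Nat.odd_iff]; omega
  rw [wb2, map_zpow, hb, show ((p : ℤ) - 1) / 2 = ((p - 1) / 2 : ℕ) by omega, zpow_natCast,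
    mulPerm_pow, primitive_pow_half hρ hodd, mulPerm_neg_one hodd]

include ha hz hp hp4

omit [Fact p.Prime] in
theorem map_wcdot : φ (wcdot p) = cyc (run 1 (((p : ℤ) - 1) / 2)) *
    cyc (run (((p : ℤ) + 1) / 2) (p - 1)).reverse := by
  have h1 : CDefined p 1 (((p : ℤ) - 1) / 2) := by left; omega
  have h2 : CDefined p (((p : ℤ) + 1) / 2) (p - 1) := by left; omega
  rw [wcdot, map_mul, map_inv, map_wcij φ ha hz (by omega) h1, map_wcij φ ha hz (by omega) h2,
    cyc_reverse, mul_inv_rev, mul_assoc, ← mul_assoc (_ ^ _),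
    show (p : ℤ) - 1 - (p + 1) / 2 = (p - 1) / 2 - 1 by omega, mul_inv_cancel, one_mul]

omit [Fact p.Prime] in
-- Up to the factor `(p+1,p+2)`, `c_• d(1,-1)` is a single cycle of length `p - 1`: up through
-- `1,…,q`, then down from `p-1` to `q+1`, where `q = (p-1)/2`. Half its length is `q`, and the
-- power `q` is the reflection `x ↦ p - x`. Since `p ≡ 3` mod 4, `q` is odd and the factor
-- `(p+1,p+2)` survives.
theorem map_wv : φ (wv p) = negPerm p * cyc [(p : ℤ) + 1, p + 2] := by
  obtain ⟨q, hq⟩ : ∃ q : ℕ, p = 2 * q + 1 := ⟨p / 2, by omega⟩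
  have hq' : (p : ℤ) = 2 * q + 1 := by omega
  have hodd : Odd (p : ℤ) := ⟨q, hq'⟩
  have hd : φ (wdij p 1 (-1)) = cyc [1, (p : ℤ) - 1] * cyc [(p : ℤ) + 1, p + 2] := by
    rw [map_wdij_congr φ ha (by omega) rfl (show -1 ≡ (p : ℤ) - 1 [ZMOD p] by simp [Int.modEq_iff_dvd]),
      map_wdij φ ha hz (by omega) (by omega) (by omega) (by omega) (by omega)]
  have e1 : ((p : ℤ) - 1) / 2 = q := by omega
  have e2 : ((p : ℤ) + 1) / 2 = q + 1 := by omega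
  set κ := cyc (run 1 (q : ℤ)) * (cyc (run ((q : ℤ) + 1) (p - 1)))⁻¹ * cyc [1, (p : ℤ) - 1] with hκ
  have hact : ∀ x, act κ x = if 1 ≤ x ∧ x < q then x + 1 else if x = q then (p : ℤ) - 1 else
      if x = q + 1 then 1 else if q + 1 < x ∧ x ≤ p - 1 then x - 1 else x := by
    intro x
    simp (disch := omega) only [hκ, act_mul, act_cyc_run, act_cyc_run_inv, act_cyc2]
    split_ifs <;> omega
  have hpow : ∀ m : ℕ, m ≤ q → ∀ x, act (κ ^ m) x =
      if 1 ≤ x ∧ x ≤ q then (if x + m ≤ q then x + m else p + q - x - m) else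
      if q + 1 ≤ x ∧ x ≤ p - 1 then (if q + 1 ≤ x - m then x - m else 1 + m - x + q) else x := by
    intro m
    induction m with
    | zero =>
      intro _ x
      simp only [pow_zero, act_one, Nat.cast_zero]
      split_ifs <;> omega
    | succ m ih =>
      intro hm x
      rw [pow_succ, act_mul, ih (by omega), hact]
      push_cast
      split_ifs <;> omega
  have hT : Commute κ (cyc [(p : ℤ) + 1, p + 2]) := by
    apply commute_of_act
    intro x
    rw [hact, act_cyc2]
    split_ifs <;> omega
  have hqodd : Odd (q : ℤ) := by
    rw [Int.odd_iff]
    omega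
  rw [wv, map_zpow, map_mul, map_wcdot φ ha hz hp hp4, hd, cyc_reverse, e1, e2, ← mul_assoc, ← hκ,
    hT.mul_zpow, cyc2_pow_odd _ _ hqodd]
  congr 1
  apply act_ext
  intro x
  rw [zpow_natCast, hpow q le_rfl, act_negPerm hodd]
  split_ifs <;> omega

include hb hρ

theorem map_wt : φ (wt p) = cyc [(p : ℤ) + 1, p + 2] := by
  have hodd : Odd p := by rw [Nat.odd_iff]; omega
  have hodd' : Odd (p : ℤ) := by exact_mod_cast hodd
  rw [wt, map_mul, map_wv φ ha hz hp hp4, map_wb2 φ hb hρ hp4]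
  apply act_ext
  intro x
  simp only [act_mul, act_negPerm hodd', act_cyc2]
  split_ifs <;> omega

/-- Multiplication by `r²` has two orbits on the nonzero residues, the even and the odd powers of
`r`, each of length `(p-1)/2`. The product `z(1) z(r) ≡ (1,p+2)(r,p+1)` inserts `p+2` into the first
orbit and `p+1` into the second, so both become cycles of length `(p+1)/2`, the exponent in `h`. -/
theorem map_wh {r : ℤ} (hr : (ρ : ZMod p) = r) : φ (wh p r) = 1 := by
  obtain ⟨q, hq⟩ : ∃ q : ℕ, p = 2 * q + 1 := ⟨p / 2, by omega⟩
  have hq' : (p : ℤ) = 2 * q + 1 := by omega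
  have hord := orderOf_primitive hρ
  have hinj : ∀ m m' : ℕ, m < 2 * q → m' < 2 * q →
      rep ((ρ : ZMod p) ^ m) = rep ((ρ : ZMod p) ^ m') → m = m' := by
    intro m m' hm hm' h
    have h' := rep_injective h
    rw [← Units.val_pow_eq_pow_val, ← Units.val_pow_eq_pow_val, ← Units.ext_iff] at h'
    exact pow_injOn_Iio_orderOf (by simp only [Set.mem_Iio]; omega)
      (by simp only [Set.mem_Iio]; omega) h'
  have hpos := fun m : ℕ => one_le_rep ((ρ : ZMod p) ^ m)
  have hlt := fun m : ℕ => rep_le ((ρ : ZMod p) ^ m)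
  have h0 : rep ((ρ : ZMod p) ^ 0) = 1 := by rw [pow_zero, rep_one]
  have hne : rep ((ρ : ZMod p) ^ 1) ≠ 1 := by
    intro h
    have := hinj 1 0 (by omega) (by omega) (h.trans h0.symm)
    omega
  have hzr : φ (wzi p r) = cyc [rep ((ρ : ZMod p) ^ 1), (p : ℤ) + 1, p + 2] := by
    rw [map_wzi_congr φ ha (by omega) (show r ≡ rep ((ρ : ZMod p) ^ 1) [ZMOD p] from ?_),
      map_wzi φ ha hz (hpos 1) (hlt 1)]
    rw [← ZMod.intCast_eq_intCast_iff, cast_rep, pow_one, hr]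
  have hneP : ∀ m : ℕ, rep ((ρ : ZMod p) ^ m) ≠ p := by
    intro m h
    exact pow_ne_zero m ρ.ne_zero (rep_injective (h.trans rep_zero.symm))
  obtain ⟨σ, hσ⟩ : ∃ σ, σ = mulPerm p (ρ ^ 2) * (cyc [1, (p : ℤ) + 2] *
    cyc [rep ((ρ : ZMod p) ^ 1), (p : ℤ) + 1]) := ⟨_, rfl⟩
  have hM : ∀ m : ℕ, act (mulPerm p (ρ ^ 2)) (rep ((ρ : ZMod p) ^ m)) =
      rep ((ρ : ZMod p) ^ (m + 2)) := by
    intro m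
    rw [act_mulPerm_rep, Units.val_pow_eq_pow_val, pow_add, mul_comm]
  have hwrap : ∀ m : ℕ, (ρ : ZMod p) ^ (m + 2 * q) = (ρ : ZMod p) ^ m := by
    intro m
    have := pow_pred_eq_one ρ
    rw [show p - 1 = 2 * q by omega, Units.ext_iff] at this
    push_cast at this
    rw [pow_add, this, mul_one]
  have hp1 := hpos 1
  have hl1 := hlt 1
  -- Before the end of an orbit the image is neither 1 nor `r`, so the two transpositions leave it
  -- alone.
  have hstep : ∀ m : ℕ, m + 2 < 2 * q →
      act σ (rep ((ρ : ZMod p) ^ m)) = rep ((ρ : ZMod p) ^ (m + 2)) := by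
    intro m hm
    have h1 : rep ((ρ : ZMod p) ^ (m + 2)) ≠ 1 := by
      intro h
      have := hinj _ 0 hm (by omega) (h.trans h0.symm)
      omega
    have h2 : rep ((ρ : ZMod p) ^ (m + 2)) ≠ rep ((ρ : ZMod p) ^ 1) := by
      intro h
      have := hinj _ 1 hm (by omega) h
      omega
    have := hpos (m + 2)
    have := hlt (m + 2)
    rw [hσ, act_mul, hM, act_mul, act_cyc2, act_cyc2]
    split_ifs <;> omega
  -- the two long orbits, with end points `p + 2` and `p + 1`
  have horb : ∀ (ε : ℕ) (E : ℤ), ε < 2 → act σ (rep ((ρ : ZMod p) ^ (ε + 2 * (q - 1)))) = E →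
      act σ E = rep ((ρ : ZMod p) ^ ε) →
      (∀ j < q, act (σ ^ (q + 1)) (rep ((ρ : ZMod p) ^ (ε + 2 * j))) =
        rep ((ρ : ZMod p) ^ (ε + 2 * j))) ∧ act (σ ^ (q + 1)) E = E := by
    intro ε E hε h1 h2
    have hj : ∀ j < q, act (σ ^ j) (rep ((ρ : ZMod p) ^ ε)) = rep ((ρ : ZMod p) ^ (ε + 2 * j)) := by
      intro j
      induction j with
      | zero => intro _; simp
      | succ j ih =>
        intro hj
        rw [pow_succ, act_mul, ih (by omega), hstep _ (by omega)]
        rfl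
    have hE : act (σ ^ q) (rep ((ρ : ZMod p) ^ ε)) = E := by
      rw [show q = (q - 1) + 1 by omega, pow_succ, act_mul, hj _ (by omega), h1]
    have hfix : act (σ ^ (q + 1)) (rep ((ρ : ZMod p) ^ ε)) = rep ((ρ : ZMod p) ^ ε) := by
      rw [pow_succ, act_mul, hE, h2]
    refine ⟨fun j hjq => ?_, ?_⟩
    · rw [← hj j hjq, act_pow_orbit hfix]
    · rw [← hE, act_pow_orbit hfix]
  have hA := horb 0 (p + 2) (by omega)
    (by
      rw [hσ, act_mul, hM, show 0 + 2 * (q - 1) + 2 = 0 + 2 * q by omega, hwrap, act_mul, act_cyc2,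
        act_cyc2, h0]
      split_ifs <;> omega)
    (by
      rw [hσ, act_mul, act_mulPerm_of_notMem _ (by omega), act_mul, act_cyc2, act_cyc2, h0]
      split_ifs <;> omega)
  have hB := horb 1 (p + 1) (by omega)
    (by
      rw [hσ, act_mul, hM, show 1 + 2 * (q - 1) + 2 = 1 + 2 * q by omega, hwrap, act_mul, act_cyc2,
        act_cyc2]
      split_ifs <;> omega)
    (by
      rw [hσ, act_mul, act_mulPerm_of_notMem _ (by omega), act_mul, act_cyc2, act_cyc2]
      split_ifs <;> omega)
  have hσ' : φ (wb ^ (2 : ℤ) * wzi p 1 * wzi p r) = σ := by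
    rw [map_mul, map_mul, map_zpow, hb, hzr, map_wzi φ ha hz (by omega) (by omega), mul_assoc,
      cyc3_mul (by omega) (by omega) (by omega) (by omega) (by omega) (by omega), zpow_ofNat,
      mulPerm_pow, hσ]
  rw [wh, map_zpow, hσ', show ((p : ℤ) + 1) / 2 = (q + 1 : ℕ) by omega, zpow_natCast]
  apply act_ext_rep (p := p)
  · intro c
    rw [act_one]
    by_cases hc : c = 0
    · apply act_pow_fixed
      have := hneP 1
      rw [hc, rep_zero, hσ, act_mul, act_mulPerm_self, act_mul, act_cyc2, act_cyc2]
      split_ifs <;> omega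
    · obtain ⟨m, hm, rfl⟩ := exists_pow_eq hρ hc
      rcases Nat.even_or_odd' m with ⟨j, rfl | rfl⟩
      · have := hA.1 j (by omega)
        rwa [zero_add] at this
      · have := hB.1 j (by omega)
        rwa [add_comm 1 (2 * j)] at this
  · intro x hx
    rw [act_one]
    by_cases h1 : x = p + 1
    · rw [h1, hB.2]
    by_cases h2 : x = p + 2
    · rw [h2, hA.2]
    apply act_pow_fixed
    rw [hσ, act_mul, act_mulPerm_of_notMem _ hx, act_mul, act_cyc2, act_cyc2]
    split_ifs <;> omega

end words

theorem act_ybar_inv {p k : ℤ} (hk : 0 ≤ k) (x : ℤ) :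
    act (ybar p k)⁻¹ x =
      if (-p - 1 + k ≤ x ∧ x ≤ 0) ∨ (k + 1 ≤ x ∧ x ≤ p + 2) then k + 1 - x else x := by
  apply act_inv_eq
  rw [act_ybar hk]
  split_ifs <;> omega

section words

variable {n p : ℤ} (φ : F →* RPerm) (hp : 11 ≤ p) (hpo : Odd p)
  (ha : φ wa = cyc (run 1 p)) (hz : φ (wz p) = cyc [p, p + 1, p + 2])
  (ht : φ (wt p) = cyc [p + 1, p + 2]) (hy : φ wy = ybar p (kk n p))
  (hk : 6 ≤ kk n p) (hkp : kk n p ≤ p + 1)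

theorem odd_kk_iff : Odd (kk n p) ↔ Odd n := by
  unfold kk
  rw [Int.odd_iff, Int.odd_iff]
  omega

/-! ### The words `c`, `d`, `e` -/

include hp hpo ha hz

theorem map_wd : φ (wd p) = cyc (run 5 (p + 2)) := by
  have h : CDefined p 5 (p + 2) := by unfold CDefined; omega
  rw [wd, map_wcij φ ha hz (by omega) h, cyc2_pow_even, mul_one]
  rw [Int.even_iff]
  rw [Int.odd_iff] at hpo
  omega

include ht hk hkp

theorem map_wc : φ (wc n p) =
    if Odd n then cyc (run 2 (kk n p)) else cyc (run 1 (kk n p)) := by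
  have hodd := odd_kk_iff (n := n) (p := p)
  rw [Int.odd_iff] at hodd
  rw [Int.odd_iff] at hpo
  unfold wc
  split_ifs with h
  · have hk2 := hodd.2 h
    have hd : CDefined p 2 (kk n p) := by unfold CDefined; omega
    rw [map_mul, map_wcij φ ha hz (by omega) hd, ht, cyc2_pow_odd, mul_assoc, cyc2_mul_self, mul_one]
    rw [Int.odd_iff]
    omega
  · have hk2 := mt hodd.1 h
    have hd : CDefined p 1 (kk n p) := by unfold CDefined; omega
    rw [map_mul, map_wcij φ ha hz (by omega) hd, ht, cyc2_pow_odd, mul_assoc, cyc2_mul_self, mul_one]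
    rw [Int.odd_iff]
    omega

/-- Multiplying `(1,…,p+2)` by the inverse of the run ending at `k + 1` makes a shortcut past the
points of that run up to `k`. The exponent of `(p+1,p+2)` in that word is odd in both cases, and `t`
cancels it. -/
theorem map_we : φ (we n p) =
    if Odd n then cyc (1 :: 2 :: run (kk n p + 1) (p + 2))
      else cyc (1 :: run (kk n p + 1) (p + 2)) := by
  have hodd := odd_kk_iff (n := n) (p := p)
  rw [Int.odd_iff] at hodd
  rw [Int.odd_iff] at hpo
  unfold we
  split_ifs with h
  · have hk2 := hodd.2 h
    have hd : CDefined p 3 (kk n p + 1) := by unfold CDefined; omega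
    have ho : Odd (kk n p + 1 - 3) := by rw [Int.odd_iff]; omega
    rw [map_mul, map_mul, map_za φ ha hz (by omega), map_inv, map_wcij φ ha hz (by omega) hd, ht,
      cyc2_pow_odd _ _ ho, mul_inv_rev, cyc2_inv, mul_assoc, ← mul_assoc (cyc [p + 1, p + 2]),
      cyc2_mul_self, one_mul, run_eq_cons (show kk n p + 1 ≤ p + 2 by omega), cyc_cons_cons,
      cyc_cons_cons, ← run_eq_cons (show kk n p + 1 ≤ p + 2 by omega)]
    generalize kk n p = k at *
    apply act_ext
    intro x
    simp (disch := omega) only [act_mul, act_cyc_run, act_cyc_run_inv, act_cyc2]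
    split_ifs <;> omega
  · have hk2 := mt hodd.1 h
    have hd : CDefined p 2 (kk n p + 1) := by unfold CDefined; omega
    have ho : Odd (kk n p + 1 - 2) := by rw [Int.odd_iff]; omega
    rw [map_mul, map_mul, map_za φ ha hz (by omega), map_inv, map_wcij φ ha hz (by omega) hd, ht,
      cyc2_pow_odd _ _ ho, mul_inv_rev, cyc2_inv, mul_assoc, ← mul_assoc (cyc [p + 1, p + 2]),
      cyc2_mul_self, one_mul, run_eq_cons (show kk n p + 1 ≤ p + 2 by omega), cyc_cons_cons,
      ← run_eq_cons (show kk n p + 1 ≤ p + 2 by omega)]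
    generalize kk n p = k at *
    apply act_ext
    intro x
    simp (disch := omega) only [act_mul, act_cyc_run, act_cyc_run_inv, act_cyc2]
    split_ifs <;> omega

omit hpo ht
omit hkp
include hy

/-! ### The words `x̃` and `u` -/

/-- The factors `(p+1,p+2)` cancel, leaving `(1,k+2)(2,k+1)`. As `y` fixes 1 and 2 and sends `k+2`
to `-1` and `k+1` to `0`, the conjugating element moves 1 to `-1` and 2 to `0` and fixes `k+1` and
`k+2`. -/
theorem map_wxtilde (h : kk n p ≤ p - 2) : φ (wxtilde n p) =
    cyc [-1, kk n p + 2] * cyc [0, kk n p + 1] := by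
  have h1 := map_wdij φ ha hz (i := 1) (j := kk n p + 2) (by omega) (by omega) (by omega) (by omega)
    (by omega)
  have h2 := map_wdij φ ha hz (i := 2) (j := kk n p + 1) (by omega) (by omega) (by omega) (by omega)
    (by omega)
  rw [wxtilde, map_conj, map_mul, map_mul, map_conj, map_conj, h1, h2, hy]
  generalize kk n p = k at *
  have hc : Commute (cyc [p + 1, p + 2]) (cyc [2, k + 1]) :=
    commute_cyc2 (by omega) (by omega) (by omega) (by omega)
  rw [mul_assoc (cyc [1, k + 2]), ← mul_assoc (cyc [p + 1, p + 2]), hc.eq, mul_assoc, cyc2_mul_self,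
    mul_one, mul_conj, mul_conj, mul_conj]
  simp (disch := omega) only [conj_cyc, List.map_cons, List.map_nil, act_ybar, act_mul, act_cyc2,
    if_pos, if_neg, if_true]
  congr 3 <;> ring

include hkp in
theorem map_wu : φ (wu p) = cyc (run 1 (p + 2)) *
    cyc (run 1 (kk n p) ++ (run (-p - 1 + kk n p) 0).reverse) := by
  rw [wu, map_mul, map_conj, map_za φ ha hz (by omega), hy, conj_cyc]
  generalize kk n p = k at *
  congr 2
  apply List.ext_getElem
  · simp only [run, List.length_map, List.length_range, List.length_append, List.length_reverse]
    omega
  · intro i h1 h2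
    simp only [run, List.length_map, List.length_range, List.length_append,
      List.length_reverse] at h1 h2
    simp only [run, List.getElem_map, List.getElem_range, List.getElem_append, List.length_map,
      List.length_range, List.getElem_reverse]
    rw [act_ybar (by omega)]
    split_ifs <;> omega

/-- Above `k` only the factor `z a` moves the point, and at or below 0 only `(z a)^y` does. So `u`
shifts both ends outward by one. -/
theorem act_wu (x : ℤ) : (-p + kk n p ≤ x ∧ x ≤ 0 → act (φ (wu p)) x = x - 1) ∧
    (kk n p + 1 ≤ x ∧ x ≤ p + 1 → act (φ (wu p)) x = x + 1) := by
  rw [wu, map_mul, map_conj, map_za φ ha hz (by omega), hy, conj]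
  generalize kk n p = k at *
  simp (disch := omega) only [act_mul, act_ybar, act_ybar_inv, act_cyc_run]
  constructor <;> intro h <;> split_ifs <;> omega

theorem conj_wxtilde_wu (h : kk n p ≤ p - 2) (m : ℕ) (hm : kk n p + 2 * m ≤ p) :
    conj (φ (wxtilde n p)) (φ (wu p) ^ (2 * m)) =
      cyc [-1 - 2 * (m : ℤ), kk n p + 2 + 2 * m] * cyc [-2 * (m : ℤ), kk n p + 1 + 2 * m] := by
  have hu := act_wu φ hp ha hz hy hk
  induction m with
  | zero =>
    rw [map_wxtilde φ hp ha hz hy hk h]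
    simp [conj]
  | succ m ih =>
    push_cast at hm
    rw [show 2 * (m + 1) = 2 * m + 1 + 1 by ring, pow_succ, pow_succ, conj_mul, conj_mul,
      ih (by omega)]
    simp only [mul_conj, conj_cyc, List.map_cons, List.map_nil]
    push_cast
    rw [(hu (-1 - 2 * m)).1 (by omega), (hu (-1 - 2 * m - 1)).1 (by omega),
      (hu (-2 * m)).1 (by omega), (hu (-2 * m - 1)).1 (by omega),
      (hu (kk n p + 2 + 2 * m)).2 (by omega), (hu (kk n p + 2 + 2 * m + 1)).2 (by omega),
      (hu (kk n p + 1 + 2 * m)).2 (by omega), (hu (kk n p + 1 + 2 * m + 1)).2 (by omega)]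
    congr 3 <;> ring_nf

/-- The word telescopes to the product of the conjugates of `x̃` by `u^0, u^2, …, u^(2m)`. Each
contributes the next two transpositions `(-i, k+1+i)`, so together they cover `0 ≤ i ≤ 2m+1`. -/
theorem act_wxtilde_prod (h : kk n p ≤ p - 2) (m : ℕ) (hm : kk n p + 2 * m ≤ p) (x : ℤ) :
    act (φ ((wxtilde n p * wu p ^ (-2 : ℤ)) ^ m * wxtilde n p * wu p ^ (2 * m))) x =
      if (-1 - 2 * (m : ℤ) ≤ x ∧ x ≤ 0) ∨ (kk n p + 1 ≤ x ∧ x ≤ kk n p + 2 + 2 * m) then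
        kk n p + 1 - x else x := by
  induction m generalizing x with
  | zero =>
    simp only [pow_zero, one_mul, mul_zero, mul_one, Nat.cast_zero,
      map_wxtilde φ hp ha hz hy hk h, act_mul, act_cyc2]
    split_ifs <;> first | omega | contradiction
  | succ m ih =>
    have e : (wxtilde n p * wu p ^ (-2 : ℤ)) ^ (m + 1) * wxtilde n p * wu p ^ (2 * (m + 1)) =
        (wxtilde n p * wu p ^ (-2 : ℤ)) ^ m * wxtilde n p * wu p ^ (2 * m) *
          conj (wxtilde n p) (wu p ^ (2 * (m + 1))) := by
      rw [conj, pow_succ, zpow_neg, zpow_ofNat, mul_add, pow_add, mul_one]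
      group
    rw [e, map_mul, act_mul, ih (by push_cast at hm; omega), map_conj, map_pow,
      conj_wxtilde_wu φ hp ha hz hy hk h _ hm, act_mul, act_cyc2, act_cyc2]
    push_cast at hm ⊢
    split_ifs <;> omega

/-! ### The word `w` -/

omit ha hk in
theorem map_ww_of_eq (h : kk n p = p) : φ (ww n p) = ybar p (kk n p) := by
  rw [h] at hy ⊢
  have e1 : φ (conj (wz p) (wy * (wz p)⁻¹)) = cyc [p + 2, 0, -1] := by
    rw [map_conj, map_mul, map_inv, hy, hz, conj_cyc, ← cyc_reverse]
    congr 1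
    simp (disch := omega) only [List.map_cons, List.map_nil, act_mul, act_ybar, act_cyc3,
      List.reverse_cons, List.reverse_nil, List.nil_append, List.cons_append, List.cons.injEq,
      and_true]
    refine ⟨?_, ?_, ?_⟩ <;> split_ifs <;> omega
  have e2 : φ (conj (wz p) (wy * wz p)) = cyc [p + 1, 0, -1] := by
    rw [map_conj, map_mul, hy, hz, conj_cyc]
    congr 1
    simp (disch := omega) only [List.map_cons, List.map_nil, act_mul, act_ybar, act_cyc3,
      List.cons.injEq, and_true]
    refine ⟨?_, ?_, ?_⟩ <;> split_ifs <;> omega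
  unfold ww
  rw [if_neg (by omega), if_pos h, map_mul, e1, e2]
  apply act_ext
  intro x
  simp (disch := omega) only [act_mul, act_ybar, act_cyc3]
  split_ifs <;> first | omega | contradiction

include ht

omit ha hk in
theorem map_ww_of_eq_add_one (h : kk n p = p + 1) : φ (ww n p) = ybar p (kk n p) := by
  unfold ww
  rw [if_pos h, map_conj, map_mul, ht, hy, hz, h]
  apply act_ext
  intro x
  simp (disch := omega) only [conj_cyc, List.map_cons, List.map_nil, act_mul, act_ybar, act_cyc3,
    if_pos, if_neg, if_true, act_cyc2]
  split_ifs <;> omega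

omit hk in
theorem map_ww_of_eq_sub_one (h : kk n p = p - 1) : φ (ww n p) = ybar p (kk n p) := by
  rw [h] at hy ⊢
  have e0 : conj (cyc [p, p + 1, p + 2]) (cyc (run 1 p) * ybar p (p - 1) * (cyc (run 1 p))⁻¹) =
      cyc [p, -1, -2] := by
    rw [conj_cyc]
    congr 1
    simp (disch := omega) only [List.map_cons, List.map_nil, act_mul, act_ybar, act_cyc_run,
      act_cyc_run_inv, List.cons.injEq, and_true]
    refine ⟨?_, ?_, ?_⟩ <;> split_ifs <;> omega
  have e1 : φ (conj (wz p) (wa * wy * wa⁻¹ * (wz p)⁻¹)) = cyc [p + 2, -1, -2] := by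
    rw [conj_mul, map_conj, map_conj]
    simp only [map_mul, map_inv, hy, hz, ha]
    rw [e0, conj_cyc, ← cyc_reverse]
    congr 1
    simp (disch := omega) only [List.map_cons, List.map_nil, act_cyc3, List.reverse_cons,
      List.reverse_nil, List.nil_append, List.cons_append, List.cons.injEq, and_true]
    refine ⟨?_, ?_, ?_⟩ <;> split_ifs <;> omega
  have e2 : φ (conj (wz p) (wa * wy * wa⁻¹ * wz p)) = cyc [p + 1, -1, -2] := by
    rw [conj_mul, map_conj, map_conj]
    simp only [map_mul, map_inv, hy, hz, ha]
    rw [e0, conj_cyc]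
    congr 1
    simp (disch := omega) only [List.map_cons, List.map_nil, act_cyc3, List.cons.injEq, and_true]
    refine ⟨?_, ?_, ?_⟩ <;> split_ifs <;> omega
  have e3 : φ (conj (wdij p 1 p * wt p) (wy * wa⁻¹)) = cyc [p, 0] := by
    rw [map_conj, map_mul, map_wdij φ ha hz (by omega) (by omega) (by omega) (by omega) (by omega),
      ht, mul_assoc, cyc2_mul_self, mul_one, map_mul, map_inv, ha, hy, conj_cyc, cyc2_comm]
    simp (disch := omega) only [List.map_cons, List.map_nil, act_mul, act_ybar, act_cyc_run_inv]
    rw [cyc2_comm]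
    congr 1
    simp only [List.cons.injEq, and_true]
    refine ⟨?_, ?_⟩ <;> split_ifs <;> omega
  unfold ww
  rw [if_neg (by omega), if_neg (by omega), if_pos h, map_mul, map_mul, e1, e2, e3]
  apply act_ext
  intro x
  simp (disch := omega) only [act_mul, act_ybar, act_cyc3, act_cyc2]
  split_ifs <;> first | omega | contradiction

include hpo

/-- The permutation `y` consists of `p - k + 2` transpositions. For `n` odd this number is even, and
the pairs supplied by the conjugates of `x̃` exhaust it. For `n` even the outermost one remains, and
the leading conjugate of `t` provides it. -/
theorem map_ww_of_le (h : kk n p ≤ p - 2) : φ (ww n p) = ybar p (kk n p) := by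
  have hodd := odd_kk_iff (n := n) (p := p)
  rw [Int.odd_iff] at hodd
  rw [Int.odd_iff] at hpo
  have hza := map_za φ ha hz (show 5 ≤ p by omega)
  unfold ww
  rw [if_neg (by omega), if_neg (by omega), if_neg (by omega)]
  split_ifs with h4
  · obtain ⟨m, hm⟩ : ∃ m : ℕ, p - kk n p = 2 * m := by
      have := hodd.2 h4
      exact ⟨((p - kk n p) / 2).toNat, by omega⟩
    rw [hm, Int.mul_ediv_cancel_left _ two_ne_zero, zpow_natCast,
      show (2 * (m : ℤ)) = (2 * m : ℕ) by push_cast; rfl, zpow_natCast]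
    apply act_ext
    intro x
    rw [act_wxtilde_prod φ hp ha hz hy hk h m (by omega), act_ybar (by omega)]
    split_ifs <;> omega
  · obtain ⟨m, hm⟩ : ∃ m : ℕ, p - kk n p - 1 = 2 * m := by
      have := mt hodd.1 h4
      exact ⟨((p - kk n p - 1) / 2).toNat, by omega⟩
    have e1 : φ (conj (wt p) (wz p * wa * wy * (wz p * wa)⁻¹)) =
        cyc [p + 2, -p - 1 + kk n p] := by
      rw [map_conj, map_mul _ (wz p * wa * wy), map_mul _ (wz p * wa), map_inv, hza, ht, hy, conj_cyc,
        cyc2_comm (p + 2)]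
      congr 1
      simp (disch := omega) only [List.map_cons, List.map_nil, act_mul, act_ybar, act_cyc_run,
        act_cyc_run_inv, List.cons.injEq, and_true]
      refine ⟨?_, ?_⟩ <;> split_ifs <;> omega
    rw [hm, Int.mul_ediv_cancel_left _ two_ne_zero, zpow_natCast,
      show (2 * (m : ℤ)) = (2 * m : ℕ) by push_cast; rfl, zpow_natCast, mul_assoc, mul_assoc,
      ← mul_assoc (_ ^ m), map_mul, e1]
    apply act_ext
    intro x
    rw [act_mul, act_wxtilde_prod φ hp ha hz hy hk h m (by omega), act_ybar (by omega), act_cyc2]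
    split_ifs <;> omega

include hkp

theorem map_ww : φ (ww n p) = ybar p (kk n p) := by
  by_cases h1 : kk n p = p + 1
  · exact map_ww_of_eq_add_one φ hp hz ht hy h1
  by_cases h2 : kk n p = p
  · exact map_ww_of_eq φ hp hz hy h2
  by_cases h3 : kk n p = p - 1
  · exact map_ww_of_eq_sub_one φ hp ha hz ht hy h3
  exact map_ww_of_le φ hp hpo ha hz ht hy hk (by omega)

end words

/-! ### Carmichael's presentation of the alternating group -/

section carmichael

variable {G : Type} [Group G] {x y w : G}

theorem mul_eq_inv_mul_inv (hxy : (x * y) ^ 2 = 1) : x * y = y⁻¹ * x⁻¹ := by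
  rw [← mul_inv_rev]
  exact eq_inv_of_mul_eq_one_left (by rwa [← pow_two])

theorem inv_eq_sq (hx : x ^ 3 = 1) : x⁻¹ = x * x :=
  inv_eq_of_mul_eq_one_left (by rw [← pow_two, ← pow_succ, hx])

theorem mul_sq_symm (hxy : (x * y) ^ 2 = 1) : (y * x) ^ 2 = 1 := by
  have : y * x = x⁻¹ * (x * y) * x := by group
  rw [this, pow_two]
  calc x⁻¹ * (x * y) * x * (x⁻¹ * (x * y) * x) = x⁻¹ * (x * y) ^ 2 * x := by rw [pow_two]; group
    _ = 1 := by rw [hxy]; group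

theorem inv_mul_eq_of_sq (hy : y ^ 3 = 1) (hxy : (x * y) ^ 2 = 1) :
    x⁻¹ * y = y * x * y⁻¹ := by
  calc x⁻¹ * y = y * (y⁻¹ * x⁻¹) * y := by group
    _ = y * (x * y) * y := by rw [← mul_eq_inv_mul_inv hxy]
    _ = y * x * (y * y) := by group
    _ = y * x * y⁻¹ := by rw [← inv_eq_sq hy]

/-- For Carmichael's coset enumeration: if a subgroup contains `y`, its coset of `x * y⁻¹` is stable
under right multiplication by `x`. -/
theorem mul_inv_mul_self (hx : x ^ 3 = 1) (hy : y ^ 3 = 1) (hxy : (x * y) ^ 2 = 1) :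
    x * y⁻¹ * x = y⁻¹ * (x * y⁻¹) := by
  calc x * y⁻¹ * x = x * (y⁻¹ * x) := by group
    _ = x * (x * y * x⁻¹) := by rw [inv_mul_eq_of_sq hx (mul_sq_symm hxy)]
    _ = (x * x) * y * x⁻¹ := by group
    _ = x⁻¹ * y * x⁻¹ := by rw [← inv_eq_sq hx]
    _ = y * x * (y⁻¹ * x⁻¹) := by rw [inv_mul_eq_of_sq hy hxy]; group
    _ = y * (x * x) * y := by rw [← mul_eq_inv_mul_inv hxy]; group
    _ = y * (x⁻¹ * y) := by rw [← inv_eq_sq hx]; group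
    _ = (y * y) * (x * y⁻¹) := by rw [inv_mul_eq_of_sq hy hxy]; group
    _ = y⁻¹ * (x * y⁻¹) := by rw [← inv_eq_sq hy]

/-- The same coset is stable under right multiplication by another generator `w` of the subgroup,
because the prefix on the right involves only `y` and `w`. -/
theorem mul_inv_mul_third (hy : y ^ 3 = 1) (hw : w ^ 3 = 1)
    (hxy : (x * y) ^ 2 = 1) (hxw : (x * w) ^ 2 = 1) (hyw : (y * w) ^ 2 = 1) :
    x * y⁻¹ * w = w⁻¹ * y * w⁻¹ * y * (x * y⁻¹) := by
  calc x * y⁻¹ * w = x * (y⁻¹ * w) := by group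
    _ = (x * w) * y * w⁻¹ := by rw [inv_mul_eq_of_sq hw hyw]; group
    _ = w⁻¹ * (x⁻¹ * y) * w⁻¹ := by rw [mul_eq_inv_mul_inv hxw]; group
    _ = w⁻¹ * y * x * (y⁻¹ * w⁻¹) := by rw [inv_mul_eq_of_sq hy hxy]; group
    _ = w⁻¹ * y * (x * w) * y := by
      rw [← mul_eq_inv_mul_inv (mul_sq_symm hyw)]; group
    _ = w⁻¹ * y * w⁻¹ * (x⁻¹ * y) := by rw [mul_eq_inv_mul_inv hxw]; group
    _ = w⁻¹ * y * w⁻¹ * y * (x * y⁻¹) := by rw [inv_mul_eq_of_sq hy hxy]; group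

variable (z : ℤ → G)

/-- The four kinds of cosets of `⟨z i : i ∈ s⟩` in `⟨z i : i ∈ s ∪ {m}⟩`. -/
theorem mem_closure_insert {s : Set ℤ} {m : ℤ} (hm : m ∉ s)
    (h3 : ∀ i ∈ insert m s, z i ^ 3 = 1)
    (h2 : ∀ i ∈ insert m s, ∀ j ∈ insert m s, i ≠ j → (z i * z j) ^ 2 = 1) {x : G}
    (hx : x ∈ Subgroup.closure (z '' insert m s)) :
    ∃ h ∈ Subgroup.closure (z '' s), x = h ∨ x = h * z m ∨ x = h * (z m)⁻¹ ∨
      ∃ i ∈ s, x = h * (z m * (z i)⁻¹) := by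
  have hmem : ∀ i ∈ s, z i ∈ Subgroup.closure (z '' s) := fun i hi =>
    Subgroup.subset_closure ⟨i, hi, rfl⟩
  have hms : m ∈ insert m s := Set.mem_insert m s
  have hsm : ∀ i ∈ s, i ∈ insert m s := fun i hi => Set.mem_insert_of_mem m hi
  have hne : ∀ i ∈ s, m ≠ i := fun i hi h => hm (h ▸ hi)
  -- The union of the listed cosets is closed under right multiplication by every generator.
  -- Inverses need no separate treatment, being squares.
  have step : ∀ (x : G) (j : ℤ), j ∈ insert m s →
      (∃ h ∈ Subgroup.closure (z '' s), x = h ∨ x = h * z m ∨ x = h * (z m)⁻¹ ∨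
        ∃ i ∈ s, x = h * (z m * (z i)⁻¹)) →
      (∃ h ∈ Subgroup.closure (z '' s), x * z j = h ∨ x * z j = h * z m ∨
        x * z j = h * (z m)⁻¹ ∨ ∃ i ∈ s, x * z j = h * (z m * (z i)⁻¹)) := by
    rintro x j hj ⟨h, hh, rfl | rfl | rfl | ⟨i, hi, rfl⟩⟩
    · rcases hj with rfl | hj
      · exact ⟨x, hh, Or.inr (Or.inl rfl)⟩
      · exact ⟨x * z j, mul_mem hh (hmem j hj), Or.inl rfl⟩
    · rcases hj with rfl | hj
      · exact ⟨h, hh, Or.inr (Or.inr (Or.inl (by rw [inv_eq_sq (h3 j hms), mul_assoc])))⟩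
      · refine ⟨h * (z j)⁻¹, mul_mem hh (inv_mem (hmem j hj)), Or.inr (Or.inr (Or.inl ?_))⟩
        rw [mul_assoc, mul_eq_inv_mul_inv (h2 m hms j (hsm j hj) (hne j hj)), mul_assoc]
    · rcases hj with rfl | hj
      · exact ⟨h, hh, Or.inl (by group)⟩
      · refine ⟨h * z j, mul_mem hh (hmem j hj), Or.inr (Or.inr (Or.inr ⟨j, hj, ?_⟩))⟩
        rw [mul_assoc, inv_mul_eq_of_sq (h3 j (hsm j hj))
          (h2 m hms j (hsm j hj) (hne j hj))]
        group
    · rcases hj with rfl | hj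
      · refine ⟨h * (z i)⁻¹, mul_mem hh (inv_mem (hmem i hi)), Or.inr (Or.inr (Or.inr ⟨i, hi, ?_⟩))⟩
        rw [mul_assoc, mul_inv_mul_self (h3 j hms) (h3 i (hsm i hi))
          (h2 j hms i (hsm i hi) (hne i hi)), mul_assoc]
      · by_cases hij : i = j
        · subst hij
          exact ⟨h, hh, Or.inr (Or.inl (by group))⟩
        · refine ⟨h * ((z j)⁻¹ * z i * (z j)⁻¹ * z i), mul_mem hh (mul_mem (mul_mem (mul_mem
            (inv_mem (hmem j hj)) (hmem i hi)) (inv_mem (hmem j hj))) (hmem i hi)),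
            Or.inr (Or.inr (Or.inr ⟨i, hi, ?_⟩))⟩
          rw [mul_assoc, mul_inv_mul_third (h3 i (hsm i hi)) (h3 j (hsm j hj))
            (h2 m hms i (hsm i hi) (hne i hi)) (h2 m hms j (hsm j hj) (hne j hj))
            (h2 i (hsm i hi) j (hsm j hj) hij), ← mul_assoc h]
  induction hx using Subgroup.closure_induction_right with
  | one => exact ⟨1, one_mem _, Or.inl rfl⟩
  | mul_right x hx y hy ih =>
    obtain ⟨j, hj, rfl⟩ := hy
    exact step x j hj ih
  | mul_inv_cancel x hx y hy ih =>
    obtain ⟨j, hj, rfl⟩ := hy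
    rw [inv_eq_sq (h3 j hj), ← mul_assoc]
    exact step _ j hj (step x j hj ih)

/-- In Carmichael's presentation, a homomorphism that maps the generators to the 3-cycles
`(i, u, v)` is injective. -/
theorem carmichael_injective (f : G →* RPerm) {u v : ℤ} (huv : u ≠ v) (s : Finset ℤ)
    (hu : u ∉ s) (hv : v ∉ s) (h3 : ∀ i ∈ s, z i ^ 3 = 1)
    (h2 : ∀ i ∈ s, ∀ j ∈ s, i ≠ j → (z i * z j) ^ 2 = 1)
    (hf : ∀ i ∈ s, f (z i) = cyc [i, u, v]) {x : G}
    (hx : x ∈ Subgroup.closure (z '' s)) (hfx : f x = 1) : x = 1 := by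
  induction s using Finset.induction_on generalizing x with
  | empty => simpa using hx
  | insert m s hm ih =>
    simp only [Finset.coe_insert] at hx
    simp only [Finset.mem_insert, not_or] at hu hv
    obtain ⟨h, hh, hcase⟩ := mem_closure_insert z (s := (s : Set ℤ)) (by exact_mod_cast hm)
      (fun i hi => h3 i (by simpa using hi))
      (fun i hi j hj => h2 i (by simpa using hi) j (by simpa using hj)) hx
    -- The smaller subgroup fixes `m`, so the four kinds of cosets send `m` to `m`, `u`, `v` and `i`
    -- respectively. An element of the kernel must be of the first kind, and induction applies.
    have hfix : act (f h) m = m := by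
      clear hcase
      have key : Subgroup.closure (z '' s) ≤
          ((MulAction.stabilizer (Equiv.Perm ℤ) m).op).comap f := by
        rw [Subgroup.closure_le]
        rintro _ ⟨i, hi, rfl⟩
        have him : i ≠ m := fun h => hm (h ▸ hi)
        have := hf i (Finset.mem_insert_of_mem hi)
        simp only [Subgroup.coe_comap, Set.mem_preimage, this]
        show act (cyc [i, u, v]) m = m
        apply act_cyc_notMem
        simp only [List.mem_cons, List.not_mem_nil, or_false, not_or]
        exact ⟨him.symm, Ne.symm hu.1, Ne.symm hv.1⟩
      exact key hh
    have hmz := hf m (Finset.mem_insert_self m s)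
    have hact : act (f x) m = m := by rw [hfx, act_one]
    have hmu : act (cyc [m, u, v]) m = u := by
      rw [act_cyc3 (Ne.symm hu.1) huv (Ne.symm hv.1), if_pos rfl]
    rcases hcase with rfl | rfl | rfl | ⟨i, hi, rfl⟩
    · exact ih hu.2 hv.2 (fun i hi => h3 i (Finset.mem_insert_of_mem hi))
        (fun i hi j hj => h2 i (Finset.mem_insert_of_mem hi) j (Finset.mem_insert_of_mem hj))
        (fun i hi => hf i (Finset.mem_insert_of_mem hi)) hh hfx
    · rw [map_mul, act_mul, hfix, hmz, hmu] at hact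
      exact absurd hact hu.1
    · rw [map_mul, act_mul, hfix, map_inv, hmz] at hact
      have h1 := act_act_inv (cyc [m, u, v]) m
      rw [hact, hmu] at h1
      exact absurd h1 hu.1
    · have hiu : i ≠ u := fun h => hu.2 (h ▸ hi)
      have hiv : i ≠ v := fun h => hv.2 (h ▸ hi)
      rw [map_mul, map_mul, act_mul, act_mul, hfix, hmz, hmu, map_inv,
        hf i (Finset.mem_insert_of_mem hi)] at hact
      have h1 : act (cyc [i, u, v])⁻¹ u = i :=
        act_inv_eq (by rw [act_cyc3 hiu huv hiv, if_pos rfl])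
      rw [h1] at hact
      exact absurd (hact ▸ hi) hm

end carmichael

/-! ### Abstract conjugation, sign arguments and the affine relations -/

section generic

variable {G : Type} [Group G]

theorem conj_conj (x h k : G) : conj (conj x h) k = conj (conj x k) (conj h k) := by
  simp [conj, mul_assoc]

theorem conj_zpow (x h : G) (m : ℤ) : conj (x ^ m) h = conj x h ^ m := by
  have := _root_.conj_zpow (i := m) (a := h⁻¹) (b := x)
  rw [inv_inv] at this
  exact this.symm

theorem conj_pow (x h : G) (m : ℕ) : conj (x ^ m) h = conj x h ^ m := by
  rw [← zpow_natCast, conj_zpow, zpow_natCast]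

theorem conj_inv (x h : G) : conj x⁻¹ h = (conj x h)⁻¹ := by
  simp [conj, mul_assoc]

theorem conj_eq_one {x h : G} (H : conj x h = 1) : x = 1 := by
  have : x = h * conj x h * h⁻¹ := by simp [conj, mul_assoc]
  rw [this, H]
  group

/-! ### Normalizers -/

theorem conj_mem_closure {S : Set G} {x : G} (h : ∀ s ∈ S, conj s x ∈ Subgroup.closure S) {u : G}
    (hu : u ∈ Subgroup.closure S) : conj u x ∈ Subgroup.closure S := by
  induction hu using Subgroup.closure_induction with
  | mem s hs => exact h s hs
  | one => simp [conj]
  | mul u v _ _ hu hv => rw [mul_conj]; exact mul_mem hu hv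
  | inv u _ hu => rw [conj_inv]; exact inv_mem hu

theorem mem_normalizer_closure {S : Set G} {x : G} (h : ∀ s ∈ S, conj s x ∈ Subgroup.closure S)
    (h' : ∀ s ∈ S, conj s x⁻¹ ∈ Subgroup.closure S) :
    x ∈ Subgroup.normalizer (Subgroup.closure S : Set G) := by
  rw [Subgroup.mem_normalizer_iff]
  intro u
  constructor
  · intro hu
    have := conj_mem_closure h' hu
    rwa [conj, inv_inv] at this
  · intro hu
    have := conj_mem_closure h hu
    rwa [conj, mul_assoc, mul_assoc, inv_mul_cancel, mul_one, inv_mul_cancel_left] at this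

theorem conj_mem_of_normalizer {A : Subgroup G} {x u : G}
    (hx : x ∈ Subgroup.normalizer (A : Set G)) (hu : u ∈ A) : conj u x ∈ A := by
  rw [Subgroup.mem_normalizer_iff] at hx
  rw [hx, conj]
  simpa [mul_assoc] using hu

/-- If `t` normalizes `A` and `t² ∈ A`, then `A ∪ A t` is a subgroup. -/
def adjoinSqrt (A : Subgroup G) (t : G) (ht : t ∈ Subgroup.normalizer (A : Set G))
    (ht2 : t ^ 2 ∈ A) : Subgroup G where
  carrier := {x | x ∈ A ∨ ∃ u ∈ A, x = u * t}
  one_mem' := Or.inl (one_mem A)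
  mul_mem' := by
    have hc : ∀ u ∈ A, t * u * t⁻¹ ∈ A := fun u hu => ((Subgroup.mem_normalizer_iff.1 ht) u).1 hu
    rintro x y (hx | ⟨u, hu, rfl⟩) (hy | ⟨v, hv, rfl⟩)
    · exact Or.inl (mul_mem hx hy)
    · exact Or.inr ⟨x * v, mul_mem hx hv, by group⟩
    · exact Or.inr ⟨u * (t * y * t⁻¹), mul_mem hu (hc y hy), by group⟩
    · refine Or.inl ?_
      have : u * t * (v * t) = u * (t * v * t⁻¹) * t ^ 2 := by rw [pow_two]; group
      rw [this]
      exact mul_mem (mul_mem hu (hc v hv)) ht2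
  inv_mem' := by
    rintro x (hx | ⟨u, hu, rfl⟩)
    · exact Or.inl (inv_mem hx)
    · refine Or.inr ⟨conj u⁻¹ t * (t ^ 2)⁻¹, mul_mem (conj_mem_of_normalizer ht (inv_mem hu))
        (inv_mem ht2), ?_⟩
      rw [conj, pow_two]
      group

/-- If `x` normalizes `A`, then `(x u)^m ∈ x^m A` for `u ∈ A`. -/
theorem mul_pow_mem {A : Subgroup G} {x u : G} (hx : x ∈ Subgroup.normalizer (A : Set G))
    (hu : u ∈ A) (m : ℕ) : ∃ v ∈ A, (x * u) ^ m = x ^ m * v := by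
  induction m with
  | zero => exact ⟨1, one_mem A, by simp⟩
  | succ m ih =>
    obtain ⟨v, hv, h⟩ := ih
    refine ⟨conj v x * u, mul_mem (conj_mem_of_normalizer hx hv) hu, ?_⟩
    rw [pow_succ, h, pow_succ, conj]
    group

theorem sign_eq_one_of_cube (sgn : G →* ℤˣ) {x : G} (hx : x ^ 3 = 1) : sgn x = 1 := by
  have h : sgn x ^ 3 = 1 := by rw [← map_pow, hx, map_one]
  rwa [pow_succ, Int.units_sq, one_mul] at h

theorem sign_eq_one_of_closure (sgn : G →* ℤˣ) {S : Set G} (hS : ∀ s ∈ S, s ^ 3 = 1) {x : G}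
    (hx : x ∈ Subgroup.closure S) : sgn x = 1 := by
  have : Subgroup.closure S ≤ sgn.ker :=
    (Subgroup.closure_le _).2 fun s hs => sign_eq_one_of_cube sgn (hS s hs)
  exact this hx

/-- A homomorphism that is injective on `A` and detects the sign is injective on `A ∪ A t`. -/
theorem eq_one_of_adjoinSqrt {H : Type} [Group H] (f : G →* H) (sgn : G →* ℤˣ)
    (hsgn : ∀ x, f x = 1 → sgn x = 1) {A : Subgroup G} {t : G}
    {ht : t ∈ Subgroup.normalizer (A : Set G)} {ht2 : t ^ 2 ∈ A} (hA : ∀ u ∈ A, sgn u = 1)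
    (hf : ∀ u ∈ A, f u = 1 → u = 1) (hneg : ∃ τ ∈ adjoinSqrt A t ht ht2, sgn τ = -1) {x : G}
    (hx : x ∈ adjoinSqrt A t ht ht2) (hfx : f x = 1) : x = 1 := by
  obtain ⟨τ, hτ, hτs⟩ := hneg
  have hsx := hsgn x hfx
  rcases hx with hx | ⟨u, hu, rfl⟩
  · exact hf x hx hfx
  · exfalso
    rw [map_mul, hA u hu, one_mul] at hsx
    rcases hτ with hτ | ⟨v, hv, rfl⟩
    · rw [hA τ hτ] at hτs
      exact absurd hτs (by decide)
    · rw [map_mul, hA v hv, one_mul, hsx] at hτs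
      exact absurd hτs (by decide)

/-! ### The affine group of the prime field -/

section affine

variable {a b : G} {p : ℕ} {r s : ℤ} (h1 : a ^ p = b ^ (p - 1))
  (h2 : conj (a ^ s) b = a ^ (s - 1))

include h1 h2

/-- Being a power of `b`, the element `a ^ p` is fixed under conjugation by `b`. The `p`-th power of
the second relation then reads `(a ^ p) ^ s = (a ^ p) ^ (s - 1)`. -/
theorem affine_pow_eq_one : a ^ p = 1 := by
  have hb : conj (a ^ p) b = a ^ p := by
    rw [h1]
    exact conj_eq_self ((Commute.refl b).pow_left _)
  have h3 : (a ^ p) ^ s = (a ^ p) ^ (s - 1) := by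
    calc (a ^ p) ^ s = conj ((a ^ p) ^ s) b := by rw [conj_zpow, hb]
      _ = conj (a ^ s) b ^ p := by rw [← conj_pow, ← zpow_natCast, ← zpow_natCast, ← zpow_mul,
          ← zpow_mul, mul_comm]
      _ = (a ^ p) ^ (s - 1) := by
        rw [h2, ← zpow_natCast, ← zpow_natCast, ← zpow_mul, ← zpow_mul, mul_comm]
  rw [zpow_sub_one] at h3
  simpa using h3

/-- Since `s (1 - r) ≡ 1`, `a` is the power `1 - r` of `a ^ s`. Conjugation turns it into `a` to the
exponent `(s - 1)(1 - r) ≡ 1 - (1 - r) = r`. -/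
theorem affine_conj (hs : s * (r - 1) ≡ -1 [ZMOD p]) : conj a b = a ^ r := by
  have hp := affine_pow_eq_one h1 h2
  have hcong : ∀ i j : ℤ, i ≡ j [ZMOD p] → a ^ i = a ^ j := by
    intro i j h
    obtain ⟨m, hm⟩ := h.dvd
    rw [show j = i + p * m by omega, zpow_add, zpow_mul, zpow_natCast, hp, one_zpow, mul_one]
  have e1 : a = (a ^ s) ^ (1 - r) := by
    rw [← zpow_mul]
    conv_lhs => rw [← zpow_one a]
    apply hcong
    have := hs.neg
    rw [neg_neg] at this
    rw [show s * (1 - r) = -(s * (r - 1)) by ring]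
    exact this.symm
  conv_lhs => rw [e1]
  rw [conj_zpow, h2, ← zpow_mul]
  apply hcong
  have := (hs.neg).add_right (r - 1)
  rw [show (s - 1) * (1 - r) = -(s * (r - 1)) + (r - 1) by ring]
  exact this.trans (by rw [show - -1 + (r - 1) = r by ring])

end affine

end generic

/-! ### The subgroup `⟨a, g⟩` -/

section subgroup_ag

variable {G : Type} [Group G] {p : ℕ} [Fact p.Prime] {r s : ℤ} {ρ : (ZMod p)ˣ} (π : F →* G)
  (hp : p % 12 = 11) (hr : (ρ : ZMod p) = r) (hρ : Subgroup.zpowers ρ = ⊤)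
  (hs : s * (r - 1) ≡ -1 [ZMOD p])
  (h1 : π wa ^ p = π wb ^ (p - 1))
  (h2 : conj (π wa ^ s) (π wb) = π wa ^ (s - 1))
  (h3 : (π (wz p) * conj (π (wz p)) (π wa)) ^ 2 = 1)

theorem map_wb : π wb = π wg ^ 3 := by
  rw [wb, map_zpow, zpow_ofNat]

omit [Fact p.Prime] in
theorem map_wz (hp : 1 ≤ p) : π (wz p) = π wg ^ (p - 1) := by
  rw [wz, map_zpow, show (p : ℤ) - 1 = (p - 1 : ℕ) by omega, zpow_natCast]

omit [Fact p.Prime] in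
theorem conj_wzi (i j : ℤ) : conj (π (wzi p i)) (π wa ^ j) = π (wzi p (i + j)) := by
  rw [wzi, wzi, ← map_zpow, ← map_conj, ← conj_mul, zpow_add]

include h1 h2

omit [Fact p.Prime] in
theorem wzi_congr {i j : ℤ} (h : i ≡ j [ZMOD p]) : π (wzi p i) = π (wzi p j) := by
  obtain ⟨m, hm⟩ := h.dvd
  have ha := affine_pow_eq_one h1 h2
  rw [show j = i + p * m by omega, ← conj_wzi, zpow_mul, zpow_natCast, ha, one_zpow]
  simp [conj]

omit [Fact p.Prime] in
theorem wb_pow_eq_one : π wb ^ (p - 1) = 1 := by rw [← h1, affine_pow_eq_one h1 h2]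

include hs

omit [Fact p.Prime] in
theorem conj_wzi_wb (hp1 : 1 ≤ p) (i : ℤ) : conj (π (wzi p i)) (π wb) = π (wzi p (r * i)) := by
  rw [wzi, wzi, map_conj, map_conj, conj_conj, map_zpow, conj_zpow, affine_conj h1 h2 hs, ← zpow_mul,
    map_zpow]
  congr 1
  apply conj_eq_self
  rw [map_wz π hp1, map_wb π]
  exact (Commute.refl _).pow_pow _ _

omit [Fact p.Prime] in
theorem conj_wzi_wb_pow (hp1 : 1 ≤ p) (m : ℕ) (i : ℤ) :
    conj (π (wzi p i)) (π wb ^ m) = π (wzi p (r ^ m * i)) := by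
  induction m with
  | zero => simp [conj]
  | succ m ih =>
    rw [pow_succ, conj_mul, ih, conj_wzi_wb π hs h1 h2 hp1, pow_succ]
    congr 2
    ring

omit hs [Fact p.Prime] in
theorem wzi_pow_three (hp1 : 1 ≤ p) (i : ℤ) : π (wzi p i) ^ 3 = 1 := by
  rw [wzi, map_conj, ← conj_pow, map_wz π hp1, ← pow_mul, mul_comm, pow_mul, ← map_wb π,
    wb_pow_eq_one π h1 h2]
  simp [conj]

include h3 hr hρ

/-- Conjugation by `b ^ m * a ^ i` with `r ^ m ≡ j - i` carries the index pair `(0, 1)` to `(i, j)`.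
A primitive root reaches every nonzero difference, so the third relation covers all pairs. -/
theorem wzi_mul_sq {i j : ℤ} (hij : ¬ i ≡ j [ZMOD p]) : (π (wzi p i) * π (wzi p j)) ^ 2 = 1 := by
  have hp1 : 1 ≤ p := (Fact.out : p.Prime).one_le
  have hne : ((j - i : ℤ) : ZMod p) ≠ 0 := by
    intro h
    apply hij
    rw [← ZMod.intCast_eq_intCast_iff]
    push_cast at h
    exact (sub_eq_zero.1 h).symm
  obtain ⟨m, -, hm⟩ := exists_pow_eq hρ hne
  have hm' : r ^ m + i ≡ j [ZMOD p] := by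
    rw [← ZMod.intCast_eq_intCast_iff]
    push_cast at hm ⊢
    rw [← hr, hm]
    ring
  have h0 : (π (wzi p 0) * π (wzi p 1)) ^ 2 = 1 := by
    rw [← h3]
    simp [wzi, conj]
  have h4 : conj ((π (wzi p 0) * π (wzi p 1)) ^ 2) (π wb ^ m * π wa ^ i) = 1 := by
    rw [h0]
    simp [conj]
  rw [conj_pow, conj_mul, mul_conj, conj_wzi_wb_pow π hs h1 h2 hp1, conj_wzi_wb_pow π hs h1 h2 hp1,
    mul_conj, conj_wzi, conj_wzi, mul_one, mul_zero, zero_add, wzi_congr π h1 h2 hm'] at h4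
  exact h4

/-- The subgroup generated by the elements `z(i)`. -/
def altSubgroup {G : Type} [Group G] (π : F →* G) (p : ℕ) : Subgroup G :=
  Subgroup.closure ((fun i : ℤ => π (wzi p i)) '' (Finset.Icc 1 (p : ℤ) : Finset ℤ))

omit hr hρ h3 hs in
theorem wzi_mem (i : ℤ) : π (wzi p i) ∈ altSubgroup π p := by
  have hp1 : 1 ≤ p := (Fact.out : p.Prime).one_le
  have h : ∃ j : ℤ, (1 ≤ j ∧ j ≤ p) ∧ i ≡ j [ZMOD p] := by
    refine ⟨rep (i : ZMod p), ⟨one_le_rep _, rep_le _⟩, ?_⟩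
    rw [← ZMod.intCast_eq_intCast_iff, cast_rep]
  obtain ⟨j, hj, hij⟩ := h
  rw [wzi_congr π h1 h2 hij]
  exact Subgroup.subset_closure ⟨j, by simpa using hj, rfl⟩

omit hr hρ h3 hs in
theorem wa_mem_normalizer : π wa ∈ Subgroup.normalizer (altSubgroup π p : Set G) := by
  apply mem_normalizer_closure
  · rintro _ ⟨i, -, rfl⟩
    have := conj_wzi (p := p) π i 1
    rw [zpow_one] at this
    simp only [this]
    exact wzi_mem π h1 h2 _
  · rintro _ ⟨i, -, rfl⟩
    have := conj_wzi (p := p) π i (-1)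
    rw [zpow_neg_one] at this
    simp only [this]
    exact wzi_mem π h1 h2 _

omit hr hρ h3 in
theorem wb_mem_normalizer (hp2 : 2 ≤ p) :
    π wb ∈ Subgroup.normalizer (altSubgroup π p : Set G) := by
  have hp1 : 1 ≤ p := by omega
  apply mem_normalizer_closure
  · rintro _ ⟨i, -, rfl⟩
    simp only [conj_wzi_wb π hs h1 h2 hp1]
    exact wzi_mem π h1 h2 _
  · rintro _ ⟨i, -, rfl⟩
    have : (π wb)⁻¹ = π wb ^ (p - 2) := by
      apply inv_eq_of_mul_eq_one_left
      rw [← pow_succ, show p - 2 + 1 = p - 1 by omega, wb_pow_eq_one π h1 h2]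
    simp only [this, conj_wzi_wb_pow π hs h1 h2 hp1]
    exact wzi_mem π h1 h2 _

include hp

omit hr hρ h3 in
-- As `p - 1 = 3 l + 1`, `z = g ^ (p - 1)` equals `g * b ^ l`. So `g` is a product of `z`, which
-- lies in `A`, and a power of `b`, which permutes the generators.
theorem wg_mem_normalizer : π wg ∈ Subgroup.normalizer (altSubgroup π p : Set G) := by
  have hz : π (wz p) ∈ Subgroup.normalizer (altSubgroup π p : Set G) := by
    apply Subgroup.le_normalizer
    have := wzi_mem (p := p) π h1 h2 0
    simpa [wzi, conj] using this
  have hb := wb_mem_normalizer π hs h1 h2 (by omega)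
  obtain ⟨l, hl⟩ : ∃ l : ℕ, p = 3 * l + 2 := ⟨p / 3, by omega⟩
  have : π wg = π (wz p) * (π wb ^ l)⁻¹ := by
    rw [map_wz π (by omega), map_wb π, ← pow_mul, show p - 1 = 3 * l + 1 by omega, pow_succ']
    group
  rw [this]
  exact mul_mem hz (inv_mem (pow_mem hb l))

variable (f : G →* RPerm) (hfa : f (π wa) = cyc (run 1 p))
  (hfz : f (π (wz p)) = cyc [(p : ℤ), p + 1, p + 2])

include hfa hfz

omit hp in
theorem altSubgroup_injective (hp5 : 5 ≤ p) {x : G} (hx : x ∈ altSubgroup π p) (hfx : f x = 1) :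
    x = 1 := by
  refine carmichael_injective (fun i : ℤ => π (wzi p i)) f (u := p + 1) (v := p + 2) (by omega)
    (Finset.Icc 1 (p : ℤ)) (by simp) (by simp) ?_ ?_ ?_ hx hfx
  · intro i _
    exact wzi_pow_three π h1 h2 (by omega) i
  · intro i hi j hj hij
    rw [Finset.mem_Icc] at hi hj
    apply wzi_mul_sq π hr hρ hs h1 h2 h3
    intro h
    apply hij
    rw [← rep_cast (p := p) hi.1 hi.2, ← rep_cast (p := p) hj.1 hj.2,
      (ZMod.intCast_eq_intCast_iff _ _ p).2 h]
  · intro i hi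
    rw [Finset.mem_Icc] at hi
    exact map_wzi (f.comp π) hfa hfz hi.1 hi.2

omit hp in
/-- Elements `≡ 1` that normalize the alternating group centralize it. -/
theorem commute_of_map_eq_one (hp5 : 5 ≤ p) {x : G}
    (hx : x ∈ Subgroup.normalizer (altSubgroup π p : Set G)) (hfx : f x = 1) {u : G}
    (hu : u ∈ altSubgroup π p) : Commute u x := by
  have h : conj u x * u⁻¹ = 1 := by
    apply altSubgroup_injective π hr hρ hs h1 h2 h3 f hfa hfz hp5
      (mul_mem (conj_mem_of_normalizer hx hu) (inv_mem hu))
    rw [map_mul, map_conj, hfx, conj, map_inv]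
    simp
  have h' := mul_inv_eq_one.1 h
  rw [conj, mul_assoc, inv_mul_eq_iff_eq_mul] at h'
  exact h'

variable (hfh : f (π (wh p r)) = 1) {y : G}
  (h4 : conj (π (watilde p) * π (wh p r)) y = π (watilde p))

include hfh h4

/-- The exponent `2 (q + 1) = (p - 1) + 2`, with `q = (p - 1)/2`, places `h` in `b² A`. Then `h ^ q`
lies in `A` and maps to 1, so it is 1. Since `h` commutes with `ã` and `ã ^ 3 = 1`, cubing the
fourth relation yields `h ^ 3 = 1`. Coprimality gives `h = 1`, and the coset `b² A` is trivial. -/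
theorem wh_eq_one_and (hp5 : 5 ≤ p) : π (wh p r) = 1 ∧ π wb ^ 2 ∈ altSubgroup π p := by
  obtain ⟨q, hq⟩ : ∃ q : ℕ, p = 2 * q + 1 := ⟨p / 2, by omega⟩
  have hbn := wb_mem_normalizer (r := r) π hs h1 h2 (by omega)
  have hu : π (wzi p 1) * π (wzi p r) ∈ altSubgroup π p :=
    mul_mem (wzi_mem π h1 h2 1) (wzi_mem π h1 h2 r)
  have hb1 := wb_pow_eq_one π h1 h2
  obtain ⟨v, hv, hhv⟩ : ∃ v ∈ altSubgroup π p, π (wh p r) = π wb ^ 2 * v := by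
    obtain ⟨v, hv, h⟩ := mul_pow_mem (pow_mem hbn 2) hu (q + 1)
    refine ⟨v, hv, ?_⟩
    rw [wh, map_zpow, show ((p : ℤ) + 1) / 2 = (q + 1 : ℕ) by omega, zpow_natCast, mul_assoc,
      map_mul, map_mul, map_zpow, zpow_ofNat, h, ← pow_mul,
      show 2 * (q + 1) = (p - 1) + 2 by omega, pow_add, hb1, one_mul]
  have hhq : π (wh p r) ^ q = 1 := by
    apply altSubgroup_injective π hr hρ hs h1 h2 h3 f hfa hfz hp5
    · obtain ⟨v', hv', h⟩ := mul_pow_mem (pow_mem hbn 2) hv q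
      rw [hhv, h, ← pow_mul, show 2 * q = p - 1 by omega, hb1, one_mul]
      exact hv'
    · rw [map_pow, hfh, one_pow]
  have ha3 : π (watilde p) ∈ altSubgroup π p := by
    rw [watilde, map_conj, conj, map_mul]
    exact mul_mem (mul_mem (inv_mem (mul_mem (wzi_mem π h1 h2 _) (wzi_mem π h1 h2 _)))
      (wzi_mem π h1 h2 _)) (mul_mem (wzi_mem π h1 h2 _) (wzi_mem π h1 h2 _))
  have hhn : π (wh p r) ∈ Subgroup.normalizer (altSubgroup π p : Set G) := by
    rw [hhv]
    exact mul_mem (pow_mem hbn 2) (Subgroup.le_normalizer hv)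
  have hcomm := commute_of_map_eq_one π hr hρ hs h1 h2 h3 f hfa hfz hp5 hhn hfh ha3
  have hat : π (watilde p) ^ 3 = 1 := by
    rw [watilde, map_conj, ← conj_pow, wzi_pow_three π h1 h2 (by omega)]
    simp [conj]
  have hh3 : π (wh p r) ^ 3 = 1 := by
    apply conj_eq_one (h := y)
    calc conj (π (wh p r) ^ 3) y = conj (π (watilde p) ^ 3 * π (wh p r) ^ 3) y := by
          rw [hat, one_mul]
      _ = conj (π (watilde p) * π (wh p r)) y ^ 3 := by rw [← hcomm.mul_pow, conj_pow]
      _ = 1 := by rw [h4, hat]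
  have hone : π (wh p r) = 1 := by
    have hd := Nat.dvd_gcd (orderOf_dvd_of_pow_eq_one hhq) (orderOf_dvd_of_pow_eq_one hh3)
    -- If 3 divided `q`, then `p = 2 q + 1` would be 1 modulo 3, whereas `p ≡ 2`.
    have hcop : Nat.Coprime q 3 := by
      rw [Nat.coprime_comm, Nat.Prime.coprime_iff_not_dvd Nat.prime_three]
      omega
    rw [hcop] at hd
    exact orderOf_eq_one_iff.1 (Nat.dvd_one.1 hd)
  refine ⟨hone, ?_⟩
  rw [hone] at hhv
  rw [eq_inv_of_mul_eq_one_left hhv.symm]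
  exact inv_mem hv

/-- The commutator of `a` and `b²` is `a ^ (r² - 1)`, and it lies in `A` because `b² ∈ A` and `a`
normalizes `A`. As `r` has order `p - 1 > 2`, the exponent is invertible modulo `p`. -/
theorem wa_mem_altSubgroup (hp5 : 5 ≤ p) : π wa ∈ altSubgroup π p := by
  have hb := (wh_eq_one_and π hp hr hρ hs h1 h2 h3 f hfa hfz hfh h4 hp5).2
  have hap := affine_pow_eq_one h1 h2
  have hab : conj (π wa) (π wb ^ 2) = π wa ^ (r * r) := by
    rw [pow_two, conj_mul, affine_conj h1 h2 hs, conj_zpow, affine_conj h1 h2 hs, ← zpow_mul]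
  have hmem : π wa ^ (r * r - 1) ∈ altSubgroup π p := by
    have e : π wa ^ (r * r - 1) = (conj ((π wb ^ 2)) (π wa))⁻¹ * π wb ^ 2 := by
      rw [sub_eq_neg_add, zpow_add, zpow_neg_one, ← hab, conj, conj]
      group
    rw [e]
    exact mul_mem (inv_mem (conj_mem_of_normalizer (wa_mem_normalizer π h1 h2) hb)) hb
  have hne : ((r * r - 1 : ℤ) : ZMod p) ≠ 0 := by
    intro h
    push_cast at h
    rw [← hr] at h
    have h' : ρ ^ 2 = 1 := by
      apply Units.ext
      push_cast
      rw [pow_two]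
      exact sub_eq_zero.1 h
    have := Nat.le_of_dvd two_pos (orderOf_dvd_of_pow_eq_one h')
    rw [orderOf_primitive hρ] at this
    omega
  have hc : ((r * r - 1 : ℤ) * ((((r * r - 1 : ℤ) : ZMod p)⁻¹).val : ℤ) : ℤ) ≡ 1 [ZMOD p] := by
    rw [← ZMod.intCast_eq_intCast_iff]
    push_cast
    rw [ZMod.natCast_zmod_val]
    push_cast at hne
    exact mul_inv_cancel₀ hne
  obtain ⟨m, hm⟩ := hc.dvd
  have e : π wa = (π wa ^ (r * r - 1)) ^ ((((r * r - 1 : ℤ) : ZMod p)⁻¹).val : ℤ) := by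
    rw [← zpow_mul]
    generalize (r * r - 1) * ((((r * r - 1 : ℤ) : ZMod p)⁻¹).val : ℤ) = c at hm
    conv_lhs => rw [← zpow_one (π wa), show (1 : ℤ) = c + p * m by omega, zpow_add, zpow_mul,
      zpow_natCast, hap, one_zpow, mul_one]
  rw [e]
  exact zpow_mem hmem _

/-- Here `g² z = g ^ (p + 1)`, and since 6 divides `p + 1` this is a power of `b² = g ^ 6`. -/
theorem wg_sq_mem_altSubgroup (hp5 : 5 ≤ p) : π wg ^ 2 ∈ altSubgroup π p := by
  have hb := (wh_eq_one_and π hp hr hρ hs h1 h2 h3 f hfa hfz hfh h4 hp5).2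
  have hz : π (wz p) ∈ altSubgroup π p := by
    have := wzi_mem (p := p) π h1 h2 0
    simpa [wzi, conj] using this
  obtain ⟨l, hl⟩ : ∃ l : ℕ, p = 12 * l + 11 := ⟨p / 12, by omega⟩
  have : π wg ^ 2 = (π wb ^ 2) ^ (2 * l + 2) * (π (wz p))⁻¹ := by
    rw [map_wz π (by omega), map_wb π, ← pow_mul, ← pow_mul, eq_mul_inv_iff_mul_eq, ← pow_add]
    congr 1
    omega
  rw [this]
  exact mul_mem (pow_mem hb _) (inv_mem hz)

/-- A homomorphism as in the theorem is injective on `⟨a, g⟩`. -/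
theorem closure_ag_injective (hp5 : 5 ≤ p) (sgn : G →* ℤˣ) (hsgn : ∀ x, f x = 1 → sgn x = 1)
    (hneg : ∃ τ ∈ Subgroup.closure {π wa, π wg}, sgn τ = -1) {x : G}
    (hx : x ∈ Subgroup.closure {π wa, π wg}) (hfx : f x = 1) : x = 1 := by
  have hgn := wg_mem_normalizer π hp hs h1 h2
  have hg2 := wg_sq_mem_altSubgroup π hp hr hρ hs h1 h2 h3 f hfa hfz hfh h4 hp5
  have hle : Subgroup.closure {π wa, π wg} ≤ adjoinSqrt (altSubgroup π p) (π wg) hgn hg2 := by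
    rw [Subgroup.closure_le]
    rintro x (rfl | rfl)
    · exact Or.inl (wa_mem_altSubgroup π hp hr hρ hs h1 h2 h3 f hfa hfz hfh h4 hp5)
    · exact Or.inr ⟨1, one_mem _, (one_mul _).symm⟩
  obtain ⟨τ, hτ, hτs⟩ := hneg
  refine eq_one_of_adjoinSqrt f sgn hsgn ?_ ?_ ⟨τ, hle hτ, hτs⟩ (hle hx) hfx
  · intro u hu
    refine sign_eq_one_of_closure sgn ?_ hu
    rintro _ ⟨i, -, rfl⟩
    exact wzi_pow_three π h1 h2 (by omega) i
  · intro u hu hfu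
    exact altSubgroup_injective π hr hρ hs h1 h2 h3 f hfa hfz hp5 hu hfu

end subgroup_ag

/-! ### Words in `a` and `g` -/

section letters

variable (n p r i j : ℤ)

/-- The words in the letters `a` and `g`. -/
def agWords : Subgroup F := Subgroup.closure {wa, wg}

theorem wa_mem_agWords : wa ∈ agWords := Subgroup.subset_closure (Or.inl rfl)

theorem wg_mem_agWords : wg ∈ agWords := Subgroup.subset_closure (Or.inr rfl)

theorem conj_mem {G : Type} [Group G] {A : Subgroup G} {x h : G} (hx : x ∈ A) (hh : h ∈ A) :
    conj x h ∈ A := mul_mem (mul_mem (inv_mem hh) hx) hh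

theorem wb_mem_agWords : wb ∈ agWords := zpow_mem wg_mem_agWords _

theorem wz_mem_agWords : wz p ∈ agWords := zpow_mem wg_mem_agWords _

theorem wzi_mem_agWords : wzi p i ∈ agWords :=
  conj_mem (wz_mem_agWords p) (zpow_mem wa_mem_agWords _)

theorem wdij_mem_agWords : wdij p i j ∈ agWords :=
  mul_mem (mul_mem (wzi_mem_agWords p i) (inv_mem (wzi_mem_agWords p j))) (wzi_mem_agWords p i)

theorem wcLow_mem_agWords : wcLow p i j ∈ agWords :=
  mul_mem (mul_mem (zpow_mem wa_mem_agWords _)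
    (zpow_mem (mul_mem wa_mem_agWords (wdij_mem_agWords p 0 1)) _)) (zpow_mem wa_mem_agWords _)

theorem wcij_mem_agWords : wcij p i j ∈ agWords := by
  have hz := wz_mem_agWords p
  have hza := mul_mem hz wa_mem_agWords
  have hP : wcP p i ∈ agWords :=
    mul_mem (conj_mem hz (zpow_mem hza _)) (wcLow_mem_agWords p i (p - 2))
  unfold wcij
  split_ifs
  · exact mul_mem hz hP
  · exact mul_mem (conj_mem hz (zpow_mem hza _)) (wcLow_mem_agWords p i (p - 1))
  · exact hP
  · exact wcLow_mem_agWords p i j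

theorem wt_mem_agWords : wt p ∈ agWords :=
  mul_mem (zpow_mem (mul_mem (mul_mem (wcij_mem_agWords p _ _) (inv_mem (wcij_mem_agWords p _ _)))
    (wdij_mem_agWords p _ _)) _) (zpow_mem wb_mem_agWords _)

theorem watilde_mem_agWords : watilde p ∈ agWords :=
  conj_mem (wzi_mem_agWords p _) (mul_mem (wzi_mem_agWords p _) (wzi_mem_agWords p _))

theorem wc_mem_agWords : wc n p ∈ agWords := by
  unfold wc
  split_ifs <;> exact mul_mem (wcij_mem_agWords p _ _) (wt_mem_agWords p)

theorem we_mem_agWords : we n p ∈ agWords := by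
  have h := mul_mem (mul_mem (wz_mem_agWords p) wa_mem_agWords) (wt_mem_agWords p)
  unfold we
  split_ifs <;> exact mul_mem h (inv_mem (wcij_mem_agWords p _ _))

/-- The words in the letters `a`, `g`, `a^y`, `g^y`. -/
def agyWords : Subgroup F := Subgroup.closure {wa, wg, conj wa wy, conj wg wy}

theorem agWords_le_agyWords : agWords ≤ agyWords :=
  Subgroup.closure_mono (by
    rintro x (rfl | rfl)
    · exact Or.inl rfl
    · exact Or.inr (Or.inl rfl))

theorem conj_wy_mem_agyWords {w : F} (hw : w ∈ agWords) : conj w wy ∈ agyWords := by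
  unfold agWords at hw
  induction hw using Subgroup.closure_induction with
  | mem x hx =>
    rcases hx with rfl | rfl
    · exact Subgroup.subset_closure (Or.inr (Or.inr (Or.inl rfl)))
    · exact Subgroup.subset_closure (Or.inr (Or.inr (Or.inr rfl)))
  | one => simp [conj, one_mem]
  | mul u v _ _ hu hv => rw [mul_conj]; exact mul_mem hu hv
  | inv u _ hu => rw [conj_inv]; exact inv_mem hu

/-- In `w` the letter `y` occurs only inside conjugators `h y k` with `h`, `k` words in `a`, `g`,
and `x^(h y k) = ((x^h)^y)^k`. -/
theorem ww_mem_agyWords : ww n p ∈ agyWords := by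
  have hz := wz_mem_agWords p
  have ha := wa_mem_agWords
  have hza := mul_mem hz ha
  have ht := wt_mem_agWords p
  have hd := wdij_mem_agWords p
  have hx : wxtilde n p ∈ agyWords :=
    conj_mem (agWords_le_agyWords (mul_mem (hd _ _) (hd _ _)))
      (mul_mem (conj_wy_mem_agyWords (hd _ _)) (conj_wy_mem_agyWords (hd _ _)))
  have hu : wu p ∈ agyWords := mul_mem (agWords_le_agyWords hza) (conj_wy_mem_agyWords hza)
  have key : ∀ x h k : F, x ∈ agWords → h ∈ agWords → k ∈ agWords →
      conj x (h * wy * k) ∈ agyWords := by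
    intro x h k hx hh hk
    rw [conj_mul, conj_mul]
    exact conj_mem (conj_wy_mem_agyWords (conj_mem hx hh)) (agWords_le_agyWords hk)
  have key' : ∀ x k : F, x ∈ agWords → k ∈ agWords → conj x (wy * k) ∈ agyWords := by
    intro x k hx hk
    have := key x 1 k hx (one_mem _) hk
    rwa [one_mul] at this
  unfold ww
  split_ifs
  · exact key' _ _ ht hz
  · exact mul_mem (key' _ _ hz (inv_mem hz)) (key' _ _ hz hz)
  · refine mul_mem (mul_mem ?_ ?_) (key' _ _ (mul_mem (hd _ _) ht) (inv_mem ha))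
    · rw [mul_assoc]
      exact key _ _ _ hz ha (mul_mem (inv_mem ha) (inv_mem hz))
    · rw [mul_assoc]
      exact key _ _ _ hz ha (mul_mem (inv_mem ha) hz)
  · exact mul_mem (mul_mem (zpow_mem (mul_mem hx (zpow_mem hu _)) _) hx) (zpow_mem hu _)
  · exact mul_mem (mul_mem (mul_mem (key _ _ _ ht hza (inv_mem hza))
      (zpow_mem (mul_mem hx (zpow_mem hu _)) _)) hx) (zpow_mem hu _)

theorem map_mem_closure_ag {G : Type} [Group G] (π : F →* G) {w : F} (hw : w ∈ agWords) :
    π w ∈ Subgroup.closure {π wa, π wg} := by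
  have := Subgroup.mem_map_of_mem π hw
  rw [agWords, MonoidHom.map_closure] at this
  simpa [Set.image_insert_eq] using this

end letters

/-! ### Transpositions in groups of permutations -/

section swaps

variable {D : Subgroup RPerm}

theorem cyc2_self (i : ℤ) : cyc [i, i] = 1 := by
  rw [cyc, List.formPerm_pair, Equiv.swap_self]
  rfl

theorem conj_cyc2_mem {i j : ℤ} {σ : RPerm} (h : cyc [i, j] ∈ D) (hσ : σ ∈ D) :
    cyc [act σ i, act σ j] ∈ D := by
  have := conj_mem h hσ
  rwa [conj_cyc] at this

theorem swap_trans {i j l : ℤ} (hij : cyc [i, j] ∈ D) (hjl : cyc [j, l] ∈ D) :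
    cyc [i, l] ∈ D := by
  by_cases h1 : i = l
  · rw [h1, cyc2_self]
    exact one_mem D
  by_cases h2 : i = j
  · rwa [h2]
  have := conj_cyc2_mem hij hjl
  rwa [act_cyc2, act_cyc2, if_neg h2, if_neg h1, if_pos rfl] at this

theorem swap_of_adjacent {a b : ℤ} (h : ∀ i, a ≤ i → i < b → cyc [i, i + 1] ∈ D) {i j : ℤ}
    (hi : a ≤ i) (hib : i ≤ b) (hj : a ≤ j) (hjb : j ≤ b) : cyc [i, j] ∈ D := by
  have key : ∀ i, a ≤ i → i ≤ b → cyc [a, i] ∈ D := by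
    intro i hi hib
    obtain ⟨m, rfl⟩ : ∃ m : ℕ, i = a + m := ⟨(i - a).toNat, by omega⟩
    clear hi
    induction m with
    | zero =>
      rw [Nat.cast_zero, add_zero, cyc2_self]
      exact one_mem D
    | succ m ih =>
      push_cast at hib ⊢
      have := swap_trans (ih (by omega)) (h (a + m) (by omega) (by omega))
      rwa [add_assoc] at this
  have h1 := key i hi hib
  rw [cyc2_comm] at h1
  exact swap_trans h1 (key j hj hjb)

theorem swap_of_run {a b : ℤ} (hr : cyc (run a b) ∈ D) (h : cyc [a, a + 1] ∈ D) {i j : ℤ}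
    (hi : a ≤ i) (hib : i ≤ b) (hj : a ≤ j) (hjb : j ≤ b) : cyc [i, j] ∈ D := by
  refine swap_of_adjacent (a := a) (b := b) ?_ hi hib hj hjb
  intro i hi hib
  obtain ⟨m, rfl⟩ : ∃ m : ℕ, i = a + m := ⟨(i - a).toNat, by omega⟩
  clear hi
  induction m with
  | zero => simpa using h
  | succ m ih =>
    push_cast at hib ⊢
    have := conj_cyc2_mem (ih (by omega)) hr
    rw [act_cyc_run (by omega), act_cyc_run (by omega), if_neg (by omega), if_pos (by omega),
      if_neg (by omega), if_pos (by omega)] at this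
    rwa [← add_assoc]

theorem cyc3_mul_run {i j : ℤ} (h : i ≤ j - 2) :
    cyc [j - 2, j - 1, j] * cyc (run i (j - 2)) = cyc (run i j) := by
  apply act_ext
  intro x
  simp (disch := omega) only [act_mul, act_cyc_run, act_cyc3]
  split_ifs <;> omega

/-- For `ε = 1`, conjugation by the long cycle shifts `(1,2,3)`. For `ε = 2` the long cycle fixes 1,
so the conjugates are `(1,i,i+1)`; conjugating one of these by the next and inverting produces
`(i,i+1,i+2)`. -/
theorem consecutive_cyc3_mem {ε k : ℤ} (hε : ε = 1 ∨ ε = 2) (h3 : cyc [1, 2, 3] ∈ D)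
    (hc : cyc (run ε k) ∈ D) {i : ℤ} (hi : 1 ≤ i) (hik : i + 2 ≤ k) :
    cyc [i, i + 1, i + 2] ∈ D := by
  rcases hε with rfl | rfl
  · obtain ⟨m, rfl⟩ : ∃ m : ℕ, i = 1 + m := ⟨(i - 1).toNat, by omega⟩
    clear hi
    induction m with
    | zero => simpa using h3
    | succ m ih =>
      push_cast at hik ⊢
      have := conj_mem (ih (by omega)) hc
      simp (disch := omega) only [conj_cyc, List.map_cons, List.map_nil, act_cyc_run, if_neg,
        if_pos] at this
      rwa [← add_assoc, show 1 + (m : ℤ) + 1 + 2 = 1 + m + 2 + 1 by ring]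
  · have key : ∀ i, 2 ≤ i → i + 1 ≤ k → cyc [1, i, i + 1] ∈ D := by
      intro i hi hik
      obtain ⟨m, rfl⟩ : ∃ m : ℕ, i = 2 + m := ⟨(i - 2).toNat, by omega⟩
      clear hi
      induction m with
      | zero => simpa using h3
      | succ m ih =>
        push_cast at hik ⊢
        have := conj_mem (ih (by omega)) hc
        simp (disch := omega) only [conj_cyc, List.map_cons, List.map_nil, act_cyc_run, if_neg,
          if_pos] at this
        rwa [← add_assoc]
    by_cases h1 : i = 1
    · rw [h1]
      simpa using h3
    have := inv_mem (conj_mem (key i (by omega) (by omega)) (key (i + 1) (by omega) (by omega)))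
    convert this using 1
    rw [conj_cyc, ← cyc_reverse]
    apply act_ext
    intro x
    simp (disch := omega) only [List.map_cons, List.map_nil, act_cyc3, if_neg, if_true, List.reverse_cons,
      List.reverse_nil, List.nil_append, List.cons_append]
    split_ifs <;> omega

/-- The 3-cycle `(1,2,3)` and an odd cycle `(1,…,k)` or `(2,…,k)` generate `Sym(1,…,k)`. -/
theorem swap_of_cyc3_of_run {ε k : ℤ} (hε : ε = 1 ∨ ε = 2) (hk : 4 ≤ k) (hodd : Odd (k - ε))
    (h3 : cyc [1, 2, 3] ∈ D) (hc : cyc (run ε k) ∈ D) {i j : ℤ}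
    (hi : 1 ≤ i) (hik : i ≤ k) (hj : 1 ≤ j) (hjk : j ≤ k) : cyc [i, j] ∈ D := by
  have hthree : ∀ i, 1 ≤ i → i + 2 ≤ k → cyc [i, i + 1, i + 2] ∈ D :=
    fun i => consecutive_cyc3_mem hε h3 hc
  -- Removing a consecutive 3-cycle shortens the long cycle by two points at its top. Because `k -
  -- ε` is odd, the process ends at the transposition `(ε, ε+1)`.
  have hdown : ∀ m : ℕ, ε ≤ k - 2 * m → cyc (run ε (k - 2 * m)) ∈ D := by
    intro m
    induction m with
    | zero => intro _; simpa using hc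
    | succ m ih =>
      intro hm
      push_cast at hm ⊢
      have h1 := cyc3_mul_run (i := ε) (j := k - 2 * m) (by omega)
      have h2 := hthree (k - 2 * m - 2) (by omega) (by omega)
      rw [show k - 2 * m - 2 + 1 = k - 2 * m - 1 by ring,
        show k - 2 * m - 2 + 2 = k - 2 * m by ring] at h2
      rw [show k - 2 * ((m : ℤ) + 1) = k - 2 * m - 2 by ring, eq_inv_mul_of_mul_eq h1]
      exact mul_mem (inv_mem h2) (ih (by omega))
  have hbase : cyc [ε, ε + 1] ∈ D := by
    obtain ⟨l, hl⟩ := hodd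
    have := hdown l.toNat (by omega)
    rw [show k - 2 * (l.toNat : ℤ) = ε + 1 by omega, run_eq_cons (by omega), run_self] at this
    exact this
  rcases hε with rfl | rfl
  · exact swap_of_run hc hbase hi hik hj hjk
  · refine swap_of_adjacent (a := 1) (b := k) ?_ hi hik hj hjk
    intro i hi hik
    by_cases h1 : i = 1
    -- The long cycle misses 1; conjugating `(2,3)` by the inverse of `(1,2,3)` yields `(1,2)`.
    · have := conj_cyc2_mem hbase (inv_mem h3)
      rw [← cyc_reverse] at this
      simp (disch := omega) [act_cyc3] at this
      rw [h1]
      simpa using this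
    · exact swap_of_run hc hbase (by omega) (by omega) (by omega) (by omega)

/-- A group that contains the transpositions of an interval contains its symmetric group. -/
theorem mem_of_swaps {a b : ℤ} (h : ∀ i j, a ≤ i → i ≤ b → a ≤ j → j ≤ b → cyc [i, j] ∈ D)
    {σ : RPerm} (hσ : ∀ x, ¬ (a ≤ x ∧ x ≤ b) → act σ x = x) : σ ∈ D := by
  have key : ∀ τ : Equiv.Perm {x : ℤ // a ≤ x ∧ x ≤ b}, op (Equiv.Perm.ofSubtype τ) ∈ D := by
    intro τ
    have : Finite {x : ℤ // a ≤ x ∧ x ≤ b} := (Set.finite_Icc a b).to_subtype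
    induction τ using Equiv.Perm.swap_induction_on with
    | one => simp [one_mem]
    | swap_mul τ x y _ ih =>
      rw [map_mul, op_mul, Equiv.Perm.ofSubtype_swap_eq]
      refine mul_mem ih ?_
      have := h x y x.2.1 x.2.2 y.2.1 y.2.2
      rwa [cyc, List.formPerm_pair] at this
  have hiff : ∀ x, (a ≤ unop σ x ∧ unop σ x ≤ b) ↔ (a ≤ x ∧ x ≤ b) := by
    intro x
    constructor
    · intro h1
      by_contra h2
      have := hσ x h2
      rw [act] at this
      rw [this] at h1
      exact h2 h1
    · intro h1
      by_contra h2
      have := act_injective σ (hσ (unop σ x) h2)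
      rw [this] at h2
      exact h2 h1
  have := key ((unop σ).subtypePerm hiff)
  rwa [Equiv.Perm.ofSubtype_subtypePerm hiff, op_unop] at this
  intro x hx
  by_contra h2
  exact hx (hσ x h2)

theorem cyc3_mul_inv_mul {i j u v : ℤ} (hij : i ≠ j) (hiu : i ≠ u) (hiv : i ≠ v) (hju : j ≠ u)
    (hjv : j ≠ v) (huv : u ≠ v) : cyc [i, u, v] * (cyc [j, u, v])⁻¹ * cyc [i, u, v] =
      cyc [i, j] * cyc [u, v] := by
  rw [← cyc_reverse]
  apply act_ext
  intro x
  simp (disch := omega) only [List.reverse_cons, List.reverse_nil, List.nil_append,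
    List.cons_append, act_mul, act_cyc3, act_cyc2]
  split_ifs <;> omega

/-- The 3-cycles `(i,1,2)` and the transposition `(3,4)` give all transpositions. -/
theorem swap_of_cyc3 {a b : ℤ} (ha : a ≤ 1) (hb : 4 ≤ b)
    (h : ∀ i, a ≤ i → i ≤ b → i ≠ 1 → i ≠ 2 → cyc [i, 1, 2] ∈ D) (h34 : cyc [3, 4] ∈ D) {i j : ℤ}
    (hi : a ≤ i) (hib : i ≤ b) (hj : a ≤ j) (hjb : j ≤ b) : cyc [i, j] ∈ D := by
  have h3 := h 3 (by omega) (by omega) (by omega) (by omega)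
  have h4 := h 4 (by omega) (by omega) (by omega) (by omega)
  -- `(3,1,2)(4,1,2)⁻¹(3,1,2) = (3,4)(1,2)`. With `(1,2)` available, each `(i,1,2)` splits off
  -- `(i,1)`.
  have h12 : cyc [1, 2] ∈ D := by
    have := mul_mem (mul_mem h3 (inv_mem h4)) h3
    rw [cyc3_mul_inv_mul (by omega) (by omega) (by omega) (by omega) (by omega) (by omega)] at this
    exact (Subgroup.mul_mem_cancel_left D h34).1 this
  have key : ∀ i, a ≤ i → i ≤ b → cyc [i, 1] ∈ D := by
    intro i hi hib
    by_cases h1 : i = 1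
    · rw [h1, cyc2_self]
      exact one_mem D
    by_cases h2 : i = 2
    · rwa [h2, cyc2_comm]
    have := h i hi hib h1 h2
    rw [cyc_cons_cons] at this
    exact (Subgroup.mul_mem_cancel_left D h12).1 this
  have hj' := key j hj hjb
  rw [cyc2_comm] at hj'
  exact swap_trans (key i hi hib) hj'

end swaps

/-! ### The amalgam of two symmetric groups -/

section amalgam

variable {G : Type} [Group G] (f : G →* RPerm) (P : Subgroup G)

/-- The homomorphism `f` is injective on the subgroup `P`. -/
def InjOn : Prop := ∀ x ∈ P, f x = 1 → x = 1

/-- The permutation `σ` fixes all points outside the interval `[a, b]`. -/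
def Supp (a b : ℤ) (σ : RPerm) : Prop := ∀ x, ¬ (a ≤ x ∧ x ≤ b) → act σ x = x

theorem Supp.mono {a b a' b' : ℤ} {σ : RPerm} (h : Supp a b σ) (ha : a' ≤ a) (hb : b ≤ b') :
    Supp a' b' σ := fun x hx => h x (by omega)

theorem supp_cyc {a b : ℤ} {l : List ℤ} (h : ∀ x ∈ l, a ≤ x ∧ x ≤ b) : Supp a b (cyc l) :=
  fun x hx => act_cyc_notMem fun hxl => hx (h x hxl)

theorem supp_cyc2 {a b i j : ℤ} (hi : a ≤ i) (hib : i ≤ b) (hj : a ≤ j) (hjb : j ≤ b) :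
    Supp a b (cyc [i, j]) := by
  apply supp_cyc
  simp [hi, hib, hj, hjb]

variable {f P}

theorem InjOn.eq (hP : InjOn f P) {x y : G} (hx : x ∈ P) (hy : y ∈ P) (h : f x = f y) : x = y := by
  have := hP (x * y⁻¹) (mul_mem hx (inv_mem hy)) (by rw [map_mul, map_inv, h, mul_inv_cancel])
  exact mul_inv_eq_one.1 this

theorem InjOn.commute (hP : InjOn f P) {x y : G} (hx : x ∈ P) (hy : y ∈ P)
    (h : Commute (f x) (f y)) : Commute x y :=
  hP.eq (mul_mem hx hy) (mul_mem hy hx) (by rw [map_mul, map_mul, h.eq])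

/-- If `N ≤ P` contains preimages of the transpositions of an interval, it contains all elements
of `P` supported there. -/
theorem InjOn.mem_of_swaps (hP : InjOn f P) {N : Subgroup G} (hN : N ≤ P) {a b : ℤ}
    (h : ∀ i j, a ≤ i → i ≤ b → a ≤ j → j ≤ b → cyc [i, j] ∈ N.map f) {x : G} (hx : x ∈ P)
    (hs : Supp a b (f x)) : x ∈ N := by
  obtain ⟨x', hx', hxx⟩ := Subgroup.mem_map.1 (SymPres.mem_of_swaps h hs)
  rwa [hP.eq hx (hN hx') hxx.symm]

theorem conj_commute {x u : G} (y : G) (h : Commute x u) : Commute (conj x y) (conj u y) := by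
  unfold Commute SemiconjBy at *
  rw [← mul_conj, h, mul_conj]

theorem supp_commute {σ τ : RPerm} {a b : ℤ} (hσ : Supp a b σ)
    (hτ : ∀ x, a ≤ x → x ≤ b → act τ x = x) : Commute σ τ := by
  apply commute_of_act
  intro x
  by_cases hx : a ≤ x ∧ x ≤ b
  · exact Or.inr (hτ x hx.1 hx.2)
  · exact Or.inl (hσ x hx)

/-- Conjugation by `y`. -/
def conjHom (y : G) : G →* G where
  toFun x := conj x y
  map_one' := by simp [conj]
  map_mul' u v := mul_conj u v y

/-! ### Transpositions in `P` and the centralizer of `y` -/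

section generation

variable {p k : ℤ} {y t za τ c : G} (hP : InjOn f P) (hk : 6 ≤ k) (hkp : k ≤ p + 1)
  (ht : t ∈ P) (hft : f t = cyc [p + 1, p + 2])
  (hza : za ∈ P) (hfza : f za = cyc (run 1 (p + 2)))
  (hτ : τ ∈ P) (hfτ : f τ = cyc [1, 2, 3]) (hτy : Commute τ y)
  (hc : c ∈ P) {ε : ℤ} (hε : ε = 1 ∨ ε = 2) (hodd : Odd (k - ε)) (hfc : f c = cyc (run ε k))
  (hcy : Commute c y)

include hk hkp

include ht hft hza hfza in
theorem exists_swap {i j : ℤ} (hi : 1 ≤ i) (hip : i ≤ p + 2) (hj : 1 ≤ j) (hjp : j ≤ p + 2) :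
    ∃ x ∈ P, f x = cyc [i, j] := by
  have h1 : cyc [p + 1, p + 2] ∈ P.map f := ⟨t, ht, hft⟩
  have h2 : cyc (run 1 (p + 2)) ∈ P.map f := ⟨za, hza, hfza⟩
  -- Two shifts along `(1,…,p+2)` take `(p+1,p+2)` to `(1,2)`, passing through `(p+2,1)`.
  have h3 := conj_cyc2_mem (conj_cyc2_mem h1 h2) h2
  simp (disch := omega) only [act_cyc_run, if_pos, if_neg, if_true] at h3
  exact Subgroup.mem_map.1 (swap_of_run h2 h3 hi hip hj hjp)

omit hkp
include hP hτ hfτ hτy hc hε hodd hfc hcy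

/-- The elements of `P` supported on `[1, k]` commute with `y`. -/
theorem commute_y {x : G} (hx : x ∈ P) (hs : Supp 1 k (f x)) : Commute x y := by
  have hmem := hP.mem_of_swaps (N := P ⊓ Subgroup.centralizer {y}) inf_le_left ?_ hx hs
  · exact Subgroup.mem_centralizer_singleton_iff.1 hmem.2
  · have hcen : ∀ {x : G}, x ∈ P → Commute x y → x ∈ P ⊓ Subgroup.centralizer {y} :=
      fun hx h => ⟨hx, Subgroup.mem_centralizer_singleton_iff.2 h⟩
    intro i j hi hik hj hjk
    exact swap_of_cyc3_of_run hε (by omega) hodd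
      (Subgroup.mem_map.2 ⟨τ, hcen hτ hτy, hfτ⟩) (Subgroup.mem_map.2 ⟨c, hcen hc hcy, hfc⟩)
      hi hik hj hjk

end generation

/-! ### Consequences of the relation `[d, e^y] = 1` -/

section commuting

variable {p k : ℤ} {y d e : G} (hP : InjOn f P) (hk : 6 ≤ k) (hkp : k ≤ p + 1)
  (hsw : ∀ i j, 1 ≤ i → i ≤ p + 2 → 1 ≤ j → j ≤ p + 2 → ∃ x ∈ P, f x = cyc [i, j])
  (hy : ∀ x ∈ P, Supp 1 k (f x) → Commute x y)
  (hd : d ∈ P) (hfd : f d = cyc (run 5 (p + 2)))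
  (he : e ∈ P) (hfe : f e = cyc (1 :: 2 :: run (k + 1) (p + 2)) ∨
    f e = cyc (1 :: run (k + 1) (p + 2)))
  (hde : Commute d (conj e y))

include hP hk hkp hsw hy hd hfd he hfe hde

/-- The element `e^y` commutes with the elements of `P` supported on `[3, p + 2]`. -/
theorem commute_conj_e {x : G} (hx : x ∈ P) (hs : Supp 3 (p + 2) (f x)) :
    Commute x (conj e y) := by
  have hcen : ∀ {x : G}, x ∈ P → Commute x (conj e y) →
      x ∈ P ⊓ Subgroup.centralizer {conj e y} :=
    fun hx h => ⟨hx, Subgroup.mem_centralizer_singleton_iff.2 h⟩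
  have hmem := hP.mem_of_swaps (N := P ⊓ Subgroup.centralizer {conj e y}) inf_le_left ?_ hx hs
  · exact Subgroup.mem_centralizer_singleton_iff.1 hmem.2
  -- Transpositions within `3,…,k` are disjoint from `e` and fixed by `y`, so conjugating by `y`
  -- shows that they commute with `e^y`.
  · have hlow : ∀ i j, 3 ≤ i → i ≤ k → 3 ≤ j → j ≤ k →
        cyc [i, j] ∈ (P ⊓ Subgroup.centralizer {conj e y}).map f := by
      intro i j hi hik hj hjk
      obtain ⟨τ, hτ, hfτ⟩ := hsw i j (by omega) (by omega) (by omega) (by omega)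
      refine Subgroup.mem_map.2 ⟨τ, hcen hτ ?_, hfτ⟩
      have h1 : Commute τ e := by
        apply hP.commute hτ he
        rw [hfτ]
        apply supp_commute (supp_cyc2 hi hik hj hjk)
        intro x hx hxk
        rcases hfe with h | h <;> rw [h] <;> apply act_cyc_notMem <;>
          simp only [List.mem_cons, mem_run, not_or] <;> omega
      have h2 : conj τ y = τ :=
        conj_eq_self (hy τ hτ (by rw [hfτ]; exact supp_cyc2 (by omega) hik (by omega) hjk))
      have h3 := conj_commute y h1
      rwa [h2] at h3
    have hd' : cyc (run 5 (p + 2)) ∈ (P ⊓ Subgroup.centralizer {conj e y}).map f :=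
      Subgroup.mem_map.2 ⟨d, hcen hd hde, hfd⟩
    intro i j hi hip hj hjp
    refine swap_of_adjacent (a := 3) (b := p + 2) ?_ hi hip hj hjp
    intro i hi hip
    by_cases h5 : i < 5
    · exact hlow i (i + 1) hi (by omega) (by omega) (by omega)
    -- This uses `k ≥ 6`: the transposition `(5,6)` that starts the run of `d` must already lie in
    -- the range of `hlow`.
    · exact swap_of_run hd' (hlow 5 (5 + 1) (by omega) (by omega) (by omega) (by omega)) (by omega)
        (by omega) (by omega) (by omega)

/-- There are elements `≡ (j,1,2)` of `P` whose conjugates by `y` commute with the elements of `P`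
supported on `[3, p + 2]`. -/
theorem exists_cyc3_commute {j : ℤ} (hj : k + 1 ≤ j) (hjp : j ≤ p + 2) :
    ∃ x ∈ P, f x = cyc [j, 1, 2] ∧
      ∀ v ∈ P, Supp 3 (p + 2) (f v) → Commute v (conj x y) := by
  -- The elements with the wanted property form a subgroup, so it suffices to build `(j,1,2)` from
  -- `e` and `(1,2)`.
  set N : Subgroup G := P ⊓
    (Subgroup.centralizer {v | v ∈ P ∧ Supp 3 (p + 2) (f v)}).comap (conjHom y) with hN
  have hmemN : ∀ x ∈ P, (∀ v ∈ P, Supp 3 (p + 2) (f v) → Commute v (conj x y)) → x ∈ N := by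
    intro x hx h
    refine Subgroup.mem_inf.2 ⟨hx, Subgroup.mem_comap.2 (Subgroup.mem_centralizer_iff.2 ?_)⟩
    rintro v ⟨hv, hvs⟩
    exact h v hv hvs
  have heN : f e ∈ N.map f := Subgroup.mem_map.2 ⟨e, hmemN e he
    fun v hv hvs => commute_conj_e hP hk hkp hsw hy hd hfd he hfe hde hv hvs, rfl⟩
  have h12 : cyc [1, 2] ∈ N.map f := by
    obtain ⟨τ, hτ, hfτ⟩ := hsw 1 2 (by omega) (by omega) (by omega) (by omega)
    refine Subgroup.mem_map.2 ⟨τ, hmemN τ hτ ?_, hfτ⟩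
    intro v hv hvs
    have hτs : Supp 1 k (f τ) := by
      rw [hfτ]
      exact supp_cyc2 (by omega) (by omega) (by omega) (by omega)
    rw [conj_eq_self (hy τ hτ hτs)]
    apply hP.commute hv hτ
    apply supp_commute hvs
    intro x hx _
    rw [hfτ, act_cyc2]
    split_ifs <;> omega
  -- a cycle `(o', k + 1, …, p + 2)` together with the transposition `(1, 2) = (o, o')`
  obtain ⟨o, o', ho, hcyc⟩ : ∃ o o' : ℤ, ((o = 1 ∧ o' = 2) ∨ (o = 2 ∧ o' = 1)) ∧
      cyc (o' :: run (k + 1) (p + 2)) ∈ N.map f := by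
    rcases hfe with h | h
    · refine ⟨1, 2, Or.inl ⟨rfl, rfl⟩, ?_⟩
      rw [h, cyc_cons_cons] at heN
      exact (Subgroup.mul_mem_cancel_right _ h12).1 heN
    · exact ⟨2, 1, Or.inr ⟨rfl, rfl⟩, h ▸ heN⟩
  have hoo : cyc [o, o'] ∈ N.map f := by
    rcases ho with ⟨rfl, rfl⟩ | ⟨rfl, rfl⟩
    · exact h12
    · rwa [cyc2_comm]
  have hact : ∀ x, x = o ∨ x = o' ∨ (k + 1 ≤ x ∧ x < p + 2) →
      act (cyc (o' :: run (k + 1) (p + 2))) x = if x = o' then k + 1 else if x = o then o else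
        x + 1 := by
    intro x hx
    rw [run_eq_cons (show k + 1 ≤ p + 2 by omega), cyc_cons_cons, ← run_eq_cons (by omega), act_mul,
      act_cyc_run (by omega), act_cyc2]
    split_ifs <;> omega
  -- The cycle fixes `o` and runs from `o'` through `k+1,…,p+2`, so conjugating `(o,o')` repeatedly
  -- reaches every `(o,j)`.
  have hstar : ∀ m : ℕ, k + 1 + m ≤ p + 2 → cyc [o, k + 1 + (m : ℤ)] ∈ N.map f := by
    intro m
    induction m with
    | zero =>
      intro _
      have := conj_cyc2_mem hoo hcyc
      rw [hact _ (Or.inl rfl), hact _ (Or.inr (Or.inl rfl)), if_neg (by omega), if_pos rfl,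
        if_pos rfl] at this
      simpa using this
    | succ m ih =>
      intro hm
      push_cast at hm ⊢
      have := conj_cyc2_mem (ih (by omega)) hcyc
      rw [hact _ (Or.inl rfl), hact _ (Or.inr (Or.inr (by omega))), if_neg (by omega), if_pos rfl,
        if_neg (by omega), if_neg (by omega)] at this
      rwa [← add_assoc]
  have hoj : cyc [o, j] ∈ N.map f := by
    have := hstar (j - (k + 1)).toNat (by omega)
    rwa [show k + 1 + ((j - (k + 1)).toNat : ℤ) = j by omega] at this
  have h1j : cyc [j, 1] ∈ N.map f := by
    rw [cyc2_comm]
    rcases ho with ⟨rfl, rfl⟩ | ⟨rfl, rfl⟩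
    · exact hoj
    · exact swap_trans h12 hoj
  have h3 : cyc [j, 1, 2] ∈ N.map f := by
    rw [cyc_cons_cons]
    exact mul_mem h12 h1j
  obtain ⟨x, hx, hfx⟩ := Subgroup.mem_map.1 h3
  exact ⟨x, hx.1, hfx, fun v hv hvs => hx.2 v ⟨hv, hvs⟩⟩

end commuting

/-! ### Carmichael generators spread over `P` and `P^y` -/

section injective

variable {p k : ℤ} {y : G} (hP : InjOn f P) (hk : 6 ≤ k) (hkp : k ≤ p + 1)
  (hfy : f y = ybar p k)
  (hsw : ∀ i j, 1 ≤ i → i ≤ p + 2 → 1 ≤ j → j ≤ p + 2 → ∃ x ∈ P, f x = cyc [i, j])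
  (hy : ∀ x ∈ P, Supp 1 k (f x) → Commute x y)
  (hcyc3 : ∀ j, k + 1 ≤ j → j ≤ p + 2 → ∃ x ∈ P, f x = cyc [j, 1, 2] ∧
      ∀ v ∈ P, Supp 3 (p + 2) (f v) → Commute v (conj x y))

include hP hk hkp hfy hsw hcyc3 in
/-- Elements `≡ (i,1,2)`, in `P` for `i ≥ 3` and in the conjugate of `P` by `y` for `i ≤ 0`. -/
theorem exists_carmichael_generators :
    ∃ z : ℤ → G, (∀ i, 3 ≤ i → i ≤ p + 2 → z i ∈ P) ∧
      (∀ i, -p - 1 + k ≤ i → i ≤ 0 → z i = conj (z (k + 1 - i)) y) ∧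
      (∀ i, -p - 1 + k ≤ i → i ≤ p + 2 → i ≠ 1 → i ≠ 2 → f (z i) = cyc [i, 1, 2]) ∧
      (∀ i, -p - 1 + k ≤ i → i ≤ 0 → ∀ v ∈ P, Supp 3 (p + 2) (f v) → Commute v (z i)) := by
  have hζ : ∀ i, ∃ x, 3 ≤ i → i ≤ p + 2 → x ∈ P ∧ f x = cyc [i, 1, 2] := by
    intro i
    by_cases hi : 3 ≤ i ∧ i ≤ p + 2
    · obtain ⟨x, hx, hfx⟩ := hsw 1 2 (by omega) (by omega) (by omega) (by omega)
      obtain ⟨x', hx', hfx'⟩ := hsw i 1 (by omega) (by omega) (by omega) (by omega)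
      exact ⟨x * x', fun _ _ => ⟨mul_mem hx hx', by
        rw [map_mul, hfx, hfx', cyc_cons_cons i 1 [2]]⟩⟩
    · exact ⟨1, fun h1 h2 => absurd ⟨h1, h2⟩ hi⟩
  choose ζ hζ using hζ
  refine ⟨fun i => if 1 ≤ i then ζ i else conj (ζ (k + 1 - i)) y, ?_, ?_, ?_, ?_⟩
  · intro i h1 h2
    simp only [if_pos (show 1 ≤ i by omega)]
    exact (hζ i h1 h2).1
  · intro i h1 h2
    simp only [if_neg (show ¬ 1 ≤ i by omega), if_pos (show 1 ≤ k + 1 - i by omega)]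
  · intro i h1 h2 h3 h4
    dsimp only
    split_ifs with h5
    · exact (hζ i (by omega) h2).2
    · rw [map_conj, (hζ (k + 1 - i) (by omega) (by omega)).2, hfy, conj_cyc]
      simp (disch := omega) only [List.map_cons, List.map_nil, act_ybar, if_neg]
      rw [if_pos (by omega)]
      congr 2
      ring
  · intro i h1 h2 v hv hvs
    simp only [if_neg (show ¬ 1 ≤ i by omega)]
    obtain ⟨x, hx, hfx, hxc⟩ := hcyc3 (k + 1 - i) (by omega) (by omega)
    have hζi := hζ (k + 1 - i) (by omega) (by omega)
    rw [hP.eq hζi.1 hx (hζi.2.trans hfx.symm)]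
    exact hxc v hv hvs

variable {z : ℤ → G} (hzP : ∀ i, 3 ≤ i → i ≤ p + 2 → z i ∈ P)
  (hzneg : ∀ i, -p - 1 + k ≤ i → i ≤ 0 → z i = conj (z (k + 1 - i)) y)
  (hfz : ∀ i, -p - 1 + k ≤ i → i ≤ p + 2 → i ≠ 1 → i ≠ 2 → f (z i) = cyc [i, 1, 2])
  (hcomm : ∀ i, -p - 1 + k ≤ i → i ≤ 0 → ∀ v ∈ P, Supp 3 (p + 2) (f v) → Commute v (z i))

include hP hk hkp hzP hzneg hfz

theorem generators_pow_three {i : ℤ} (h1 : -p - 1 + k ≤ i) (h2 : i ≤ p + 2) (h3 : i ≠ 1)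
    (h4 : i ≠ 2) : z i ^ 3 = 1 := by
  have hpos : ∀ i, 3 ≤ i → i ≤ p + 2 → z i ^ 3 = 1 := by
    intro i hi hip
    apply hP _ (pow_mem (hzP i hi hip) 3)
    rw [map_pow, hfz i (by omega) hip (by omega) (by omega),
      cyc3_pow (by omega) (by omega) (by omega)]
  by_cases h5 : 1 ≤ i
  · exact hpos i (by omega) h2
  · rw [hzneg i h1 (by omega), ← conj_pow, hpos _ (by omega) (by omega)]
    simp [conj]

include hsw hy hcomm

/-- Two indices of the same sign reduce to a computation in `P`, after undoing a conjugation by `y`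
if they are nonpositive. For `3 ≤ i ≤ k` and `j ≤ 0`, `y` centralizes `z i`, so both elements are
conjugates by `y` of elements of `P`. For larger `i`, conjugation by an element `≡ (3,i)` moves `z
3` to `z i` and fixes `z j`. -/
theorem generators_mul_sq {i j : ℤ} (hi : -p - 1 + k ≤ i) (hip : i ≤ p + 2) (hi1 : i ≠ 1)
    (hi2 : i ≠ 2) (hj : -p - 1 + k ≤ j) (hjp : j ≤ p + 2) (hj1 : j ≠ 1) (hj2 : j ≠ 2)
    (hij : i ≠ j) : (z i * z j) ^ 2 = 1 := by
  have hpos : ∀ i j, 3 ≤ i → i ≤ p + 2 → 3 ≤ j → j ≤ p + 2 → i ≠ j → (z i * z j) ^ 2 = 1 := by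
    intro i j hi hip hj hjp hij
    apply hP _ (pow_mem (mul_mem (hzP i hi hip) (hzP j hj hjp)) 2)
    rw [map_pow, map_mul, hfz i (by omega) hip (by omega) (by omega),
      hfz j (by omega) hjp (by omega) (by omega),
      cyc3_mul_sq hij (by omega) (by omega) (by omega) (by omega) (by omega)]
  have hlow : ∀ i j, 3 ≤ i → i ≤ k → -p - 1 + k ≤ j → j ≤ 0 → (z i * z j) ^ 2 = 1 := by
    intro i j hi hik hj hj0
    have h1 : conj (z i) y = z i := by
      apply conj_eq_self (hy _ (hzP i hi (by omega)) _)
      rw [hfz i (by omega) (by omega) (by omega) (by omega)]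
      apply supp_cyc
      simp only [List.mem_cons, List.not_mem_nil, or_false]
      omega
    rw [hzneg j hj hj0, ← h1, ← mul_conj, ← conj_pow,
      hpos _ _ hi (by omega) (by omega) (by omega) (by omega)]
    simp [conj]
  have hmixed : ∀ i j, 3 ≤ i → i ≤ p + 2 → -p - 1 + k ≤ j → j ≤ 0 → (z i * z j) ^ 2 = 1 := by
    intro i j hi hip hj hj0
    obtain ⟨τ, hτ, hfτ⟩ := hsw 3 i (by omega) (by omega) (by omega) (by omega)
    have h1 : conj (z 3) τ = z i := by
      apply hP.eq (conj_mem (hzP 3 (by omega) (by omega)) hτ) (hzP i hi hip)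
      rw [map_conj, hfz 3 (by omega) (by omega) (by omega) (by omega),
        hfz i (by omega) hip (by omega) (by omega), hfτ, conj_cyc]
      simp (disch := omega) only [List.map_cons, List.map_nil, act_cyc2, if_true, if_neg]
    have h2 : conj (z j) τ = z j := by
      apply conj_eq_self (hcomm j hj hj0 τ hτ _).symm
      rw [hfτ]
      exact supp_cyc2 (by omega) (by omega) (by omega) (by omega)
    rw [← h1, ← h2, ← mul_conj, ← conj_pow, hlow 3 j (by omega) (by omega) hj hj0]
    simp [conj]
  by_cases h1 : 1 ≤ i <;> by_cases h2 : 1 ≤ j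
  · exact hpos i j (by omega) hip (by omega) hjp hij
  · exact hmixed i j (by omega) hip hj (by omega)
  · exact mul_sq_symm (hmixed j i (by omega) hjp hi (by omega))
  · rw [hzneg i hi (by omega), hzneg j hj (by omega), ← mul_conj, ← conj_pow,
      hpos _ _ (by omega) (by omega) (by omega) (by omega) (by omega)]
    simp [conj]

include hfy in
/-- The homomorphism `f` is injective on the group generated by `P` and its conjugate by `y`. -/
theorem amalgam_injective (sgn : G →* ℤˣ)
    (hsgn : ∀ x, f x = 1 → sgn x = 1) (hneg : ∀ x, f x = cyc [3, 4] → sgn x = -1)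
    {S : Set G} (hSP : S ⊆ P) (hS : ∀ x ∈ S, Supp 1 (p + 2) (f x))
    (htop : Subgroup.closure (S ∪ conjHom y '' S) = ⊤) {x : G} (hfx : f x = 1) : x = 1 := by
  set s : Finset ℤ := ((Finset.Icc (-p - 1 + k) (p + 2)).erase 1).erase 2 with hs
  have hmems : ∀ i, i ∈ s ↔ -p - 1 + k ≤ i ∧ i ≤ p + 2 ∧ i ≠ 1 ∧ i ≠ 2 := by
    intro i
    rw [hs, Finset.mem_erase, Finset.mem_erase, Finset.mem_Icc]
    tauto
  obtain ⟨t, ht, hft⟩ := hsw 3 4 (by omega) (by omega) (by omega) (by omega)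
  have hts : Supp 3 (p + 2) (f t) := by
    rw [hft]
    exact supp_cyc2 (by omega) (by omega) (by omega) (by omega)
  have hty : Commute t y := by
    apply hy t ht
    rw [hft]
    exact supp_cyc2 (by omega) (by omega) (by omega) (by omega)
  have htt : t * t = 1 := hP _ (mul_mem ht ht) (by rw [map_mul, hft, cyc2_mul_self])
  have htinv : t⁻¹ = t := inv_eq_of_mul_eq_one_left htt
  have hmemA : ∀ i ∈ s, z i ∈ Subgroup.closure (z '' s) := fun i hi =>
    Subgroup.subset_closure ⟨i, hi, rfl⟩
  -- The element `t ≡ (3,4)` permutes the `z i` with `i ≥ 3`, as seen in `P`, and commutes with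
  -- those for `i ≤ 0`.
  have htn : t ∈ Subgroup.normalizer (Subgroup.closure (z '' s) : Set G) := by
    have key : ∀ x ∈ z '' (s : Set ℤ), conj x t ∈ Subgroup.closure (z '' s) := by
      rintro _ ⟨i, hi, rfl⟩
      have hi' := (hmems i).1 hi
      by_cases h1 : 1 ≤ i
      · have hσ : (if i = 3 then 4 else if i = 4 then 3 else i) ∈ s := by
          rw [hmems]
          split_ifs <;> omega
        have hσ' := (hmems _).1 hσ
        have : conj (z i) t = z (if i = 3 then 4 else if i = 4 then 3 else i) := by
          apply hP.eq (conj_mem (hzP i (by omega) hi'.2.1) ht)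
            (hzP _ (by split_ifs <;> omega) hσ'.2.1)
          rw [map_conj, hfz i hi'.1 hi'.2.1 hi'.2.2.1 hi'.2.2.2,
            hfz _ hσ'.1 hσ'.2.1 hσ'.2.2.1 hσ'.2.2.2, hft, conj_cyc]
          simp (disch := omega) only [List.map_cons, List.map_nil, act_cyc2, if_neg]
        rw [this]
        exact hmemA _ hσ
      · rw [conj_eq_self (hcomm i hi'.1 (by omega) t ht hts).symm]
        exact hmemA i hi
    apply mem_normalizer_closure key
    rwa [htinv]
  have ht2 : t ^ 2 ∈ Subgroup.closure (z '' s) := by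
    rw [pow_two, htt]
    exact one_mem _
  have hKA : ∀ i ∈ s, z i ∈ adjoinSqrt _ t htn ht2 := fun i hi => Or.inl (hmemA i hi)
  have htK : t ∈ adjoinSqrt _ t htn ht2 := Or.inr ⟨1, one_mem _, (one_mul t).symm⟩
  -- Used for `P` on `[1, p+2]` and for `P^y` on `[-p-1+k, k]`: in each case the `z i` belonging to
  -- the interval, with `t`, already give all its transpositions.
  have hsub : ∀ (Q : Subgroup G) (a b : ℤ), InjOn f Q → a ≤ 1 → 4 ≤ b → t ∈ Q →
      (∀ i, a ≤ i → i ≤ b → i ≠ 1 → i ≠ 2 → i ∈ s ∧ z i ∈ Q) → ∀ x ∈ Q, Supp a b (f x) →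
      x ∈ adjoinSqrt _ t htn ht2 := by
    intro Q a b hQ ha hb htQ hzQ x hx hxs
    refine (hQ.mem_of_swaps (N := Q ⊓ adjoinSqrt _ t htn ht2) inf_le_left ?_ hx hxs).2
    intro i j hi hib hj hjb
    refine swap_of_cyc3 ha hb ?_ (Subgroup.mem_map.2 ⟨t, Subgroup.mem_inf.2 ⟨htQ, htK⟩, hft⟩) hi hib hj hjb
    intro i hi hib h1 h2
    have h := hzQ i hi hib h1 h2
    have h' := (hmems i).1 h.1
    exact Subgroup.mem_map.2 ⟨z i, Subgroup.mem_inf.2 ⟨h.2, hKA i h.1⟩, hfz i h'.1 h'.2.1 h1 h2⟩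
  have hK : ∀ x, x ∈ adjoinSqrt _ t htn ht2 := by
    suffices h : Subgroup.closure (S ∪ conjHom y '' S) ≤ adjoinSqrt _ t htn ht2 by
      intro x
      apply h
      rw [htop]
      trivial
    rw [Subgroup.closure_le]
    rintro x (hx | ⟨u, hu, rfl⟩)
    · refine hsub P 1 (p + 2) hP le_rfl (by omega) ht ?_ x (hSP hx) (hS x hx)
      intro i hi hip h1 h2
      exact ⟨(hmems i).2 ⟨by omega, hip, h1, h2⟩, hzP i (by omega) hip⟩
    · refine hsub (P.map (conjHom y)) (-p - 1 + k) k ?_ (by omega) (by omega) ?_ ?_ _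
        (Subgroup.mem_map_of_mem _ (hSP hu)) ?_
      · rintro _ ⟨v, hv, rfl⟩ hfv
        have : f v = 1 := by
          apply conj_eq_one (h := f y)
          rw [← map_conj]
          exact hfv
        rw [hP v hv this, map_one]
      · exact ⟨t, ht, conj_eq_self hty⟩
      · intro i hi hik h1 h2
        refine ⟨(hmems i).2 ⟨hi, by omega, h1, h2⟩, ?_⟩
        by_cases h3 : 1 ≤ i
        · refine ⟨z i, hzP i (by omega) (by omega), conj_eq_self ?_⟩
          apply hy _ (hzP i (by omega) (by omega))
          rw [hfz i (by omega) (by omega) h1 h2]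
          apply supp_cyc
          simp only [List.mem_cons, List.not_mem_nil, or_false]
          omega
        · rw [hzneg i hi (by omega)]
          exact Subgroup.mem_map_of_mem _ (hzP _ (by omega) (by omega))
      · intro x hx
        have hu' := hS u hu
        show act (f (conj u y)) x = x
        rw [map_conj, hfy, conj, act_mul, act_mul, act_ybar_inv (by omega)]
        by_cases h1 : k + 1 ≤ x ∧ x ≤ p + 2
        · rw [if_pos (Or.inr h1), hu' _ (by omega), act_ybar (by omega), if_pos (by omega)]
          ring
        · rw [if_neg (by omega), hu' _ (by omega), act_ybar (by omega), if_neg (by omega)]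
  refine eq_one_of_adjoinSqrt f sgn hsgn ?_ ?_ ⟨t, htK, hneg t hft⟩ (hK x) hfx
  · intro u hu
    refine sign_eq_one_of_closure sgn ?_ hu
    rintro _ ⟨i, hi, rfl⟩
    have hi' := (hmems i).1 hi
    exact generators_pow_three hP hk hkp hzP hzneg hfz hi'.1 hi'.2.1 hi'.2.2.1 hi'.2.2.2
  · intro u hu hfu
    refine carmichael_injective z f (u := 1) (v := 2) (by omega) s (by simp [hs]) (by simp [hs])
      ?_ ?_ ?_ hu hfu
    · intro i hi
      have hi' := (hmems i).1 hi
      exact generators_pow_three hP hk hkp hzP hzneg hfz hi'.1 hi'.2.1 hi'.2.2.1 hi'.2.2.2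
    · intro i hi j hj hij
      have hi' := (hmems i).1 hi
      have hj' := (hmems j).1 hj
      exact generators_mul_sq hP hk hkp hsw hy hzP hzneg hfz hcomm hi'.1 hi'.2.1 hi'.2.2.1
        hi'.2.2.2 hj'.1 hj'.2.1 hj'.2.2.1 hj'.2.2.2 hij
    · intro i hi
      have hi' := (hmems i).1 hi
      exact hfz i hi'.1 hi'.2.1 hi'.2.2.1 hi'.2.2.2

end injective

end amalgam

/-! ### Bit-length -/

section bits

/-- The word `w` is denoted by an expression with at most `K` times as many symbols as `4p` has
binary digits. -/
def Short (p K : ℕ) (w : F) : Prop :=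
  ∃ e : Expr (Fin 3), e.eval = w ∧ e.symbols ≤ K * (4 * p).size

variable {p : ℕ} (hp : 5 ≤ p)

theorem Short.mono {K K' : ℕ} {w : F} (h : Short p K w) (hK : K ≤ K') : Short p K' w := by
  obtain ⟨e, he, hs⟩ := h
  exact ⟨e, he, hs.trans (Nat.mul_le_mul_right _ hK)⟩

theorem Short.mul {K K' : ℕ} {w w' : F} (h : Short p K w) (h' : Short p K' w') :
    Short p (K + K') (w * w') := by
  obtain ⟨e, he, hs⟩ := h
  obtain ⟨e', he', hs'⟩ := h'
  refine ⟨e.mul e', by rw [Expr.eval, he, he'], ?_⟩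
  rw [Expr.symbols, add_mul]
  exact add_le_add hs hs'

theorem Short.bitLength_le {K : ℕ} {w : F} (h : Short p K w) :
    bitLength w ≤ K * (4 * p).size := by
  obtain ⟨e, he, hs⟩ := h
  have : bitLength w ≤ e.symbols := Nat.sInf_le ⟨e, he, rfl⟩
  exact this.trans hs

include hp

theorem size_pos : 1 ≤ (4 * p).size := Nat.size_pos.2 (by omega)

theorem short_letter (i : Fin 3) : Short p 1 (FreeGroup.of i) :=
  ⟨Expr.letter i, rfl, by rw [Expr.symbols, one_mul]; exact size_pos hp⟩

/-- Brackets and sign cost 3 symbols and the digits at most one unit, hence `+ 4`. The range `4p`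
accommodates differences of two indices bounded by `2p`. -/
theorem Short.zpow {K : ℕ} {w : F} (h : Short p K w) {m : ℤ} (hm : -4 * p ≤ m)
    (hm' : m ≤ 4 * p) : Short p (K + 4) (w ^ m) := by
  obtain ⟨e, he, hs⟩ := h
  refine ⟨e.pow m, by rw [Expr.eval, he], ?_⟩
  have h1 := size_pos hp
  have h2 : max 1 m.natAbs.size ≤ (4 * p).size := max_le h1 (Nat.size_le_size (by omega))
  rw [Expr.symbols, add_mul]
  omega

theorem Short.inv {K : ℕ} {w : F} (h : Short p K w) : Short p (K + 4) w⁻¹ := by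
  have := h.zpow hp (m := -1) (by omega) (by omega)
  rwa [zpow_neg_one] at this

theorem Short.conj {K K' : ℕ} {w w' : F} (h : Short p K w) (h' : Short p K' w') :
    Short p (K' + 4 + K + K') (conj w w') := ((h'.inv hp).mul h).mul h'

theorem short_wa : Short p 1 wa := short_letter hp 0

theorem short_wg : Short p 1 wg := short_letter hp 1

theorem short_wy : Short p 1 wy := short_letter hp 2

theorem short_wb : Short p 5 wb := (short_wg hp).zpow hp (by omega) (by omega)

theorem short_wz : Short p 5 (wz p) := (short_wg hp).zpow hp (by omega) (by omega)

theorem short_wzi {i : ℤ} (h : -4 * p ≤ i) (h' : i ≤ 4 * p) : Short p 19 (wzi p i) :=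
  (short_wz hp).conj hp ((short_wa hp).zpow hp h h')

theorem short_wdij {i j : ℤ} (hi : -4 * p ≤ i) (hi' : i ≤ 4 * p) (hj : -4 * p ≤ j)
    (hj' : j ≤ 4 * p) : Short p 61 (wdij p i j) :=
  ((short_wzi hp hi hi').mul ((short_wzi hp hj hj').inv hp)).mul (short_wzi hp hi hi')

theorem short_wcLow {i j : ℤ} (hi : -2 * p ≤ i) (hi' : i ≤ 2 * p) (hj : -2 * p ≤ j)
    (hj' : j ≤ 2 * p) : Short p 76 (wcLow p i j) := by
  have hx : Short p 61 (wx p) :=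
    short_wdij hp (by omega) (by omega) (by omega) (by omega)
  exact (((short_wa hp).zpow hp (by omega) (by omega)).mul
    (((short_wa hp).mul hx).zpow hp (by omega) (by omega))).mul
    ((short_wa hp).zpow hp (by omega) (by omega))

theorem short_wcij {i j : ℤ} (hi : -2 * p ≤ i) (hi' : i ≤ 2 * p) (hj : -2 * p ≤ j)
    (hj' : j ≤ 2 * p) : Short p 110 (wcij p i j) := by
  have hz := short_wz hp
  have hza := hz.mul (short_wa hp)
  have hP : Short p 105 (wcP p i) :=
    (hz.conj hp (hza.zpow hp (by omega) (by omega))).mul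
      (short_wcLow hp hi hi' (by omega) (by omega))
  unfold wcij
  split_ifs
  · exact hz.mul hP
  · exact ((hz.conj hp (hza.zpow hp (by omega) (by omega))).mul
      (short_wcLow hp hi hi' (by omega) (by omega))).mono (by norm_num)
  · exact hP.mono (by norm_num)
  · exact (short_wcLow hp hi hi' hj hj').mono (by norm_num)

theorem short_wt : Short p 298 (wt p) := by
  have h1 : Short p 224 (wcdot p) :=
    (short_wcij hp (by omega) (by omega) (by omega) (by omega)).mul
      ((short_wcij hp (by omega) (by omega) (by omega) (by omega)).inv hp)
  have h2 : Short p 289 (wv p) :=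
    (h1.mul (short_wdij hp (by omega) (by omega) (by omega) (by omega))).zpow hp
      (by omega) (by omega)
  exact h2.mul ((short_wb hp).zpow hp (by omega) (by omega))

theorem short_watilde : Short p 99 (watilde p) :=
  (short_wzi hp (by omega) (by omega)).conj hp
    ((short_wzi hp (by omega) (by omega)).mul (short_wzi hp (by omega) (by omega)))

theorem short_wh {r : ℤ} (hr : |r| ≤ p) : Short p 51 (wh p r) := by
  rw [abs_le] at hr
  exact ((((short_wb hp).zpow hp (by omega) (by omega)).mul
    (short_wzi hp (by omega) (by omega))).mul
    (short_wzi hp (by omega) (by omega))).zpow hp (by omega) (by omega)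

variable {n : ℤ} (hk : 6 ≤ kk n p) (hkp : kk n p ≤ p + 1)

include hk hkp

theorem short_wc : Short p 408 (wc n p) := by
  unfold wc
  split_ifs <;>
  exact (short_wcij hp (by omega) (by omega) (by omega) (by omega)).mul (short_wt hp)

theorem short_we : Short p 418 (we n p) := by
  have h := ((short_wz hp).mul (short_wa hp)).mul (short_wt hp)
  unfold we
  split_ifs <;>
  exact h.mul ((short_wcij hp (by omega) (by omega) (by omega) (by omega)).inv hp)

theorem short_ww : Short p 1500 (ww n p) := by
  have hz := short_wz hp
  have ha := short_wa hp
  have hy := short_wy hp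
  have hza := hz.mul ha
  have ht := short_wt hp
  have hd1 : Short p 61 (wdij p 1 (kk n p + 2)) :=
    short_wdij hp (by omega) (by omega) (by omega) (by omega)
  have hd2 : Short p 61 (wdij p 2 (kk n p + 1)) :=
    short_wdij hp (by omega) (by omega) (by omega) (by omega)
  have hx : Short p 394 (wxtilde n p) :=
    (hd1.mul hd2).conj hp ((hd1.conj hp hy).mul (hd2.conj hp hy))
  have hu : Short p 18 (wu p) := hza.mul (hza.conj hp hy)
  have hxu : Short p 416 (wxtilde n p * wu p ^ (-2 : ℤ)) :=
    hx.mul (hu.zpow hp (by omega) (by omega))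
  unfold ww
  split_ifs
  · exact (ht.conj hp (hy.mul hz)).mono (by norm_num)
  · exact ((hz.conj hp (hy.mul (hz.inv hp))).mul (hz.conj hp (hy.mul hz))).mono (by norm_num)
  · have hd3 : Short p 61 (wdij p 1 p) :=
      short_wdij hp (by omega) (by omega) (by omega) (by omega)
    have hay := (ha.mul hy).mul (ha.inv hp)
    exact (((hz.conj hp (hay.mul (hz.inv hp))).mul (hz.conj hp (hay.mul hz))).mul
      ((hd3.mul ht).conj hp (hy.mul (ha.inv hp)))).mono (by norm_num)
  · exact (((hxu.zpow hp (by omega) (by omega)).mul hx).mul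
      (hu.zpow hp (by omega) (by omega))).mono (by norm_num)
  · exact ((((ht.conj hp ((hza.mul hy).mul (hza.inv hp))).mul
      (hxu.zpow hp (by omega) (by omega))).mul hx).mul
      (hu.zpow hp (by omega) (by omega))).mono (by norm_num)

theorem short_relators {r s : ℤ} (hr : |r| ≤ p) (hs : |s| ≤ p) (i : Fin 7) :
    Short p 2000 (relators n p r s i) := by
  have ha := short_wa hp
  have hb := short_wb hp
  have hy := short_wy hp
  have hz := short_wz hp
  have hc := short_wc hp hk hkp
  have he := (short_we hp hk hkp).conj hp hy
  have hd : Short p 110 (wd p) := short_wcij hp (by omega) (by omega) (by omega) (by omega)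
  have hat := short_watilde hp
  have hw := short_ww hp hk hkp
  have hh := short_wh hp hr
  rw [abs_le] at hs
  fin_cases i
  · exact ((ha.zpow hp (by omega) (by omega)).mul
      ((hb.zpow hp (by omega) (by omega)).inv hp)).mono (by norm_num)
  · exact (((ha.zpow hp (by omega) (by omega)).conj hp hb).mul
      ((ha.zpow hp (by omega) (by omega)).inv hp)).mono (by norm_num)
  · exact ((hz.mul (hz.conj hp ha)).zpow hp (by omega) (by omega)).mono (by norm_num)
  · exact (hat.mul (((hat.mul hh).conj hp hy).inv hp)).mono (by norm_num)
  · exact (hc.mul ((hc.conj hp hy).inv hp)).mono (by norm_num)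
  · exact ((((hd.inv hp).mul (he.inv hp)).mul hd).mul he).mono (by norm_num)
  · exact (hy.mul (hw.inv hp)).mono (by norm_num)

/-- Seven relators at 2000 units each, and three generators absorbed because a unit is at least 1.
-/
theorem presentationBitLength_le {r s : ℤ} (hr : |r| ≤ p) (hs : |s| ≤ p) :
    presentationBitLength (relators n p r s) ≤ 14003 * (4 * p).size := by
  have h1 := size_pos hp
  have h2 : ∑ i, bitLength (relators n p r s i) ≤ ∑ _i : Fin 7, 2000 * (4 * p).size :=
    Finset.sum_le_sum fun i _ => (short_relators hp hk hkp hr hs i).bitLength_le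
  rw [Finset.sum_const, Finset.card_univ, Fintype.card_fin, smul_eq_mul] at h2
  unfold presentationBitLength
  rw [Fintype.card_fin]
  omega

omit hk hkp in
-- With `l + 1` the number of digits, `2 ^ l ≤ 4p ≤ 4n ≤ n²` bounds `l` by a multiple of `log n`,
-- and `log n ≥ log 4` absorbs the extra digit.
theorem size_le_log {n : ℕ} (hn : p ≤ n) : ((4 * p).size : ℝ) ≤ 8 * Real.log n := by
  obtain ⟨l, hl⟩ : ∃ l, (4 * p).size = l + 1 := ⟨(4 * p).size - 1, by have := size_pos hp; omega⟩
  have h1 : 2 ^ l ≤ 4 * p := Nat.lt_size.1 (by omega)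
  have hn5 : (5 : ℝ) ≤ n := by exact_mod_cast hp.trans hn
  have h2 : (2 : ℝ) ^ l ≤ n ^ 2 := by
    have h3 : (2 : ℝ) ^ l ≤ 4 * n := by exact_mod_cast h1.trans (Nat.mul_le_mul_left 4 hn)
    nlinarith
  have h4 := Real.log_le_log (by positivity) h2
  rw [Real.log_pow, Real.log_pow] at h4
  have h5 := Real.log_two_gt_d9
  have h6 : Real.log 4 ≤ Real.log n := Real.log_le_log (by norm_num) (by linarith)
  have h7 : Real.log 4 = 2 * Real.log 2 := by
    rw [show (4 : ℝ) = 2 ^ 2 by norm_num, Real.log_pow]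
    norm_num
  rw [hl]
  push_cast at h4 ⊢
  have h8 : (0 : ℝ) ≤ l := Nat.cast_nonneg l
  nlinarith

end bits

/-! ### The symmetric group on the interval -/

section sym

variable {n p : ℤ}

/-- Permutations of the interval as permutations of `ℤ`. -/
def extendHom : S n p →* RPerm where
  toFun := extend
  map_one' := by simp [extend]
  map_mul' σ τ := by simp [extend]

theorem extendHom_injective : Function.Injective (extendHom (n := n) (p := p)) := by
  intro σ τ h
  exact unop_injective (Equiv.Perm.ofSubtype_injective (op_injective h))

theorem exists_extend {σ : RPerm} (hσ : Supp (-p + kk n p - 1) (p + 2) σ) :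
    ∃ τ : S n p, extendHom τ = σ := by
  have h : σ ∈ (extendHom (n := n) (p := p)).range := by
    refine mem_of_swaps (a := -p + kk n p - 1) (b := p + 2) ?_ hσ
    intro i j hi hip hj hjp
    refine ⟨op (Equiv.swap ⟨i, hi, hip⟩ ⟨j, hj, hjp⟩), ?_⟩
    show op (Equiv.Perm.ofSubtype (Equiv.swap _ _)) = _
    rw [Equiv.Perm.ofSubtype_swap_eq, cyc, List.formPerm_pair]
  exact h

theorem supp_extendHom (τ : S n p) : Supp (-p + kk n p - 1) (p + 2) (extendHom τ) :=
  fun _ hx => Equiv.Perm.ofSubtype_apply_of_not_mem (unop τ) hx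

noncomputable instance intervalFintype : Fintype {x : ℤ // -p + kk n p - 1 ≤ x ∧ x ≤ p + 2} :=
  inferInstanceAs (Fintype (Set.Icc (-p + kk n p - 1) (p + 2)))

/-- The sign of a permutation of the interval. -/
noncomputable def signHom : S n p →* ℤˣ where
  toFun τ := Equiv.Perm.sign (unop τ)
  map_one' := by simp
  map_mul' σ τ := by simp [mul_comm]

theorem signHom_of_swap {τ : S n p} {i j : ℤ} (hi : -p + kk n p - 1 ≤ i) (hip : i ≤ p + 2)
    (hj : -p + kk n p - 1 ≤ j) (hjp : j ≤ p + 2) (hij : i ≠ j) (h : extendHom τ = cyc [i, j]) :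
    signHom τ = -1 := by
  have h1 : τ = op (Equiv.swap ⟨i, hi, hip⟩ ⟨j, hj, hjp⟩) := by
    apply extendHom_injective
    rw [h]
    show _ = op (Equiv.Perm.ofSubtype (Equiv.swap _ _))
    rw [Equiv.Perm.ofSubtype_swap_eq, cyc, List.formPerm_pair]
  have h2 : (⟨i, hi, hip⟩ : {x : ℤ // -p + kk n p - 1 ≤ x ∧ x ≤ p + 2}) ≠ ⟨j, hj, hjp⟩ :=
    fun h => hij (congrArg Subtype.val h)
  rw [h1]
  exact Equiv.Perm.sign_swap h2

/-- The interval has `2p + 4 - k = n` points, and inversion identifies the opposite group with the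
group. -/
theorem nonempty_mulEquiv_fin {n p : ℕ} (hkp : kk n p ≤ p + 1) (hk : 6 ≤ kk n p) :
    Nonempty (S n p ≃* Equiv.Perm (Fin n)) := by
  have hcard : Fintype.card {x : ℤ // -(p : ℤ) + kk n p - 1 ≤ x ∧ x ≤ p + 2} = n := by
    have : Fintype.card (Set.Icc (-(p : ℤ) + kk n p - 1) (p + 2)) = n := by
      have h := Int.card_fintype_Icc_of_le (-(p : ℤ) + kk n p - 1) (p + 2) (by omega)
      have h' : kk n p = 2 * p + 4 - n := rfl
      omega
    exact this
  exact ⟨(MulEquiv.inv' _).symm.trans (Fintype.equivFinOfCardEq hcard).permCongrHom⟩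

end sym

/-! ### The homomorphism onto the symmetric group -/

section main

variable {n p : ℕ} [Fact p.Prime] {r s : ℤ} {ρ : (ZMod p)ˣ} (α : (ZMod p)ˣ)

omit [Fact p.Prime] in
theorem supp_a {lo : ℤ} (hlo : lo ≤ 1) : Supp lo ((p : ℤ) + 2) (cyc (run 1 p)) := by
  apply supp_cyc
  intro x hx
  rw [mem_run] at hx
  omega

theorem supp_mulPerm : Supp 1 p (mulPerm p α) := fun _ hx => act_mulPerm_of_notMem α hx

theorem supp_mul {a b : ℤ} {σ τ : RPerm} (hσ : Supp a b σ) (hτ : Supp a b τ) :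
    Supp a b (σ * τ) := fun x hx => by rw [act_mul, hσ x hx, hτ x hx]

theorem supp_g {lo : ℤ} (hlo : lo ≤ 1) :
    Supp lo ((p : ℤ) + 2) (mulPerm p α * cyc [(p : ℤ), p + 1, p + 2]) := by
  have hp1 := (Fact.out : p.Prime).one_le
  refine supp_mul ((supp_mulPerm α).mono hlo (by omega)) (supp_cyc ?_)
  simp only [List.mem_cons, List.not_mem_nil, or_false]
  omega

omit [Fact p.Prime] in
theorem supp_y {k : ℤ} (hk : 0 ≤ k) :
    Supp (-(p : ℤ) + k - 1) ((p : ℤ) + 2) (ybar p k) := by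
  intro x hx
  rw [act_ybar hk, if_neg (by omega)]

theorem map_g_pow (m : ℕ) : (mulPerm p α * cyc [(p : ℤ), p + 1, p + 2]) ^ m =
    mulPerm p (α ^ m) * cyc [(p : ℤ), p + 1, p + 2] ^ m := by
  have hc : Commute (mulPerm p α) (cyc [(p : ℤ), p + 1, p + 2]) := by
    apply commute_of_act
    intro x
    by_cases hx : 1 ≤ x ∧ x ≤ p
    · by_cases hxp : x = p
      · rw [hxp]
        exact Or.inl (act_mulPerm_self α)
      · right
        apply act_cyc_notMem
        simp only [List.mem_cons, List.not_mem_nil, or_false]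
        omega
    · exact Or.inl (act_mulPerm_of_notMem α hx)
  rw [hc.mul_pow, mulPerm_pow]

theorem exists_word_hom (hk : 6 ≤ kk n p) (hkp : kk n p ≤ p + 1) :
    ∃ φ : F →* S n p, extendHom (φ wa) = cyc (run 1 p) ∧
      extendHom (φ wg) = mulPerm p α * cyc [(p : ℤ), p + 1, p + 2] ∧
      extendHom (φ wy) = ybar p (kk n p) := by
  obtain ⟨A, hA⟩ := exists_extend (n := n) (p := p) (supp_a (p := p) (by omega))
  obtain ⟨g, hg⟩ := exists_extend (n := n) (p := p) (supp_g α (by omega))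
  obtain ⟨Y, hY⟩ := exists_extend (n := n) (p := p) (supp_y (k := kk n p) (by omega))
  refine ⟨FreeGroup.lift ![A, g, Y], ?_, ?_, ?_⟩
  · rw [wa, FreeGroup.lift_apply_of]
    exact hA
  · rw [wg, FreeGroup.lift_apply_of]
    exact hg
  · rw [wy, FreeGroup.lift_apply_of]
    exact hY

section words

variable (φ : F →* RPerm) (hφa : φ wa = cyc (run 1 p))
  (hφg : φ wg = mulPerm p α * cyc [(p : ℤ), p + 1, p + 2]) (hφy : φ wy = ybar p (kk n p))
  (hp11 : 11 ≤ p) (hp : p % 12 = 11)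
  (hk : 6 ≤ kk n p) (hkp : kk n p ≤ p + 1)
  (hr : (ρ : ZMod p) = r) (hρ : Subgroup.zpowers ρ = ⊤) (hs : s * (r - 1) ≡ -1 [ZMOD p])
  (hα : α ^ 3 = ρ)

include hφg

include hα in
theorem map_wb_mulPerm : φ wb = mulPerm p ρ := by
  rw [map_wb, hφg, map_g_pow, hα, cyc3_pow (by omega) (by omega) (by omega), mul_one]

include hp in
-- The power `p - 1` kills the multiplication by `α`; as `p - 1 ≡ 1` mod 3, it keeps the 3-cycle.
theorem map_wz_cyc : φ (wz p) = cyc [(p : ℤ), p + 1, p + 2] := by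
  obtain ⟨l, hl⟩ : ∃ l : ℕ, p - 1 = 3 * l + 1 := ⟨p / 3, by omega⟩
  rw [map_wz _ (by omega), hφg, map_g_pow, pow_pred_eq_one, mulPerm_one, one_mul, hl, pow_succ,
    pow_mul, cyc3_pow (by omega) (by omega) (by omega), one_pow, one_mul]

include hφa hφy hp11 hp hk hkp hr hρ hs hα

theorem map_relators (i : Fin 7) : φ (relators n p r s i) = 1 := by
  have hodd : Odd (p : ℤ) := by rw [Int.odd_iff]; omega
  have ha := hφa
  have hz := map_wz_cyc α φ hφg hp
  have hb := map_wb_mulPerm α φ hφg hα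
  have ht := map_wt φ ha hz hb hρ (by omega) (by omega)
  fin_cases i
  · show φ (wa ^ (p : ℤ) * (wb ^ ((p : ℤ) - 1))⁻¹) = 1
    rw [map_mul, map_inv, map_zpow, map_zpow, ha, hb, pow_a_period (by omega),
      show (p : ℤ) - 1 = (p - 1 : ℕ) by omega, zpow_natCast, mulPerm_pow, pow_pred_eq_one,
      mulPerm_one, inv_one, mul_one]
  · show φ (conj (wa ^ s) wb * (wa ^ (s - 1))⁻¹) = 1
    rw [map_mul, map_inv, map_conj, map_zpow, map_zpow, ha, hb, conj_a_zpow_mulPerm ρ hr hs,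
      mul_inv_cancel]
  · exact map_wz_conj_sq φ ha hz (by omega)
  · show φ (watilde p * (conj (watilde p * wh p r) wy)⁻¹) = 1
    have hat := map_watilde φ ha hz (by omega)
    rw [map_mul, map_inv, map_conj, map_mul, map_wh φ ha hz hb hρ (by omega) (by omega) hr, hat,
      hφy, mul_one, conj_eq_self, mul_inv_cancel]
    refine supp_commute (a := 1) (b := 3) (supp_cyc ?_) ?_
    · simp only [List.mem_cons, List.not_mem_nil, or_false]
      omega
    · intro x h1 h2
      rw [act_ybar (by omega), if_neg (by omega)]
  · show φ (wc n p * (conj (wc n p) wy)⁻¹) = 1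
    rw [map_mul, map_inv, map_conj, hφy, conj_eq_self, mul_inv_cancel]
    refine supp_commute (a := 1) (b := kk n p) ?_ ?_
    · rw [map_wc φ (by omega) hodd ha hz ht hk hkp]
      split_ifs <;>
      · apply supp_cyc
        intro x hx
        rw [mem_run] at hx
        omega
    · intro x h1 h2
      rw [act_ybar (by omega), if_neg (by omega)]
  · show φ (comm (wd p) (conj (we n p) wy)) = 1
    have hd := map_wd φ (by omega) hodd ha hz
    have he := map_we φ (by omega) hodd ha hz ht hk hkp
    have hc : Commute (φ (wd p)) (φ (conj (we n p) wy)) := by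
      refine supp_commute (a := 5) (b := p + 2) ?_ ?_
      · rw [hd]
        apply supp_cyc
        intro x hx
        rwa [mem_run] at hx
      · intro x h1 h2
        -- `y` fixes `[5, k]` pointwise and sends `[k+1, p+2]` to nonpositive points. All of these
        -- are fixed by `e`, so `e^y` fixes the support of `d`.
        have he' : ∀ x : ℤ, x ≤ 0 ∨ 3 ≤ x ∧ x ≤ kk n p → act (φ (we n p)) x = x := by
          intro x hx
          rw [he]
          split_ifs <;> apply act_cyc_notMem <;>
            simp only [List.mem_cons, mem_run, not_or] <;> omega
        rw [map_conj, hφy, conj, act_mul, act_mul, act_ybar_inv (by omega)]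
        by_cases h3 : x ≤ kk n p
        · rw [if_neg (by omega), he' x (Or.inr ⟨by omega, h3⟩), act_ybar (by omega),
            if_neg (by omega)]
        · rw [if_pos (by omega), he' _ (Or.inl (by omega)), act_ybar (by omega), if_pos (by omega)]
          ring
    rw [comm, map_mul, map_mul, map_mul, map_inv, map_inv, mul_assoc, hc.eq]
    group
  · show φ (wy * (ww n p)⁻¹) = 1
    rw [map_mul, map_inv, hφy, map_ww φ (by omega) hodd ha hz ht hφy hk hkp, mul_inv_cancel]

end words

end main

/-! ### Bijectivity of the homomorphism -/

section main

variable {n p : ℕ} [Fact p.Prime] {r s : ℤ} {ρ : (ZMod p)ˣ} (α : (ZMod p)ˣ)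

theorem mul_eq_of_relator {G : Type} [Group G] {π : F →* G} {u v : F} (h : π (u * v⁻¹) = 1) :
    π u = π v := by
  rwa [map_mul, map_inv, mul_inv_eq_one] at h

theorem closure_letters : Subgroup.closure {wa, wg, wy} = ⊤ := by
  rw [← FreeGroup.closure_range_of (Fin 3)]
  congr 1
  ext x
  simp only [Set.mem_insert_iff, Set.mem_singleton_iff, Set.mem_range, wa, wg, wy]
  constructor
  · rintro (rfl | rfl | rfl)
    exacts [⟨0, rfl⟩, ⟨1, rfl⟩, ⟨2, rfl⟩]
  · rintro ⟨i, rfl⟩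
    fin_cases i
    exacts [Or.inl rfl, Or.inr (Or.inl rfl), Or.inr (Or.inr rfl)]

/-- The relation `y = w` makes `a`, `g`, `a^y`, `g^y` generators. -/
theorem closure_conj_eq_top {G : Type} [Group G] {π : F →* G} (hπ : Function.Surjective π)
    {n p : ℤ} (h7 : π wy = π (ww n p)) :
    Subgroup.closure ({π wa, π wg} ∪ conjHom (π wy) '' {π wa, π wg}) = ⊤ := by
  have himg : ({π wa, π wg} ∪ conjHom (π wy) '' {π wa, π wg} : Set G) =
      π '' {wa, wg, conj wa wy, conj wg wy} := by
    have hc : ∀ u, conjHom (π wy) (π u) = π (conj u wy) := fun u => (map_conj π u wy).symm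
    simp only [Set.image_insert_eq, Set.image_singleton, hc]
    ext x
    simp only [Set.mem_union, Set.mem_insert_iff, Set.mem_singleton_iff]
    tauto
  rw [himg, ← MonoidHom.map_closure, eq_top_iff]
  have hwy : π wy ∈ (agyWords).map π := by
    rw [h7]
    exact Subgroup.mem_map_of_mem π (ww_mem_agyWords n p)
  have hle : Subgroup.closure {wa, wg, wy} ≤ ((agyWords).map π).comap π := by
    rw [Subgroup.closure_le]
    rintro x (rfl | rfl | rfl)
    · exact Subgroup.mem_map_of_mem π (agWords_le_agyWords wa_mem_agWords)
    · exact Subgroup.mem_map_of_mem π (agWords_le_agyWords wg_mem_agWords)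
    · exact hwy
  rw [closure_letters] at hle
  intro x _
  obtain ⟨u, rfl⟩ := hπ x
  exact hle (Subgroup.mem_top u)

variable (hp11 : 11 ≤ p) (hp : p % 12 = 11)
  (hk : 6 ≤ kk n p) (hkp : kk n p ≤ p + 1)
  (hr : (ρ : ZMod p) = r) (hρ : Subgroup.zpowers ρ = ⊤) (hs : s * (r - 1) ≡ -1 [ZMOD p])
  (hα : α ^ 3 = ρ)

include hp11 hp hk hkp hr hρ hs hα

/-- A homomorphism from a quotient of the presented group is injective. -/
theorem injective_of_relators {G : Type} [Group G] (π : F →* G) (hπ : Function.Surjective π)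
    (hrel : ∀ i, π (relators n p r s i) = 1) (Ψ : G →* S n p)
    (hφa : extendHom (Ψ (π wa)) = cyc (run 1 p))
    (hφg : extendHom (Ψ (π wg)) = mulPerm p α * cyc [(p : ℤ), p + 1, p + 2])
    (hφy : extendHom (Ψ (π wy)) = ybar p (kk n p)) : Function.Injective Ψ := by
  have hoddp : Odd (p : ℤ) := by rw [Int.odd_iff]; omega
  set f : G →* RPerm := extendHom.comp Ψ with hf
  have ha : (f.comp π) wa = cyc (run 1 p) := hφa
  have hz := map_wz_cyc α (f.comp π) hφg hp
  have hb := map_wb_mulPerm α (f.comp π) hφg hα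
  have ht := map_wt (f.comp π) ha hz hb hρ (by omega) (by omega)
  have hh := map_wh (f.comp π) ha hz hb hρ (by omega) (by omega) hr
  have hat := map_watilde (f.comp π) ha hz (by omega)
  have hc := map_wc (f.comp π) (by omega) hoddp ha hz ht hk hkp
  have hd := map_wd (f.comp π) (by omega) hoddp ha hz
  have he := map_we (f.comp π) (by omega) hoddp ha hz ht hk hkp
  have hza := map_za (f.comp π) ha hz (by omega)
  have h1 : π wa ^ p = π wb ^ (p - 1) := by
    have := mul_eq_of_relator (hrel 0)
    rwa [map_zpow, map_zpow, zpow_natCast, show (p : ℤ) - 1 = (p - 1 : ℕ) by omega,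
      zpow_natCast] at this
  have h2 : conj (π wa ^ s) (π wb) = π wa ^ (s - 1) := by
    have := mul_eq_of_relator (hrel 1)
    rwa [map_conj, map_zpow, map_zpow] at this
  have h3 : (π (wz p) * conj (π (wz p)) (π wa)) ^ 2 = 1 := by
    have : π ((wz p * conj (wz p) wa) ^ (2 : ℤ)) = 1 := hrel 2
    rwa [map_zpow, map_mul, map_conj, zpow_ofNat] at this
  have h4 : conj (π (watilde p) * π (wh p r)) (π wy) = π (watilde p) := by
    have := mul_eq_of_relator (hrel 3)
    rw [map_conj, map_mul] at this
    exact this.symm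
  have h5 : conj (π (wc n p)) (π wy) = π (wc n p) := by
    have := mul_eq_of_relator (hrel 4)
    rw [map_conj] at this
    exact this.symm
  have h6 : Commute (π (wd p)) (conj (π (we n p)) (π wy)) := by
    have : π (comm (wd p) (conj (we n p) wy)) = 1 := hrel 5
    rw [comm, map_mul, map_mul, map_mul, map_inv, map_inv, map_conj, mul_assoc, ← mul_inv_rev,
      inv_mul_eq_one] at this
    exact this.symm
  have h7 : π wy = π (ww n p) := mul_eq_of_relator (hrel 6)
  have hcomm_of_conj : ∀ {x : G}, conj x (π wy) = x → Commute x (π wy) := by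
    intro x hx
    rw [conj, mul_assoc, inv_mul_eq_iff_eq_mul] at hx
    exact hx
  -- `f` takes values in permutations of an infinite set, so the sign is read off from the finite
  -- symmetric group.
  set sgn : G →* ℤˣ := signHom.comp Ψ with hsgn
  have hsgn1 : ∀ x, f x = 1 → sgn x = 1 := by
    intro x hx
    have : Ψ x = 1 := extendHom_injective (hx.trans (map_one _).symm)
    rw [hsgn, MonoidHom.comp_apply, this, map_one]
  have hsgn2 : ∀ x i j, 1 ≤ i → i < j → j ≤ (p : ℤ) + 2 → f x = cyc [i, j] → sgn x = -1 := by
    intro x i j hi hij hj hx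
    exact signHom_of_swap (by omega) (by omega) (by omega) hj hij.ne hx
  have hmem : ∀ {w : F}, w ∈ agWords → π w ∈ Subgroup.closure {π wa, π wg} := map_mem_closure_ag π
  -- Once `h = 1`, the fourth relation says that `ã` commutes with `y`.
  have hwh := (wh_eq_one_and π hp hr hρ hs h1 h2 h3 f hφa hz hh h4 (by omega)).1
  rw [hwh, mul_one] at h4
  have hP : InjOn f (Subgroup.closure {π wa, π wg}) := by
    intro x hx hfx
    refine closure_ag_injective π hp hr hρ hs h1 h2 h3 f hφa hz hh (y := π wy) ?_ (by omega) sgn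
      hsgn1 ⟨π (wt p), hmem (wt_mem_agWords p), hsgn2 _ (p + 1) (p + 2) (by omega) (by omega) le_rfl
      ht⟩ hx hfx
    rw [hwh, mul_one, h4]
  have hsw : ∀ i j : ℤ, 1 ≤ i → i ≤ p + 2 → 1 ≤ j → j ≤ p + 2 →
      ∃ x ∈ Subgroup.closure {π wa, π wg}, f x = cyc [i, j] := by
    intro i j
    exact exists_swap hk hkp (hmem (wt_mem_agWords p)) ht
      (hmem (mul_mem (wz_mem_agWords p) wa_mem_agWords)) hza
  have hkodd := odd_kk_iff (n := n) (p := p)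
  rw [Int.odd_iff] at hkodd
  have hy : ∀ x ∈ Subgroup.closure {π wa, π wg}, Supp 1 (kk n p) (f x) → Commute x (π wy) := by
    intro x hx hxs
    have hcm := hmem (wc_mem_agWords n p)
    by_cases ho : Odd (n : ℤ)
    · rw [if_pos ho] at hc
      refine commute_y hP hk (hmem (watilde_mem_agWords p)) hat (hcomm_of_conj h4) hcm
        (Or.inr rfl) ?_ hc (hcomm_of_conj h5) hx hxs
      have := hkodd.2 ho
      rw [Int.odd_iff]
      omega
    · rw [if_neg ho] at hc
      refine commute_y hP hk (hmem (watilde_mem_agWords p)) hat (hcomm_of_conj h4) hcm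
        (Or.inl rfl) ?_ hc (hcomm_of_conj h5) hx hxs
      have := mt hkodd.1 ho
      rw [Int.odd_iff]
      omega
  have hfe : f (π (we n p)) = cyc (1 :: 2 :: run (kk n p + 1) (p + 2)) ∨
      f (π (we n p)) = cyc (1 :: run (kk n p + 1) (p + 2)) := by
    by_cases ho : Odd (n : ℤ)
    · rw [if_pos ho] at he
      exact Or.inl he
    · rw [if_neg ho] at he
      exact Or.inr he
  have hcyc3 := fun j hj hjp => exists_cyc3_commute hP hk hkp hsw hy
    (hmem (wcij_mem_agWords p 5 (p + 2))) hd (hmem (we_mem_agWords n p)) hfe h6 (j := j) hj hjp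
  obtain ⟨z, hzP, hzneg, hfz, hzc⟩ := exists_carmichael_generators hP hk hkp hφy hsw hcyc3
  rw [injective_iff_map_eq_one]
  intro x hx
  have hfx : f x = 1 := by rw [hf, MonoidHom.comp_apply, hx, map_one]
  refine amalgam_injective hP hk hkp hφy hsw hy hzP hzneg hfz hzc sgn hsgn1
    (fun x hx => hsgn2 x 3 4 (by omega) (by omega) (by omega) hx)
    (S := {π wa, π wg}) Subgroup.subset_closure ?_ (closure_conj_eq_top hπ h7) hfx
  rintro u (rfl | rfl)
  · rw [show f (π wa) = cyc (run 1 p) from ha]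
    exact supp_a le_rfl
  · rw [show f (π wg) = mulPerm p α * cyc [(p : ℤ), p + 1, p + 2] from hφg]
    exact supp_g α le_rfl

omit hs hr in
-- The images of `a` and `g` yield the transpositions of `[1, p+2]`. Conjugation by `y` turns
-- `(k+1,1)` into `(0,1)` and adjacent transpositions above `k` into those at nonpositive points.
theorem surjective_of_images {G : Type} [Group G] (π : F →* G) (Ψ : G →* S n p)
    (hφa : extendHom (Ψ (π wa)) = cyc (run 1 p))
    (hφg : extendHom (Ψ (π wg)) = mulPerm p α * cyc [(p : ℤ), p + 1, p + 2])
    (hφy : extendHom (Ψ (π wy)) = ybar p (kk n p)) : Function.Surjective Ψ := by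
  set f : G →* RPerm := extendHom.comp Ψ with hf
  have ha : (f.comp π) wa = cyc (run 1 p) := hφa
  have hz := map_wz_cyc α (f.comp π) hφg hp
  have hb := map_wb_mulPerm α (f.comp π) hφg hα
  have ht := map_wt (f.comp π) ha hz hb hρ (by omega) (by omega)
  have hza := map_za (f.comp π) ha hz (by omega)
  have hsw : ∀ i j : ℤ, 1 ≤ i → i ≤ p + 2 → 1 ≤ j → j ≤ p + 2 → cyc [i, j] ∈ f.range := by
    intro i j hi hip hj hjp
    obtain ⟨x, -, hx⟩ := exists_swap (f := f) (P := ⊤) hk hkp (Subgroup.mem_top _) ht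
      (Subgroup.mem_top _) hza hi hip hj hjp
    exact ⟨x, hx⟩
  have hyr : ybar p (kk n p) ∈ f.range := ⟨π wy, hφy⟩
  have hall : ∀ i j : ℤ, -p + kk n p - 1 ≤ i → i ≤ p + 2 → -p + kk n p - 1 ≤ j → j ≤ p + 2 →
      cyc [i, j] ∈ f.range := by
    intro i j hi hip hj hjp
    refine swap_of_adjacent (a := -p + kk n p - 1) (b := p + 2) ?_ hi hip hj hjp
    intro i hi hip
    by_cases h1 : 1 ≤ i
    · exact hsw i (i + 1) h1 (by omega) (by omega) (by omega)
    by_cases h0 : i = 0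
    · have := conj_cyc2_mem (hsw (kk n p + 1) 1 (by omega) (by omega) (by omega) (by omega)) hyr
      rw [act_ybar (by omega), act_ybar (by omega), if_pos (by omega), if_neg (by omega)] at this
      rw [h0]
      simpa using this
    · have := conj_cyc2_mem
        (hsw (kk n p + 1 - i) (kk n p - i) (by omega) (by omega) (by omega) (by omega)) hyr
      rw [act_ybar (by omega), act_ybar (by omega), if_pos (by omega), if_pos (by omega)] at this
      convert this using 3
      · ring
      · congr 1
        ring
  intro τ
  obtain ⟨x, hx⟩ : extendHom τ ∈ f.range := mem_of_swaps hall (supp_extendHom τ)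
  exact ⟨x, extendHom_injective hx⟩

theorem exists_mulEquiv : ∃ θ : J n p r s ≃* S n p,
    Rep θ wa (cyc (run 1 p)) ∧
    Rep θ wg (mulPerm p α * cyc [(p : ℤ), p + 1, p + 2]) ∧
    Rep θ wy (ybar p (kk n p)) := by
  obtain ⟨φ, hφa, hφg, hφy⟩ := exists_word_hom (n := n) α hk hkp
  have hrel : ∀ w ∈ Set.range (relators n p r s), φ w = 1 := by
    rintro _ ⟨i, rfl⟩
    apply extendHom_injective
    rw [map_one]
    exact map_relators α (extendHom.comp φ) hφa hφg hφy hp11 hp hk hkp hr hρ hs hα i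
  have hker : Subgroup.normalClosure (Set.range (relators n p r s)) ≤ φ.ker :=
    Subgroup.normalClosure_le_normal hrel
  let Ψ : J n p r s →* S n p := QuotientGroup.lift _ φ hker
  have hinj : Function.Injective Ψ := by
    refine injective_of_relators α hp11 hp hk hkp hr hρ hs hα (PresentedGroup.mk _)
      (PresentedGroup.mk_surjective _) ?_ Ψ hφa hφg hφy
    intro i
    exact PresentedGroup.one_of_mem ⟨i, rfl⟩
  have hsurj : Function.Surjective Ψ :=
    surjective_of_images α hp11 hp hk hkp hρ hα (PresentedGroup.mk _) Ψ hφa hφg hφy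
  exact ⟨MulEquiv.ofBijective Ψ ⟨hinj, hsurj⟩, hφa, hφg, hφy⟩

end main

end SymPres

/-! ### Assembly of the theorem -/

theorem mainTheorem2 :
    ∃ C : ℝ, ∀ (n p : ℕ) [Fact p.Prime] (r s : ℤ) (ρ : (ZMod p)ˣ),
      ((14 ≤ n ∧ n ≤ 20) ∨ (26 ≤ n ∧ n ≤ 44) ∨ 50 ≤ n) →
      p % 12 = 11 → n + 2 ≤ 2 * p → p + 3 ≤ n →
      (ρ : ZMod p) = (r : ZMod p) → Subgroup.zpowers ρ = ⊤ →
      s * (r - 1) ≡ -1 [ZMOD p] →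
      -- bit-length
      (|r| ≤ (p : ℤ) → |s| ≤ (p : ℤ) →
        (SymPres.presentationBitLength (SymPres.relators n p r s) : ℝ) ≤ C * Real.log n) ∧
      -- the group is the symmetric group of degree `n`
      Nonempty (SymPres.J n p r s ≃* Equiv.Perm (Fin n)) ∧
      -- the range of `k`, the existence of `α`, and the letters of `w`
      (6 ≤ SymPres.kk n p ∧ SymPres.kk n p ≤ p + 1 ∧ (n : ℤ) ≡ SymPres.kk n p [ZMOD 2]) ∧
      (∃ α : (ZMod p)ˣ, α ^ 3 = ρ) ∧
      SymPres.ww n p ∈ Subgroup.closure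
        {SymPres.wa, SymPres.wg, SymPres.conj SymPres.wa SymPres.wy,
          SymPres.conj SymPres.wg SymPres.wy} ∧
      -- the isomorphism and the images of the words
      ∀ α : (ZMod p)ˣ, α ^ 3 = ρ →
        ∃ θ : SymPres.J n p r s ≃* SymPres.S n p,
          SymPres.Rep θ SymPres.wa (SymPres.cyc (SymPres.run 1 p)) ∧
          SymPres.Rep θ SymPres.wg (SymPres.mulPerm p α * SymPres.cyc [p, p + 1, p + 2]) ∧
          SymPres.Rep θ SymPres.wy (SymPres.ybar p (SymPres.kk n p)) ∧
          SymPres.Rep θ SymPres.wb (SymPres.mulPerm p ρ) ∧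
          SymPres.Rep θ (SymPres.wz p) (SymPres.cyc [p, p + 1, p + 2]) ∧
          SymPres.Rep θ (SymPres.wh p r) 1 ∧
          (∀ i : ℤ, 1 ≤ i → i ≤ p →
            SymPres.Rep θ (SymPres.wzi p i) (SymPres.cyc [i, p + 1, p + 2])) ∧
          (∀ i j : ℤ, 1 ≤ i → i ≤ p → 1 ≤ j → j ≤ p → i ≠ j →
            SymPres.Rep θ (SymPres.wdij p i j)
              (SymPres.cyc [i, j] * SymPres.cyc [p + 1, p + 2])) ∧
          (∀ i i' : ℤ, i ≡ i' [ZMOD p] →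
            θ (PresentedGroup.mk _ (SymPres.wzi p i)) =
              θ (PresentedGroup.mk _ (SymPres.wzi p i'))) ∧
          (∀ i i' j j' : ℤ, i ≡ i' [ZMOD p] → j ≡ j' [ZMOD p] →
            θ (PresentedGroup.mk _ (SymPres.wdij p i j)) =
              θ (PresentedGroup.mk _ (SymPres.wdij p i' j'))) ∧
          SymPres.Rep θ (SymPres.wx p) (SymPres.cyc [1, p] * SymPres.cyc [p + 1, p + 2]) ∧
          (∀ i j : ℤ, SymPres.CDefined p i j →
            SymPres.Rep θ (SymPres.wcij p i j)
              (SymPres.cyc (SymPres.run i j) * SymPres.cyc [p + 1, p + 2] ^ (j - i))) ∧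
          SymPres.Rep θ (SymPres.wb2 p) (SymPres.negPerm p) ∧
          SymPres.Rep θ (SymPres.wcdot p)
            (SymPres.cyc (SymPres.run 1 (((p : ℤ) - 1) / 2)) *
              SymPres.cyc (SymPres.run (((p : ℤ) + 1) / 2) (p - 1)).reverse) ∧
          SymPres.Rep θ (SymPres.wv p) (SymPres.negPerm p * SymPres.cyc [p + 1, p + 2]) ∧
          SymPres.Rep θ (SymPres.wt p) (SymPres.cyc [p + 1, p + 2]) ∧
          SymPres.Rep θ (SymPres.watilde p) (SymPres.cyc [1, 2, 3]) ∧
          SymPres.Rep θ (SymPres.wc n p)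
            (if Odd n then SymPres.cyc (SymPres.run 2 (SymPres.kk n p))
              else SymPres.cyc (SymPres.run 1 (SymPres.kk n p))) ∧
          SymPres.Rep θ (SymPres.wd p) (SymPres.cyc (SymPres.run 5 (p + 2))) ∧
          SymPres.Rep θ (SymPres.we n p)
            (if Odd n then SymPres.cyc (1 :: 2 :: SymPres.run (SymPres.kk n p + 1) (p + 2))
              else SymPres.cyc (1 :: SymPres.run (SymPres.kk n p + 1) (p + 2))) ∧
          (SymPres.kk n p ≤ p - 2 →
            SymPres.Rep θ (SymPres.wxtilde n p)
              (SymPres.cyc [-1, SymPres.kk n p + 2] * SymPres.cyc [0, SymPres.kk n p + 1]) ∧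
            SymPres.Rep θ (SymPres.wu p)
              (SymPres.cyc (SymPres.run 1 (p + 2)) *
                SymPres.cyc (SymPres.run 1 (SymPres.kk n p) ++
                  (SymPres.run (-p - 1 + SymPres.kk n p) 0).reverse))) ∧
          SymPres.Rep θ (SymPres.ww n p) (SymPres.ybar p (SymPres.kk n p)) := by
  refine ⟨14003 * 8, ?_⟩
  intro n p _ r s ρ hn hp12 hnp hpn hr hρ hs
  have hp11 : 11 ≤ p := by omega
  have hkdef : SymPres.kk n p = 2 * p + 4 - n := rfl
  have hk : 6 ≤ SymPres.kk n p := by omega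
  have hkp : SymPres.kk n p ≤ p + 1 := by omega
  have hα : ∃ α : (ZMod p)ˣ, α ^ 3 = ρ := by
    obtain ⟨l, hl⟩ : ∃ l : ℕ, p = 3 * l + 2 := ⟨p / 3, by omega⟩
    -- With `p = 3 l + 2`, `2 l + 1` inverts 3 modulo `p - 1`, since `3 (2 l + 1) = 2 (p - 1) + 1`.
    refine ⟨ρ ^ (2 * l + 1), ?_⟩
    rw [← pow_mul, show (2 * l + 1) * 3 = (p - 1) * 2 + 1 by omega, pow_succ, pow_mul,
      SymPres.pow_pred_eq_one, one_pow, one_mul]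
  refine ⟨?_, ?_, ⟨hk, hkp, ?_⟩, hα, SymPres.ww_mem_agyWords n p, ?_⟩
  · intro hr' hs'
    have h1 := SymPres.presentationBitLength_le (p := p) (n := n) (by omega) hk hkp hr' hs'
    have h2 := SymPres.size_le_log (p := p) (by omega) (n := n) (by omega)
    have h3 : (SymPres.presentationBitLength (SymPres.relators n p r s) : ℝ) ≤
        14003 * ((4 * p).size : ℝ) := by exact_mod_cast h1
    linarith
  · obtain ⟨α, hα⟩ := hα
    obtain ⟨θ, -⟩ := SymPres.exists_mulEquiv (n := n) α hp11 hp12 hk hkp hr hρ hs hα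
    obtain ⟨η⟩ := SymPres.nonempty_mulEquiv_fin (n := n) (p := p) hkp hk
    exact ⟨θ.trans η⟩
  · rw [hkdef, Int.modEq_iff_dvd]
    exact ⟨p + 2 - n, by ring⟩
  intro α hα
  obtain ⟨θ, ha, hg, hy⟩ := SymPres.exists_mulEquiv (n := n) α hp11 hp12 hk hkp hr hρ hs hα
  obtain ⟨φ, hφ⟩ : ∃ φ : SymPres.F →* SymPres.RPerm, φ = (SymPres.extendHom.comp
    (θ : SymPres.J n p r s →* SymPres.S n p)).comp (PresentedGroup.mk _) := ⟨_, rfl⟩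
  have hrep : ∀ w σ, φ w = σ → SymPres.Rep θ w σ := by
    rintro w _ rfl
    rw [hφ]
    rfl
  have hφa : φ SymPres.wa = SymPres.cyc (SymPres.run 1 p) := by rw [hφ]; exact ha
  have hφg : φ SymPres.wg = SymPres.mulPerm p α * SymPres.cyc [(p : ℤ), p + 1, p + 2] := by
    rw [hφ]; exact hg
  have hφy : φ SymPres.wy = SymPres.ybar p (SymPres.kk n p) := by rw [hφ]; exact hy
  -- Periodicity of `z(i)` and `d(i,j)` need only be checked on permutations of `ℤ`, because
  -- extension by the identity is injective.
  have heq : ∀ u v, φ u = φ v → θ (PresentedGroup.mk _ u) = θ (PresentedGroup.mk _ v) := by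
    intro u v h
    rw [hφ] at h
    exact SymPres.extendHom_injective h
  have hodd : Odd (p : ℤ) := by rw [Int.odd_iff]; omega
  have hz := SymPres.map_wz_cyc α φ hφg hp12
  have hb := SymPres.map_wb_mulPerm α φ hφg hα
  have ht := SymPres.map_wt φ hφa hz hb hρ (by omega) (by omega)
  have hc := SymPres.map_wc φ (by omega) hodd hφa hz ht hk hkp
  have he := SymPres.map_we φ (by omega) hodd hφa hz ht hk hkp
  simp only [Int.odd_coe_nat] at hc he
  refine ⟨θ, ha, hg, hy, hrep _ _ hb, hrep _ _ hz, ?_, ?_, ?_, ?_, ?_, ?_, ?_, ?_, ?_, ?_, ?_, ?_,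
    hrep _ _ hc, ?_, hrep _ _ he, ?_, ?_⟩
  · exact hrep _ _ (SymPres.map_wh φ hφa hz hb hρ (by omega) (by omega) hr)
  · intro i hi hip
    exact hrep _ _ (SymPres.map_wzi φ hφa hz hi hip)
  · intro i j hi hip hj hjp hij
    exact hrep _ _ (SymPres.map_wdij φ hφa hz hi hip hj hjp hij)
  · intro i i' h
    exact heq _ _ (SymPres.map_wzi_congr φ hφa (by omega) h)
  · intro i i' j j' h h'
    exact heq _ _ (SymPres.map_wdij_congr φ hφa (by omega) h h')
  · exact hrep _ _ (SymPres.map_wx φ hφa hz (by omega))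
  · intro i j h
    exact hrep _ _ (SymPres.map_wcij φ hφa hz (by omega) h)
  · exact hrep _ _ (SymPres.map_wb2 φ hb hρ (by omega))
  · exact hrep _ _ (SymPres.map_wcdot φ hφa hz (by omega) (by omega))
  · exact hrep _ _ (SymPres.map_wv φ hφa hz (by omega) (by omega))
  · exact hrep _ _ ht
  · exact hrep _ _ (SymPres.map_watilde φ hφa hz (by omega))
  · exact hrep _ _ (SymPres.map_wd φ (by omega) hodd hφa hz)
  · intro h
    exact ⟨hrep _ _ (SymPres.map_wxtilde φ (by omega) hφa hz hφy hk h),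
      hrep _ _ (SymPres.map_wu φ (by omega) hφa hz hφy hk hkp)⟩
  · exact hrep _ _ (SymPres.map_ww φ (by omega) hodd hφa hz ht hφy hk hkp)
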